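/- Let $0\le d<n$ and let $A=(a_{ij})\in\mathbb{C}^{(d+1)\times(n+1)}$ be a matrix of rank $d+1$ with no zero column. Let $L\subset\mathbb{P}^n$ be its projectivized row span, $\ell_j(t)=\sum_{i=0}^d a_{ij}t_i$ the linear forms given by its columns, and $L^{-1}\subset\mathbb{P}^n$ the Zariski closure of $\{(x_0^{-1}:\dots:x_n^{-1}) : x\in L,\ x_0\cdots x_n\neq 0\}$, with homogeneous ideal $I(L^{-1})\subset\mathbb{C}[x_0,\dots,x_n]$. Let $u\in\mathbb{C}^{n+1}$, let $s\in\mathbb{C}$ be determined by $s+d+1+u_0+\dots+u_n=0$, and put $$f(t,z)=\sum_{j=0}^n \frac{z_j}{\ell_j(t)},\qquad \varphi(t,z)=f^{-s-d-1}\prod_{j=0}^n\ell_j^{u_j},\qquad \Omega(t)=\sum_{i=0}^d(-1)^i t_i\,dt_0\wedge\cdots\wedge\widehat{dt_i}\wedge\cdots\wedge dt_d .$$ Let $D=\mathbb{C}\langle z_j,\partial_j : j=0,\dots,n\rangle$ be the Weyl algebra, let $H_L(u)\subset D$ be the left ideal generated by $$H=\sum_j z_j\partial_j+s,\qquad P_i=\sum_j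 a_{ij}z_j\partial_j^2-\sum_j a_{ij}u_j\partial_j\ (0\le i\le d),\qquad Q_h=h(\partial_0,\dots,\partial_n)\ (h\in I(L^{-1})),$$ and let $M_L(u)=D/H_L(u)$. Let $X=\{(t,z)\in\mathbb{P}^d\times\mathbb{C}^{n+1} : \ell_0(t)\cdots\ell_n(t)\neq0,\ f(t,z)\neq0\}$, let $Z=\mathbb{C}^{n+1}$, let $\Omega^\bullet_{X/Z}$ be the complex of (global, algebraic) relative differential forms, with the twisted differential $\nabla_\omega\eta=d_t\eta+\omega\wedge\eta$, where $\omega=d_t\log\varphi=-(s+d+1)\frac{d_tf}{f}+\sum_j u_j\frac{d_t\ell_j}{\ell_j}$, and let $M_L^{\rm hyp}(u)=H^d(\Omega^\bullet_{X/Z},\nabla_\omega)$. This is a left $D$-module in which $z_j$ acts by multiplication and $\partial_j\bullet[\eta]=\big[\partial_j\eta-(s+d+1)\frac{\partial_jf}{f}\eta\big]$, where $\partial_j\eta$ is obtained by differentiating the coefficients of $\eta$ with respect to $z_j$. 1. There is a unique $D$-module homomorphism $\psi:M_L(u)\to M_L^{\rm hyp}(u)$ with $\psi([1])=[f(t,z)^{d+1}\,\Omega(t)]$.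 2. Every operator in $H_L(u)$ annihilates the Euler integrals $$g_\Gamma(z)=\int_\Gamma f(t,z)^{-s}\prod_{j=0}^n\ell_j(t)^{u_j}\,\Omega(t)=\int_\Gamma\varphi(t,z)\,f(t,z)^{d+1}\,\Omega(t).$$ Precisely: let $z_0\in\mathbb{C}^{n+1}$ and let $\Gamma$ be a twisted $d$-cycle on $X_{z_0}=\{t\in\mathbb{P}^d:\ell_0(t)\cdots\ell_n(t)\ne0,\ f(t,z_0)\neq0\}$, that is, a cycle of smooth singular simplices with coefficients in the rank one local system of branches of $\varphi(\cdot,z_0)$. Define $g_\Gamma(z)$ for $z$ near $z_0$ by continuing these branches in $z$. Then $g_\Gamma$ is holomorphic on an open neighbourhood $W$ of $z_0$, and $P\cdot g_\Gamma=0$ on $W$ for every $P\in H_L(u)$. -/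

import Mathlib

open scoped ContDiff

noncomputable section

namespace MatroidHG

/-! ## The Weyl algebra -/

/-- Defining relations of the Weyl algebra; `Sum.inl i` stands for the variable `z_i` and
`Sum.inr i` for the partial derivative `∂_i`. -/
inductive WeylRel (ι : Type) [DecidableEq ι] :
    FreeAlgebra ℂ (ι ⊕ ι) → FreeAlgebra ℂ (ι ⊕ ι) → Prop
  | var_comm (i j : ι) : WeylRel ι
      (FreeAlgebra.ι ℂ (Sum.inl i) * FreeAlgebra.ι ℂ (Sum.inl j))
      (FreeAlgebra.ι ℂ (Sum.inl j) * FreeAlgebra.ι ℂ (Sum.inl i))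
  | der_comm (i j : ι) : WeylRel ι
      (FreeAlgebra.ι ℂ (Sum.inr i) * FreeAlgebra.ι ℂ (Sum.inr j))
      (FreeAlgebra.ι ℂ (Sum.inr j) * FreeAlgebra.ι ℂ (Sum.inr i))
  | der_var (i j : ι) : WeylRel ι
      (FreeAlgebra.ι ℂ (Sum.inr i) * FreeAlgebra.ι ℂ (Sum.inl j))
      (FreeAlgebra.ι ℂ (Sum.inl j) * FreeAlgebra.ι ℂ (Sum.inr i) + if i = j then 1 else 0)

/-- The Weyl algebra `D = ℂ⟨z_i, ∂_i⟩`, the ring of differential operators with polynomial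
coefficients on the affine space with coordinates `z_i`. -/
def Weyl (ι : Type) [DecidableEq ι] : Type := RingQuot (WeylRel ι)

namespace Weyl

variable {ι : Type} [DecidableEq ι]

instance : Ring (Weyl ι) := inferInstanceAs (Ring (RingQuot (WeylRel ι)))
instance : Algebra ℂ (Weyl ι) := inferInstanceAs (Algebra ℂ (RingQuot (WeylRel ι)))

/-- The quotient map from the free algebra. -/
def mk : FreeAlgebra ℂ (ι ⊕ ι) →ₐ[ℂ] Weyl ι := RingQuot.mkAlgHom ℂ (WeylRel ι)

/-- The operator of multiplication by `z_i`. -/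
def z (i : ι) : Weyl ι := mk (FreeAlgebra.ι ℂ (Sum.inl i))

/-- The operator `∂_i = ∂/∂z_i`. -/
def del (i : ι) : Weyl ι := mk (FreeAlgebra.ι ℂ (Sum.inr i))

/-- The universal property of the Weyl algebra. -/
def lift {B : Type*} [Ring B] [Algebra ℂ B] (x y : ι → B)
    (hxx : ∀ i j, x i * x j = x j * x i) (hyy : ∀ i j, y i * y j = y j * y i)
    (hyx : ∀ i j, y i * x j = x j * y i + if i = j then 1 else 0) : Weyl ι →ₐ[ℂ] B :=
  RingQuot.liftAlgHom ℂ ⟨FreeAlgebra.lift ℂ (Sum.elim x y), by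
    intro a b h
    induction h with
    | var_comm i j => simpa using hxx i j
    | der_comm i j => simpa using hyy i j
    | der_var i j =>
      have := hyx i j
      split_ifs at this ⊢ with h <;> simpa [h] using this⟩

section lift

variable {B : Type*} [Ring B] [Algebra ℂ B] (x y : ι → B)
    (hxx : ∀ i j, x i * x j = x j * x i) (hyy : ∀ i j, y i * y j = y j * y i)
    (hyx : ∀ i j, y i * x j = x j * y i + if i = j then 1 else 0)

@[simp] theorem lift_z (i : ι) : lift x y hxx hyy hyx (z i) = x i := by
  unfold lift z mk
  erw [RingQuot.liftAlgHom_mkAlgHom_apply]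
  simp

@[simp] theorem lift_del (i : ι) : lift x y hxx hyy hyx (del i) = y i := by
  unfold lift del mk
  erw [RingQuot.liftAlgHom_mkAlgHom_apply]
  simp

end lift

theorem induction {C : Weyl ι → Prop} (hc : ∀ c : ℂ, C (algebraMap ℂ _ c)) (hz : ∀ i, C (z i))
    (hd : ∀ i, C (del i)) (hmul : ∀ a b, C a → C b → C (a * b))
    (hadd : ∀ a b, C a → C b → C (a + b)) (P : Weyl ι) : C P := by
  obtain ⟨p, rfl⟩ : ∃ p, mk p = P := RingQuot.mkAlgHom_surjective ℂ (WeylRel ι) P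
  induction p using FreeAlgebra.induction with
  | grade0 r => simpa using hc r
  | grade1 s =>
    cases s with
    | inl i => exact hz i
    | inr i => exact hd i
  | mul a b ha hb => rw [map_mul]; exact hmul _ _ ha hb
  | add a b ha hb => rw [map_add]; exact hadd _ _ ha hb

/-- The constant coefficient operator `h(∂_0, …, ∂_n)` of a polynomial `h`. -/
def ofSymbol {m : ℕ} (h : MvPolynomial (Fin m) ℂ) : Weyl (Fin m) :=
  ∑ e ∈ h.support, h.coeff e • (List.ofFn fun i => del i ^ e i).prod

end Weyl

/-! ## The matroid hypergeometric system -/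

variable {d n : ℕ}

/-- The complex number `s` determined by `s + d + 1 + u_0 + ⋯ + u_n = 0`. -/
def sParam (d : ℕ) (u : Fin (n + 1) → ℂ) : ℂ := -(d + 1 + ∑ j, u j)

/-- The points `(x_0⁻¹, …, x_n⁻¹)`, where `x` runs over the points of the row span of `A` all of
whose coordinates are nonzero. Their classes in projective space are the points of `φ_{-1}(L ∩ T)`;
the reciprocal linear space `L⁻¹` is the Zariski closure of that set. -/
def reciprocalPoints (A : Matrix (Fin (d + 1)) (Fin (n + 1)) ℂ) : Set (Fin (n + 1) → ℂ) :=
  {y | ∃ x ∈ Submodule.span ℂ (Set.range A), (∀ j, x j ≠ 0) ∧ y = fun j => (x j)⁻¹}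

/-- The homogeneous ideal `I(L⁻¹)` of the reciprocal linear space. (A set and its closure have the
same vanishing ideal, and the set above is stable under scaling.) -/
def reciprocalIdeal (A : Matrix (Fin (d + 1)) (Fin (n + 1)) ℂ) :
    Ideal (MvPolynomial (Fin (n + 1)) ℂ) :=
  MvPolynomial.vanishingIdeal ℂ (reciprocalPoints A)

/-- `H = ∑ z_j ∂_j + s`. -/
def opH (d : ℕ) (u : Fin (n + 1) → ℂ) : Weyl (Fin (n + 1)) :=
  ∑ j, Weyl.z j * Weyl.del j + algebraMap ℂ _ (sParam d u)

/-- `P_i = ∑ a_ij z_j ∂_j² - ∑ a_ij u_j ∂_j`. -/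
def opP (A : Matrix (Fin (d + 1)) (Fin (n + 1)) ℂ) (u : Fin (n + 1) → ℂ) (i : Fin (d + 1)) :
    Weyl (Fin (n + 1)) :=
  ∑ j, A i j • (Weyl.z j * Weyl.del j ^ 2) - ∑ j, (A i j * u j) • Weyl.del j

/-- The matroid hypergeometric ideal `H_L(u)`: the left ideal of the Weyl algebra generated by
`H`, the `P_i` and the `Q_h = h(∂)` with `h ∈ I(L⁻¹)`. -/
def hypIdeal (A : Matrix (Fin (d + 1)) (Fin (n + 1)) ℂ) (u : Fin (n + 1) → ℂ) :
    Submodule (Weyl (Fin (n + 1))) (Weyl (Fin (n + 1))) :=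
  Submodule.span _
    ({opH d u} ∪ Set.range (opP A u) ∪ Weyl.ofSymbol '' (reciprocalIdeal A : Set _))

/-- The matroid hypergeometric system `M_L(u) = D / H_L(u)`, a left module over the Weyl algebra. -/
abbrev HypSystem (A : Matrix (Fin (d + 1)) (Fin (n + 1)) ℂ) (u : Fin (n + 1) → ℂ) : Type :=
  Weyl (Fin (n + 1)) ⧸ hypIdeal A u

/-! ## Rational functions in `t` and `z` -/

/-- The polynomial ring `ℂ[t_0, …, t_d, z_0, …, z_n]`. -/
abbrev Poly (d n : ℕ) : Type := MvPolynomial (Fin (d + 1) ⊕ Fin (n + 1)) ℂ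

/-- The field `ℂ(t_0, …, t_d, z_0, …, z_n)`. -/
abbrev RatTZ (d n : ℕ) : Type := FractionRing (Poly d n)

/-- The coordinate `t_a`. -/
def tv (a : Fin (d + 1)) : RatTZ d n := algebraMap (Poly d n) _ (MvPolynomial.X (Sum.inl a))

/-- The coordinate `z_j`. -/
def zv (j : Fin (n + 1)) : RatTZ d n := algebraMap (Poly d n) _ (MvPolynomial.X (Sum.inr j))

section derivation

variable (v : Fin (d + 1) ⊕ Fin (n + 1))

/-- For a derivation `D` of `R` and an `R`-algebra `K`, the ring homomorphism `p ↦ p + ε D p` from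
`R` to the dual numbers over `K`. -/
def jet {R K : Type} [CommRing R] [CommRing K] [Algebra ℂ R] [Algebra R K]
    (D : Derivation ℂ R R) : R →+* TrivSqZeroExt K K where
  toFun p := TrivSqZeroExt.inl (algebraMap R K p) + TrivSqZeroExt.inr (algebraMap R K (D p))
  map_one' := by ext <;> simp
  map_zero' := by ext <;> simp
  map_mul' p q := by
    ext
    · simp
    · simp only [TrivSqZeroExt.snd_add, TrivSqZeroExt.snd_inl, TrivSqZeroExt.snd_inr,
        TrivSqZeroExt.snd_mul, TrivSqZeroExt.fst_add, TrivSqZeroExt.fst_inl,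
        TrivSqZeroExt.fst_inr, Derivation.leibniz, smul_eq_mul, map_add, map_mul,
        MulOpposite.smul_eq_mul_unop, MulOpposite.unop_op]
      ring
  map_add' p q := by
    ext
    · simp
    · simp only [TrivSqZeroExt.snd_add, TrivSqZeroExt.snd_inl, TrivSqZeroExt.snd_inr, map_add]
      ring

theorem fst_jet {R K : Type} [CommRing R] [CommRing K] [Algebra ℂ R] [Algebra R K]
    (D : Derivation ℂ R R) (p : R) : (jet (K := K) D p).fst = algebraMap R K p := by
  simp [jet]

theorem snd_jet {R K : Type} [CommRing R] [CommRing K] [Algebra ℂ R] [Algebra R K]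
    (D : Derivation ℂ R R) (p : R) : (jet (K := K) D p).snd = algebraMap R K (D p) := by
  change (TrivSqZeroExt.inl (algebraMap R K p) + TrivSqZeroExt.inr (algebraMap R K (D p)) :
    TrivSqZeroExt K K).snd = _
  rw [TrivSqZeroExt.snd_add, TrivSqZeroExt.snd_inl, TrivSqZeroExt.snd_inr, zero_add]

/-- The jet of the partial derivative `∂/∂v` of polynomials. -/
def polyJet : Poly d n →+* TrivSqZeroExt (RatTZ d n) (RatTZ d n) := jet (MvPolynomial.pderiv v)

theorem fst_polyJet (p : Poly d n) : (polyJet v p).fst = algebraMap _ _ p := fst_jet _ _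

theorem snd_polyJet (p : Poly d n) :
    (polyJet v p).snd = algebraMap _ _ (MvPolynomial.pderiv v p) := snd_jet _ _

/-- The extension of `polyJet` to rational functions. -/
def ratJet : RatTZ d n →+* TrivSqZeroExt (RatTZ d n) (RatTZ d n) :=
  IsLocalization.lift (M := nonZeroDivisors (Poly d n)) (g := polyJet v) (by
    intro y
    rw [TrivSqZeroExt.isUnit_iff_isUnit_fst]
    rw [fst_polyJet]
    exact IsLocalization.map_units (RatTZ d n) y)

theorem ratJet_algebraMap (p : Poly d n) : ratJet v (algebraMap _ _ p) = polyJet v p :=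
  IsLocalization.lift_eq _ _

theorem fst_ratJet (g : RatTZ d n) : (ratJet v g).fst = g := by
  have : (TrivSqZeroExt.fstHom ℂ (RatTZ d n) (RatTZ d n)).toRingHom.comp (ratJet v)
      = RingHom.id _ := by
    apply IsLocalization.ringHom_ext (nonZeroDivisors (Poly d n))
    refine RingHom.ext fun p => ?_
    simp [ratJet_algebraMap, fst_polyJet]
  exact congrArg (fun F : RatTZ d n →+* RatTZ d n => F g) this

/-- The partial derivative with respect to a coordinate `v`, on rational functions: the derivation
that extends the partial derivative of polynomials. -/
def pd : Derivation ℂ (RatTZ d n) (RatTZ d n) :=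
  Derivation.mk'
    { toFun := fun g => (ratJet v g).snd
      map_add' := by intro a b; simp
      map_smul' := by
        intro c g
        have hc : ratJet v (algebraMap ℂ _ c) = TrivSqZeroExt.inl (algebraMap ℂ _ c) := by
          rw [IsScalarTower.algebraMap_apply ℂ (Poly d n), ratJet_algebraMap]
          ext
          · rw [fst_polyJet, TrivSqZeroExt.fst_inl]
          · rw [snd_polyJet, TrivSqZeroExt.snd_inl, Derivation.map_algebraMap, map_zero]
        simp [Algebra.smul_def, hc] }
    (by
      intro a b
      simp [TrivSqZeroExt.snd_mul, fst_ratJet, mul_comm])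

theorem pd_algebraMap (p : Poly d n) :
    pd v (algebraMap _ _ p) = algebraMap _ _ (MvPolynomial.pderiv v p) := by
  change (ratJet v _).snd = _
  rw [ratJet_algebraMap, snd_polyJet]

@[simp] theorem pd_tv (a : Fin (d + 1)) :
    pd v (tv a : RatTZ d n) = if v = Sum.inl a then 1 else 0 := by
  rw [tv, pd_algebraMap, MvPolynomial.pderiv_X]
  by_cases h : v = Sum.inl a
  · simp [h]
  · simp [h, Ne.symm h]

@[simp] theorem pd_zv (j : Fin (n + 1)) :
    pd v (zv j : RatTZ d n) = if v = Sum.inr j then 1 else 0 := by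
  rw [zv, pd_algebraMap, MvPolynomial.pderiv_X]
  by_cases h : v = Sum.inr j
  · simp [h]
  · simp [h, Ne.symm h]

theorem derivation_ext {D D' : Derivation ℂ (RatTZ d n) (RatTZ d n)}
    (ht : ∀ a, D (tv a) = D' (tv a)) (hz : ∀ j, D (zv j) = D' (zv j)) : D = D' := by
  have hp : ∀ p : Poly d n, D (algebraMap _ _ p) = D' (algebraMap _ _ p) := by
    intro p
    induction p using MvPolynomial.induction_on with
    | C c =>
      rw [← MvPolynomial.algebraMap_eq, ← IsScalarTower.algebraMap_apply]
      simp
    | add p q hp hq => simp [hp, hq]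
    | mul_X p v hp =>
      rw [map_mul, D.leibniz, D'.leibniz, hp]
      cases v with
      | inl a => rw [show (algebraMap _ _ (MvPolynomial.X (Sum.inl a))) = (tv a : RatTZ d n) from rfl,
          ht]
      | inr j => rw [show (algebraMap _ _ (MvPolynomial.X (Sum.inr j))) = (zv j : RatTZ d n) from rfl,
          hz]
  ext g
  obtain ⟨p, q, hq, rfl⟩ := IsFractionRing.div_surjective (A := Poly d n) g
  rw [D.leibniz_div, D'.leibniz_div, hp, hp]

theorem pd_comm (v w : Fin (d + 1) ⊕ Fin (n + 1)) (g : RatTZ d n) :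
    pd v (pd w g) = pd w (pd v g) := by
  have : ⁅pd v, pd w⁆ = (0 : Derivation ℂ (RatTZ d n) (RatTZ d n)) := by
    apply derivation_ext
    · intro a
      rw [Derivation.commutator_apply]
      simp only [pd_tv]
      split_ifs <;> simp
    · intro a
      rw [Derivation.commutator_apply]
      simp only [pd_zv]
      split_ifs <;> simp
  have h := congrArg (fun D : Derivation ℂ (RatTZ d n) (RatTZ d n) => D g) this
  simp only [Derivation.commutator_apply] at h
  simpa [sub_eq_zero] using h

end derivation

/-- The substitution `t ↦ l t`, `z ↦ z` on polynomials. -/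
def polyScale (l : ℂ) : Poly d n →ₐ[ℂ] Poly d n :=
  MvPolynomial.aeval (Sum.elim (fun a => l • MvPolynomial.X (Sum.inl a))
    (fun j => MvPolynomial.X (Sum.inr j)))

theorem polyScale_injective (l : ℂˣ) : Function.Injective (polyScale (d := d) (n := n) (l : ℂ)) := by
  have h : (polyScale (d := d) (n := n) ((l⁻¹ : ℂˣ) : ℂ)).comp (polyScale (l : ℂ))
      = AlgHom.id ℂ _ := by
    ext v
    cases v <;> simp [polyScale, smul_smul]
  intro p q hpq
  have := congrArg (polyScale (d := d) (n := n) ((l⁻¹ : ℂˣ) : ℂ)) hpq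
  rw [← AlgHom.comp_apply, ← AlgHom.comp_apply, h] at this
  simpa using this

/-- The substitution `g(t, z) ↦ g(l t, z)` on rational functions, for `l ∈ ℂ^×`. -/
def scale (l : ℂˣ) : RatTZ d n →+* RatTZ d n :=
  IsFractionRing.lift (A := Poly d n)
    (g := (algebraMap (Poly d n) (RatTZ d n)).comp (polyScale (l : ℂ)).toRingHom)
    ((IsFractionRing.injective (Poly d n) (RatTZ d n)).comp (polyScale_injective l))

theorem scale_algebraMap (l : ℂˣ) (p : Poly d n) :
    scale l (algebraMap _ _ p) = algebraMap _ (RatTZ d n) (polyScale (l : ℂ) p) := by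
  unfold scale
  rw [IsFractionRing.lift_algebraMap]; rfl

@[simp] theorem scale_const (l : ℂˣ) (c : ℂ) :
    scale l (algebraMap ℂ (RatTZ d n) c) = algebraMap ℂ _ c := by
  rw [IsScalarTower.algebraMap_apply ℂ (Poly d n), scale_algebraMap, AlgHom.commutes]

@[simp] theorem scale_smul (l : ℂˣ) (c : ℂ) (g : RatTZ d n) :
    scale l (c • g) = c • scale l g := by
  rw [Algebra.smul_def, map_mul, scale_const, Algebra.smul_def]

@[simp] theorem scale_tv (l : ℂˣ) (a : Fin (d + 1)) :
    scale l (tv a : RatTZ d n) = (l : ℂ) • tv a := by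
  rw [tv, scale_algebraMap]
  simp only [polyScale, MvPolynomial.aeval_X, Sum.elim_inl]
  rw [Algebra.smul_def, map_mul, Algebra.smul_def, ← IsScalarTower.algebraMap_apply]

@[simp] theorem scale_zv (l : ℂˣ) (j : Fin (n + 1)) :
    scale l (zv j : RatTZ d n) = zv j := by
  rw [zv, scale_algebraMap]
  simp [polyScale]

theorem scale_pd_zv (l : ℂˣ) (j : Fin (n + 1)) (g : RatTZ d n) :
    scale l (pd (Sum.inr j) g) = pd (Sum.inr j) (scale l g) := by
  have hp : ∀ p : Poly d n, scale l (pd (Sum.inr j) (algebraMap _ (RatTZ d n) p))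
      = pd (Sum.inr j) (scale l (algebraMap _ (RatTZ d n) p)) := by
    intro p
    induction p using MvPolynomial.induction_on with
    | C c =>
      rw [← MvPolynomial.algebraMap_eq, ← IsScalarTower.algebraMap_apply]
      simp
    | add p q hp hq => simp only [map_add, hp, hq]
    | mul_X p v hp =>
      rw [map_mul, Derivation.leibniz]
      simp only [map_add, map_mul, smul_eq_mul, hp]
      rw [Derivation.leibniz]
      cases v with
      | inl a =>
        rw [show (algebraMap _ _ (MvPolynomial.X (Sum.inl a))) = (tv a : RatTZ d n) from rfl]
        simp
      | inr i =>
        rw [show (algebraMap _ _ (MvPolynomial.X (Sum.inr i))) = (zv i : RatTZ d n) from rfl]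
        simp only [pd_zv, scale_zv, smul_eq_mul]
        split_ifs <;> simp
  obtain ⟨p, q, hq, rfl⟩ := IsFractionRing.div_surjective (A := Poly d n) g
  simp only [Derivation.leibniz_div, map_div₀, map_mul, map_sub, map_pow, map_inv₀, smul_eq_mul, hp]

/-- The linear form `ℓ_j(t) = ∑ a_{ij} t_i`, the `j`-th column of `A`. -/
def ell (A : Matrix (Fin (d + 1)) (Fin (n + 1)) ℂ) (j : Fin (n + 1)) : RatTZ d n :=
  ∑ i, A i j • tv i

/-- The rational function `f(t, z) = ∑ z_j / ℓ_j(t)`. -/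
def fRat (A : Matrix (Fin (d + 1)) (Fin (n + 1)) ℂ) : RatTZ d n := ∑ j, zv j / ell A j

/-- The subring `ℂ[t, z, 1/ℓ_0, …, 1/ℓ_n, 1/f]` of `ℂ(t, z)`: regular functions on the cone
over `X = {(t, z) : ℓ_0(t) ⋯ ℓ_n(t) ≠ 0, f(t, z) ≠ 0}`. -/
def regRing (A : Matrix (Fin (d + 1)) (Fin (n + 1)) ℂ) : Subalgebra ℂ (RatTZ d n) :=
  Algebra.adjoin ℂ
    (Set.range tv ∪ Set.range zv ∪ Set.range (fun j => (ell A j)⁻¹) ∪ {(fRat A)⁻¹})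

/-- The coefficient of `dt_a` in `ω = d_t log φ = -(s+d+1) d_t f / f + ∑ u_j d_t ℓ_j / ℓ_j`, where
`φ = f^{-s-d-1} ∏ ℓ_j^{u_j}`. -/
def omega (A : Matrix (Fin (d + 1)) (Fin (n + 1)) ℂ) (u : Fin (n + 1) → ℂ) (a : Fin (d + 1)) :
    RatTZ d n :=
  -(sParam d u + d + 1) • (pd (Sum.inl a) (fRat A) / fRat A)
    + ∑ j, u j • (pd (Sum.inl a) (ell A j) / ell A j)

/-- The logarithmic derivative `∂_j φ / φ = -(s+d+1) ∂_j f / f` with respect to `z_j`. -/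
def kappa (A : Matrix (Fin (d + 1)) (Fin (n + 1)) ℂ) (u : Fin (n + 1) → ℂ) (j : Fin (n + 1)) :
    RatTZ d n :=
  -(sParam d u + d + 1) • (pd (Sum.inr j) (fRat A) / fRat A)

section lemmas

variable (A : Matrix (Fin (d + 1)) (Fin (n + 1)) ℂ) (u : Fin (n + 1) → ℂ)

theorem pd_z_ell (i j : Fin (n + 1)) : pd (Sum.inr i) (ell A j) = 0 := by
  simp [ell]

theorem pd_t_ell (a : Fin (d + 1)) (j : Fin (n + 1)) :
    pd (Sum.inl a) (ell A j) = algebraMap ℂ _ (A a j) := by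
  simp [ell, Algebra.smul_def]

theorem pd_z_fRat (i : Fin (n + 1)) : pd (Sum.inr i) (fRat A) = (ell A i)⁻¹ := by
  simp only [fRat, map_sum]
  rw [Finset.sum_eq_single i]
  · rw [Derivation.leibniz_div_const _ _ _ (pd_z_ell A i i)]
    simp
  · intro b _ hb
    rw [Derivation.leibniz_div_const _ _ _ (pd_z_ell A i b)]
    simp [hb.symm]
  · simp

theorem pd_dlog_comm (v w : Fin (d + 1) ⊕ Fin (n + 1)) (g : RatTZ d n) :
    pd v (pd w g / g) = pd w (pd v g / g) := by
  rw [Derivation.leibniz_div, Derivation.leibniz_div, pd_comm v w]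
  simp only [smul_eq_mul]
  ring

theorem pd_omega (a : Fin (d + 1)) (j : Fin (n + 1)) :
    pd (Sum.inr j) (omega A u a) = pd (Sum.inl a) (kappa A u j) := by
  have h : ∀ i, pd (Sum.inr j) (pd (Sum.inl a) (ell A i) / ell A i) = 0 := by
    intro i
    rw [pd_dlog_comm, pd_z_ell]; simp
  simp only [omega, kappa, map_add, map_sum, Derivation.map_smul, h]
  rw [pd_dlog_comm]; simp

theorem pd_kappa (i j : Fin (n + 1)) :
    pd (Sum.inr i) (kappa A u j) = pd (Sum.inr j) (kappa A u i) := by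
  simp only [kappa, Derivation.map_smul]
  rw [pd_dlog_comm]

theorem zv_mem (j : Fin (n + 1)) : zv j ∈ regRing A :=
  Algebra.subset_adjoin (Or.inl (Or.inl (Or.inr ⟨j, rfl⟩)))

theorem tv_mem (a : Fin (d + 1)) : tv a ∈ regRing A :=
  Algebra.subset_adjoin (Or.inl (Or.inl (Or.inl ⟨a, rfl⟩)))

theorem ell_inv_mem (j : Fin (n + 1)) : (ell A j)⁻¹ ∈ regRing A :=
  Algebra.subset_adjoin (Or.inl (Or.inr ⟨j, rfl⟩))

theorem fRat_inv_mem : (fRat A)⁻¹ ∈ regRing A := Algebra.subset_adjoin (Or.inr rfl)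

theorem fRat_mem : fRat A ∈ regRing A := by
  refine sum_mem fun j _ => ?_
  rw [div_eq_mul_inv]
  exact mul_mem (zv_mem A j) (ell_inv_mem A j)

theorem kappa_mem (j : Fin (n + 1)) : kappa A u j ∈ regRing A := by
  refine Subalgebra.smul_mem _ ?_ _
  rw [pd_z_fRat, div_eq_mul_inv]
  exact mul_mem (ell_inv_mem A j) (fRat_inv_mem A)

theorem pd_z_mem (j : Fin (n + 1)) {g : RatTZ d n} (hg : g ∈ regRing A) :
    pd (Sum.inr j) g ∈ regRing A := by
  induction hg using Algebra.adjoin_induction with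
  | mem x hx =>
    rcases hx with ((⟨a, rfl⟩ | ⟨i, rfl⟩) | ⟨i, rfl⟩) | rfl
    · simp
    · simp only [pd_zv]
      split_ifs
      exacts [one_mem _, zero_mem _]
    · simp [Derivation.leibniz_inv, pd_z_ell]
    · rw [Derivation.leibniz_inv, pd_z_fRat, smul_eq_mul]
      exact mul_mem (neg_mem (pow_mem (fRat_inv_mem A) 2)) (ell_inv_mem A j)
  | algebraMap r => simp
  | add x y _ _ hx hy => rw [map_add]; exact add_mem hx hy
  | mul x y hx' hy' hx hy =>
    rw [Derivation.leibniz]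
    exact add_mem (mul_mem hx' hy) (mul_mem hy' hx)

theorem scale_ell (l : ℂˣ) (j : Fin (n + 1)) : scale l (ell A j) = (l : ℂ) • ell A j := by
  simp only [ell, map_sum, scale_smul, scale_tv, Finset.smul_sum]
  exact Finset.sum_congr rfl fun a _ => smul_comm _ _ _

theorem scale_fRat (l : ℂˣ) : scale l (fRat A) = ((l⁻¹ : ℂˣ) : ℂ) • fRat A := by
  simp only [fRat, map_sum, map_div₀, scale_zv, scale_ell, Finset.smul_sum]
  refine Finset.sum_congr rfl fun j _ => ?_
  rw [Algebra.smul_def, Algebra.smul_def, div_eq_mul_inv, div_eq_mul_inv, mul_inv,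
    Units.val_inv_eq_inv_val, map_inv₀]
  ring

theorem scale_kappa (l : ℂˣ) (j : Fin (n + 1)) : scale l (kappa A u j) = kappa A u j := by
  simp only [kappa, scale_smul, map_div₀, scale_pd_zv, scale_fRat, Derivation.map_smul]
  rw [Algebra.smul_def ((l⁻¹ : ℂˣ) : ℂ), Algebra.smul_def ((l⁻¹ : ℂˣ) : ℂ), mul_div_mul_left]
  exact (map_ne_zero _).2 (Units.ne_zero _)

end lemmas

/-! ## Relative differential forms and the twisted de Rham complex -/

/-- Differential forms `η = ∑_I g_I ⋀_{i ∈ I} dt_i` in `dt_0, …, dt_d` with coefficients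
`g_I ∈ ℂ(t, z)`; the form `η` is recorded as the function `I ↦ g_I`. (The parameters `A`, `u`
only matter for the module structure over the Weyl algebra that is introduced below.) -/
def Forms (_A : Matrix (Fin (d + 1)) (Fin (n + 1)) ℂ) (_u : Fin (n + 1) → ℂ) : Type :=
  Finset (Fin (d + 1)) → RatTZ d n

variable (A : Matrix (Fin (d + 1)) (Fin (n + 1)) ℂ) (u : Fin (n + 1) → ℂ)

instance : AddCommGroup (Forms A u) :=
  inferInstanceAs (AddCommGroup (Finset (Fin (d + 1)) → RatTZ d n))
instance : Module ℂ (Forms A u) :=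
  inferInstanceAs (Module ℂ (Finset (Fin (d + 1)) → RatTZ d n))

/-- Multiplication of forms by `z_j`. -/
def formZ (j : Fin (n + 1)) : Module.End ℂ (Forms A u) where
  toFun η := fun I => zv j * η I
  map_add' _ _ := funext fun _ => mul_add _ _ _
  map_smul' c η := funext fun I => mul_smul_comm c (zv j) (η I)

/-- The operator `η ↦ ∂_j η - (s+d+1) (∂_j f / f) η`, with `∂_j` acting on the coefficients. -/
def formDel (j : Fin (n + 1)) : Module.End ℂ (Forms A u) where
  toFun η := fun I => pd (Sum.inr j) (η I) + kappa A u j * η I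
  map_add' η θ := funext fun I => by
    change pd _ (η I + θ I) + _ * (η I + θ I) = (_ + _) + (_ + _)
    rw [map_add]; ring
  map_smul' c η := funext fun I => by
    change pd _ (c • η I) + _ * (c • η I) = c • (_ + _)
    rw [Derivation.map_smul, smul_add, mul_smul_comm]

/-- The action of the Weyl algebra on forms. -/
def formAction : Weyl (Fin (n + 1)) →ₐ[ℂ] Module.End ℂ (Forms A u) :=
  Weyl.lift (formZ A u) (formDel A u)
    (by
      intro i j
      refine LinearMap.ext fun η => funext fun I => ?_
      change zv i * (zv j * η I) = zv j * (zv i * η I)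
      ring)
    (by
      intro i j
      refine LinearMap.ext fun η => funext fun I => ?_
      change pd (Sum.inr i) (pd (Sum.inr j) (η I) + kappa A u j * η I)
          + kappa A u i * (pd (Sum.inr j) (η I) + kappa A u j * η I)
        = pd (Sum.inr j) (pd (Sum.inr i) (η I) + kappa A u i * η I)
          + kappa A u j * (pd (Sum.inr i) (η I) + kappa A u i * η I)
      simp only [map_add, Derivation.leibniz, smul_eq_mul]
      rw [pd_comm (Sum.inr i), pd_kappa A u i]
      ring)
    (by
      intro i j
      refine LinearMap.ext fun η => funext fun I => ?_
      have h : (if i = j then (1 : Module.End ℂ (Forms A u)) else 0) η I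
          = (if i = j then (1 : RatTZ d n) else 0) * η I := by
        split_ifs
        · simp
        · rw [zero_mul]; rfl
      change pd (Sum.inr i) (zv j * η I) + kappa A u i * (zv j * η I)
        = zv j * (pd (Sum.inr i) (η I) + kappa A u i * η I)
          + (if i = j then (1 : Module.End ℂ (Forms A u)) else 0) η I
      rw [h, Derivation.leibniz, pd_zv]
      simp only [smul_eq_mul, Sum.inr.injEq]
      ring)

instance : Module (Weyl (Fin (n + 1))) (Forms A u) :=
  Module.compHom (Forms A u) (formAction A u).toRingHom

theorem Forms.algebraMap_smul (c : ℂ) (η : Forms A u) :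
    (algebraMap ℂ (Weyl (Fin (n + 1))) c) • η = c • η := by
  change formAction A u (algebraMap ℂ _ c) η = _
  rw [AlgHom.commutes]; rfl

theorem Forms.z_smul (j : Fin (n + 1)) (η : Forms A u) (I : Finset (Fin (d + 1))) :
    (Weyl.z j • η) I = zv j * η I := by
  change formAction A u (Weyl.z j) η I = _
  rw [formAction, Weyl.lift_z]; rfl

theorem Forms.del_smul (j : Fin (n + 1)) (η : Forms A u) (I : Finset (Fin (d + 1))) :
    (Weyl.del j • η) I = pd (Sum.inr j) (η I) + kappa A u j * η I := by
  change formAction A u (Weyl.del j) η I = _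
  rw [formAction, Weyl.lift_del]; rfl

theorem Forms.smul_mem_of (S : Submodule ℂ (Forms A u)) (hz : ∀ (j : Fin (n + 1)), ∀ η ∈ S, Weyl.z j • η ∈ S)
    (hd : ∀ (j : Fin (n + 1)), ∀ η ∈ S, Weyl.del j • η ∈ S) (P : Weyl (Fin (n + 1))) :
    ∀ η ∈ S, P • η ∈ S := by
  induction P using Weyl.induction with
  | hc c => intro η h; rw [Forms.algebraMap_smul]; exact S.smul_mem c h
  | hz j => exact hz j
  | hd j => exact hd j
  | hmul a b ha hb => intro η h; rw [mul_smul]; exact ha _ (hb _ h)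
  | hadd a b ha hb => intro η h; rw [add_smul]; exact S.add_mem (ha _ h) (hb _ h)

/-- The sign `ε` in `dt_a ∧ ⋀_{i ∈ I \ a} dt_i = ε ⋀_{i ∈ I} dt_i`, for `a ∈ I`. -/
def wedgeSign (a : Fin (d + 1)) (I : Finset (Fin (d + 1))) : RatTZ d n :=
  (-1) ^ (I.filter (· < a)).card

/-- The twisted differential `∇_ω η = d_t η + ω ∧ η = ∑_a dt_a ∧ (∂η/∂t_a + ω_a η)`. -/
def nablaFun (η : Forms A u) : Forms A u := fun I =>
  ∑ a ∈ I, wedgeSign a I * (pd (Sum.inl a) (η (I.erase a)) + omega A u a * η (I.erase a))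

theorem nablaFun_add (η θ : Forms A u) :
    nablaFun A u (η + θ) = nablaFun A u η + nablaFun A u θ := by
  funext I
  change _ = nablaFun A u η I + nablaFun A u θ I
  simp only [nablaFun]
  rw [← Finset.sum_add_distrib]
  refine Finset.sum_congr rfl fun a _ => ?_
  change wedgeSign a I * (pd _ (η (I.erase a) + θ (I.erase a))
    + _ * (η (I.erase a) + θ (I.erase a))) = _
  rw [map_add]; ring

theorem pd_wedgeSign (v : Fin (d + 1) ⊕ Fin (n + 1)) (a : Fin (d + 1))
    (I : Finset (Fin (d + 1))) : pd v (wedgeSign a I) = 0 := by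
  unfold wedgeSign
  rcases neg_one_pow_eq_or (RatTZ d n) (I.filter (· < a)).card with h | h <;> rw [h] <;> simp

theorem nablaFun_smul (P : Weyl (Fin (n + 1))) :
    ∀ η : Forms A u, nablaFun A u (P • η) = P • nablaFun A u η := by
  induction P using Weyl.induction with
  | hc c =>
    intro η
    rw [Forms.algebraMap_smul, Forms.algebraMap_smul]
    funext I
    change _ = c • nablaFun A u η I
    simp only [nablaFun, Finset.smul_sum]
    refine Finset.sum_congr rfl fun a _ => ?_
    change wedgeSign a I * (pd _ (c • η (I.erase a)) + _ * (c • η (I.erase a))) = _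
    rw [Derivation.map_smul, mul_smul_comm, ← smul_add, mul_smul_comm]
  | hz j =>
    intro η
    funext I
    rw [Forms.z_smul]
    simp only [nablaFun, Finset.mul_sum]
    refine Finset.sum_congr rfl fun a _ => ?_
    rw [Forms.z_smul, Derivation.leibniz, pd_zv]
    simp only [smul_eq_mul, reduceCtorEq, if_false]
    ring
  | hd j =>
    intro η
    funext I
    rw [Forms.del_smul]
    simp only [nablaFun, map_sum, Finset.mul_sum]
    rw [← Finset.sum_add_distrib]
    refine Finset.sum_congr rfl fun a _ => ?_
    rw [Forms.del_smul]
    simp only [Derivation.leibniz, map_add, smul_eq_mul, pd_wedgeSign, pd_omega]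
    rw [pd_comm (Sum.inl a)]
    ring
  | hmul a b ha hb => intro η; rw [mul_smul, mul_smul, ha, hb]
  | hadd a b ha hb => intro η; rw [add_smul, add_smul, nablaFun_add, ha, hb]

/-- The twisted differential `∇_ω`; it commutes with the action of the Weyl algebra. -/
def nabla : Forms A u →ₗ[Weyl (Fin (n + 1))] Forms A u where
  toFun := nablaFun A u
  map_add' := nablaFun_add A u
  map_smul' := nablaFun_smul A u

/-- Contraction with the Euler vector field `∑ t_a ∂/∂t_a`. -/
def contract (η : Forms A u) : Forms A u := fun I =>
  ∑ a ∈ Iᶜ, wedgeSign a I * (tv a * η (insert a I))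

/-- `η` is a relative `p`-form on `X → Z = ℂ^{n+1}`, where `X ⊂ ℙ^d × Z` is the locus
`ℓ_0 ⋯ ℓ_n ≠ 0`, `f ≠ 0`: it has the shape `∑_{|I| = p} g_I dt_I`, its coefficients `g_I` are
regular and homogeneous of degree `-p` in `t`, and it is killed by contraction with the Euler
vector field (the condition that a form in homogeneous coordinates is one on projective space). -/
structure IsRelForm (p : ℤ) (η : Forms A u) : Prop where
  degree : ∀ I : Finset (Fin (d + 1)), (I.card : ℤ) ≠ p → η I = 0
  regular : ∀ I, η I ∈ regRing A
  homogeneous : ∀ (l : ℂˣ) I, scale l (η I) = ((l ^ (-p) : ℂˣ) : ℂ) • η I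
  horizontal : contract A u η = 0

theorem contract_eq_zero_iff (η : Forms A u) : contract A u η = 0 ↔
    ∀ I, ∑ a ∈ Iᶜ, wedgeSign a I * (tv a * η (insert a I)) = 0 :=
  ⟨fun h I => congrFun h I, fun h => funext h⟩

/-- Relative `p`-forms, as a complex vector space. -/
def relFormsAux (p : ℤ) : Submodule ℂ (Forms A u) where
  carrier := {η | IsRelForm A u p η}
  zero_mem' := by
    refine ⟨fun _ _ => rfl, fun _ => zero_mem _, fun l I => ?_, ?_⟩
    · change scale l 0 = _ • (0 : RatTZ d n)
      simp
    · funext I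
      change ∑ a ∈ Iᶜ, wedgeSign a I * (tv a * (0 : RatTZ d n)) = 0
      simp
  add_mem' := by
    rintro η θ ⟨h1, h2, h3, h4⟩ ⟨k1, k2, k3, k4⟩
    refine ⟨fun I hI => ?_, fun I => add_mem (h2 I) (k2 I), fun l I => ?_, ?_⟩
    · change η I + θ I = 0
      rw [h1 I hI, k1 I hI, add_zero]
    · change scale l (η I + θ I) = _ • (η I + θ I)
      rw [map_add, h3, k3, smul_add]
    · rw [contract_eq_zero_iff] at h4 k4 ⊢
      intro I
      change ∑ a ∈ Iᶜ, wedgeSign a I * (tv a * (η (insert a I) + θ (insert a I))) = 0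
      simp only [mul_add, Finset.sum_add_distrib, h4, k4, add_zero]
  smul_mem' := by
    rintro c η ⟨h1, h2, h3, h4⟩
    refine ⟨fun I hI => ?_, fun I => Subalgebra.smul_mem _ (h2 I) c, fun l I => ?_, ?_⟩
    · change c • η I = 0
      rw [h1 I hI, smul_zero]
    · change scale l (c • η I) = _ • (c • η I)
      rw [scale_smul, h3, smul_comm]
    · rw [contract_eq_zero_iff] at h4 ⊢
      intro I
      change ∑ a ∈ Iᶜ, wedgeSign a I * (tv a * (c • η (insert a I))) = 0
      simp only [mul_smul_comm, ← Finset.smul_sum, h4, smul_zero]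

/-- Relative `p`-forms `Ω^p_{X/Z}`, as a module over the Weyl algebra. -/
def relForms (p : ℤ) : Submodule (Weyl (Fin (n + 1))) (Forms A u) where
  carrier := {η | IsRelForm A u p η}
  zero_mem' := (relFormsAux A u p).zero_mem
  add_mem' := (relFormsAux A u p).add_mem
  smul_mem' P η hη := by
    refine Forms.smul_mem_of A u (relFormsAux A u p) ?_ ?_ P η hη
    · rintro j η ⟨h1, h2, h3, h4⟩
      refine ⟨fun I hI => ?_, fun I => ?_, fun l I => ?_, ?_⟩
      · rw [Forms.z_smul, h1 I hI, mul_zero]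
      · rw [Forms.z_smul]; exact mul_mem (zv_mem A j) (h2 I)
      · rw [Forms.z_smul, map_mul, h3, scale_zv, mul_smul_comm]
      · rw [contract_eq_zero_iff] at h4 ⊢
        intro I
        rw [← mul_zero (zv j), ← h4 I, Finset.mul_sum]
        refine Finset.sum_congr rfl fun a _ => ?_
        rw [Forms.z_smul]; ring
    · rintro j η ⟨h1, h2, h3, h4⟩
      refine ⟨fun I hI => ?_, fun I => ?_, fun l I => ?_, ?_⟩
      · rw [Forms.del_smul, h1 I hI]; simp
      · rw [Forms.del_smul]
        exact add_mem (pd_z_mem A j (h2 I)) (mul_mem (kappa_mem A u j) (h2 I))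
      · rw [Forms.del_smul, map_add, map_mul, scale_pd_zv, h3, scale_kappa, Derivation.map_smul,
          mul_smul_comm, smul_add]
      · rw [contract_eq_zero_iff] at h4 ⊢
        intro I
        have e' := congrArg (fun g => pd (Sum.inr j) g + kappa A u j * g) (h4 I)
        simp only [map_zero, mul_zero, add_zero, map_sum, Finset.mul_sum] at e'
        rw [← e', ← Finset.sum_add_distrib]
        refine Finset.sum_congr rfl fun a _ => ?_
        rw [Forms.del_smul]
        simp only [Derivation.leibniz, pd_wedgeSign, pd_tv, smul_eq_mul, reduceCtorEq, if_false]
        ring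

/-- Closed relative `p`-forms. -/
def cocycles (p : ℤ) : Submodule (Weyl (Fin (n + 1))) (Forms A u) :=
  relForms A u p ⊓ LinearMap.ker (nabla A u)

/-- Exact relative `p`-forms. -/
def coboundaries (p : ℤ) : Submodule (Weyl (Fin (n + 1))) (Forms A u) :=
  (relForms A u (p - 1)).map (nabla A u)

/-- The hypergeometric `D`-module `M_L^hyp(u) = H^d(Ω^•_{X/Z}, ∇_ω)`, with the action of the Weyl
algebra induced by that on forms. -/
abbrev HypCohomology : Type :=
  cocycles A u d ⧸ (coboundaries A u d).submoduleOf (cocycles A u d)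

/-- The form `f^{d+1} Ω(t)`, where `Ω(t) = ∑_i (-1)^i t_i dt_0 ∧ ⋯ ∧ (dt_i omitted) ∧ ⋯ ∧ dt_d`. -/
def eulerForm : Forms A u := fun I =>
  ∑ i : Fin (d + 1),
    if I = Finset.univ.erase i then fRat A ^ (d + 1) * ((-1) ^ (i : ℕ) * tv i) else 0

theorem eulerForm_erase (i : Fin (d + 1)) :
    eulerForm A u (Finset.univ.erase i) = fRat A ^ (d + 1) * ((-1) ^ (i : ℕ) * tv i) := by
  unfold eulerForm
  rw [Finset.sum_eq_single i]
  · simp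
  · intro b _ hb
    rw [if_neg]
    intro h
    have : i ∈ Finset.univ.erase b := Finset.mem_erase.2 ⟨hb.symm, Finset.mem_univ _⟩
    rw [← h] at this
    simp at this
  · simp

theorem eulerForm_of_card_ne {I : Finset (Fin (d + 1))} (h : I.card ≠ d) :
    eulerForm A u I = 0 := by
  unfold eulerForm
  refine Finset.sum_eq_zero fun i _ => if_neg ?_
  rintro rfl
  exact h (by simp)

theorem exists_eq_erase {I : Finset (Fin (d + 1))} (h : I.card = d) :
    ∃ i, I = Finset.univ.erase i := by
  have h1 : Iᶜ.card = 1 := by rw [Finset.card_compl, h]; simp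
  obtain ⟨i, hi⟩ := Finset.card_eq_one.1 h1
  refine ⟨i, ?_⟩
  rw [← compl_compl I, hi]
  ext x; simp

theorem euler_fRat : ∑ a, tv a * pd (Sum.inl a) (fRat A) = -fRat A := by
  have h1 : ∀ a, tv a * pd (Sum.inl a) (fRat A)
      = ∑ j, -(zv j * ((ell A j)⁻¹ ^ 2 * (A a j • tv a))) := by
    intro a
    simp only [fRat, map_sum, Finset.mul_sum]
    refine Finset.sum_congr rfl fun j _ => ?_
    rw [Derivation.leibniz_div, pd_t_ell, pd_zv]
    simp only [reduceCtorEq, if_false, smul_eq_mul]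
    rw [Algebra.smul_def]
    ring
  simp only [h1]
  rw [Finset.sum_comm, fRat, ← Finset.sum_neg_distrib]
  refine Finset.sum_congr rfl fun j _ => ?_
  rw [Finset.sum_neg_distrib, ← Finset.mul_sum, ← Finset.mul_sum]
  change -(zv j * ((ell A j)⁻¹ ^ 2 * ell A j)) = _
  by_cases h : ell A j = 0
  · simp [h]
  · field_simp

theorem ell_ne_zero {j : Fin (n + 1)} (h : ∃ i, A i j ≠ 0) : ell A j ≠ 0 := by
  obtain ⟨i, hi⟩ := h
  intro h0
  have := pd_t_ell A i j
  rw [h0, map_zero] at this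
  exact hi ((map_eq_zero _).1 this.symm)

theorem euler_omega (hA : ∀ j, ∃ i, A i j ≠ 0) (hf : fRat A ≠ 0) :
    ∑ a, tv a * omega A u a = 0 := by
  have h1 : ∀ a, tv a * omega A u a = -(sParam d u + d + 1) • ((fRat A)⁻¹ *
      (tv a * pd (Sum.inl a) (fRat A))) + ∑ j, u j • ((ell A j)⁻¹ * (A a j • tv a)) := by
    intro a
    rw [omega, mul_add, Finset.mul_sum, mul_smul_comm]
    congr 1
    · congr 1; ring
    · refine Finset.sum_congr rfl fun j _ => ?_
      rw [mul_smul_comm, pd_t_ell, Algebra.smul_def (A a j)]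
      congr 1; ring
  simp only [h1]
  rw [Finset.sum_add_distrib, ← Finset.smul_sum, ← Finset.mul_sum, euler_fRat]
  have h2 : ∀ j, ∑ a, u j • ((ell A j)⁻¹ * (A a j • tv a)) = algebraMap ℂ (RatTZ d n) (u j) := by
    intro j
    rw [← Finset.smul_sum, ← Finset.mul_sum]
    change u j • ((ell A j)⁻¹ * ell A j) = _
    rw [inv_mul_cancel₀ (ell_ne_zero A (hA j)), Algebra.smul_def, mul_one]
  have h3 : ∑ a, ∑ j, u j • ((ell A j)⁻¹ * (A a j • tv a))
      = ∑ j, algebraMap ℂ (RatTZ d n) (u j) := by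
    rw [Finset.sum_comm]
    exact Finset.sum_congr rfl fun j _ => h2 j
  rw [h3]
  rw [mul_neg, inv_mul_cancel₀ hf, Algebra.smul_def, ← map_sum, mul_neg, mul_one, ← map_neg,
    ← map_add, sParam]
  rw [map_eq_zero]
  ring

theorem card_filter_lt (a : Fin (d + 1)) :
    ((Finset.univ : Finset (Fin (d + 1))).filter (· < a)).card = a := by
  rw [← Fin.card_Iio a]
  congr 1
  ext x
  simp

theorem contract_eulerForm : contract A u (eulerForm A u) = 0 := by
  rw [contract_eq_zero_iff]
  intro I
  by_cases hI : Iᶜ.card = 2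
  · obtain ⟨b, c, hbc, hI'⟩ : ∃ b c : Fin (d + 1), b < c ∧ Iᶜ = {b, c} := by
      obtain ⟨x, y, hxy, h⟩ := Finset.card_eq_two.1 hI
      rcases lt_or_gt_of_ne hxy with h' | h'
      · exact ⟨x, y, h', h⟩
      · exact ⟨y, x, h', by rw [h, Finset.pair_comm]⟩
    have hmem : ∀ x, x ∈ I ↔ x ≠ b ∧ x ≠ c := by
      intro x
      have : x ∈ Iᶜ ↔ x = b ∨ x = c := by rw [hI']; simp
      rw [Finset.mem_compl] at this
      tauto
    have e1 : insert b I = Finset.univ.erase c := by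
      ext x
      simp only [Finset.mem_insert, hmem, Finset.mem_erase, Finset.mem_univ, and_true]
      constructor
      · rintro (rfl | h)
        exacts [hbc.ne, h.2]
      · tauto
    have e2 : insert c I = Finset.univ.erase b := by
      ext x
      simp only [Finset.mem_insert, hmem, Finset.mem_erase, Finset.mem_univ, and_true]
      constructor
      · rintro (rfl | h)
        exacts [hbc.ne', h.1]
      · tauto
    have s1 : I.filter (· < b) = Finset.univ.filter (· < b) := by
      ext x
      simp only [Finset.mem_filter, hmem, Finset.mem_univ, true_and, and_iff_right_iff_imp]
      intro h
      exact ⟨h.ne, (h.trans hbc).ne⟩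
    have s2 : I.filter (· < c) = (Finset.univ.filter (· < c)).erase b := by
      ext x
      simp only [Finset.mem_filter, hmem, Finset.mem_univ, true_and, Finset.mem_erase]
      constructor
      · rintro ⟨h, h'⟩; exact ⟨h.1, h'⟩
      · rintro ⟨h, h'⟩; exact ⟨⟨h, h'.ne⟩, h'⟩
    have c2 : (I.filter (· < c)).card + 1 = c := by
      rw [s2, Finset.card_erase_add_one (by simpa using hbc), card_filter_lt]
    rw [hI', Finset.sum_pair hbc.ne, e1, e2, eulerForm_erase, eulerForm_erase]
    simp only [wedgeSign, s1, card_filter_lt]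
    rw [← c2]
    ring
  · refine Finset.sum_eq_zero fun a ha => ?_
    rw [eulerForm_of_card_ne, mul_zero, mul_zero]
    intro h
    rw [Finset.card_insert_of_notMem (Finset.mem_compl.1 ha)] at h
    rw [Finset.card_compl, Fintype.card_fin] at hI
    omega

theorem nabla_eulerForm (hA : ∀ j, ∃ i, A i j ≠ 0) : nabla A u (eulerForm A u) = 0 := by
  funext I
  change ∑ a ∈ I, wedgeSign a I * (pd (Sum.inl a) (eulerForm A u (I.erase a))
    + omega A u a * eulerForm A u (I.erase a)) = 0
  by_cases hI : I = Finset.univ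
  · subst hI
    by_cases hf : fRat A = 0
    · refine Finset.sum_eq_zero fun a _ => ?_
      simp [eulerForm_erase, hf]
    have h1 : ∀ a : Fin (d + 1), wedgeSign a Finset.univ *
        (pd (Sum.inl a) (eulerForm A u (Finset.univ.erase a))
          + omega A u a * eulerForm A u (Finset.univ.erase a))
        = fRat A ^ (d + 1) + ((d : RatTZ d n) + 1) * fRat A ^ d * (tv a * pd (Sum.inl a) (fRat A))
          + fRat A ^ (d + 1) * (tv a * omega A u a) := by
      intro a
      have hs : pd (Sum.inl a) ((-1 : RatTZ d n) ^ (a : ℕ)) = 0 := by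
        rcases neg_one_pow_eq_or (RatTZ d n) (a : ℕ) with h | h <;> rw [h] <;> simp
      rw [eulerForm_erase, Derivation.leibniz, Derivation.leibniz, hs,
        Derivation.leibniz_pow, pd_tv, wedgeSign, card_filter_lt]
      have h2 : ((-1 : RatTZ d n) ^ (a : ℕ)) * (-1) ^ (a : ℕ) = 1 := by
        rw [← mul_pow]; simp
      simp only [smul_eq_mul, if_true, nsmul_eq_mul, add_tsub_cancel_right]
      push_cast
      linear_combination (fRat A ^ (d + 1) + ((d : RatTZ d n) + 1) * fRat A ^ d * (tv a * pd (Sum.inl a) (fRat A))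
          + fRat A ^ (d + 1) * (tv a * omega A u a)) * h2
    simp only [h1]
    rw [Finset.sum_add_distrib, Finset.sum_add_distrib, ← Finset.mul_sum, ← Finset.mul_sum,
      euler_fRat, euler_omega A u hA hf]
    simp
    ring
  · refine Finset.sum_eq_zero fun a ha => ?_
    rw [eulerForm_of_card_ne]
    · simp
    · rw [Finset.card_erase_of_mem ha]
      have : I.card < Fintype.card (Fin (d + 1)) := Finset.card_lt_univ_of_notMem
        (x := (not_forall.1 (fun h => hI (Finset.eq_univ_iff_forall.2 h))).choose)
        (not_forall.1 (fun h => hI (Finset.eq_univ_iff_forall.2 h))).choose_spec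
      have h0 : 0 < I.card := Finset.card_pos.2 ⟨a, ha⟩
      rw [Fintype.card_fin] at this
      omega

theorem eulerForm_mem (hA : ∀ j, ∃ i, A i j ≠ 0) : eulerForm A u ∈ cocycles A u d := by
  refine Submodule.mem_inf.2 ⟨⟨?_, ?_, ?_, contract_eulerForm A u⟩, nabla_eulerForm A u hA⟩
  · intro I hI
    exact eulerForm_of_card_ne A u (by exact_mod_cast hI)
  · intro I
    refine sum_mem fun i _ => ?_
    split_ifs
    · exact mul_mem (pow_mem (fRat_mem A) _)
        (mul_mem (pow_mem (neg_mem (one_mem _)) _) (tv_mem A i))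
    · exact zero_mem _
  · intro l I
    by_cases hI : I.card = d
    · obtain ⟨i, rfl⟩ := exists_eq_erase hI
      rw [eulerForm_erase]
      simp only [map_mul, map_pow, scale_fRat, scale_tv, map_neg, map_one]
      rw [smul_pow, mul_smul_comm, mul_smul_comm, smul_mul_assoc, smul_smul]
      congr 1
      simp only [Units.val_inv_eq_inv_val, zpow_neg, zpow_natCast, Units.val_pow_eq_pow_val]
      have := Units.ne_zero l
      rw [inv_pow, pow_succ, mul_inv, mul_left_comm, mul_inv_cancel₀ this, mul_one]
    · rw [eulerForm_of_card_ne A u hI]; simp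

/-- The class `[f^{d+1} Ω(t)]` in `M_L^hyp(u)`. -/
def eulerClass (hA : ∀ j, ∃ i, A i j ≠ 0) : HypCohomology A u :=
  Submodule.Quotient.mk ⟨eulerForm A u, eulerForm_mem A u hA⟩

/-! ## Holomorphic functions as a module over the Weyl algebra -/

section holomorphic

variable {m : ℕ} (W : TopologicalSpace.Opens (Fin m → ℂ))

/-- Holomorphic functions on the open set `W`, i.e. functions that are infinitely complex
differentiable on `W`; they are represented by their extension by zero outside of `W`. -/
def holSubmodule : Submodule ℂ ((Fin m → ℂ) → ℂ) where
  carrier := {g | ContDiffOn ℂ ∞ g W ∧ ∀ z ∉ W, g z = 0}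
  zero_mem' := ⟨contDiffOn_const, fun _ _ => rfl⟩
  add_mem' := fun ha hb => ⟨ha.1.add hb.1, fun z hz => by simp [ha.2 z hz, hb.2 z hz]⟩
  smul_mem' := fun c _ ha => ⟨ha.1.const_smul c, fun z hz => by simp [ha.2 z hz]⟩

/-- The space `𝒪(W)` of holomorphic functions on `W`. -/
def Hol : Type := holSubmodule W

instance : AddCommGroup (Hol W) := inferInstanceAs (AddCommGroup (holSubmodule W))
instance : Module ℂ (Hol W) := inferInstanceAs (Module ℂ (holSubmodule W))

variable {W}

/-- The value of a holomorphic function at a point. -/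
def Hol.val (g : Hol W) : (Fin m → ℂ) → ℂ := Subtype.val (p := fun g => g ∈ holSubmodule W) g

theorem Hol.contDiffOn (g : Hol W) : ContDiffOn ℂ ∞ g.val W :=
  (Subtype.property (p := fun g => g ∈ holSubmodule W) g).1

theorem Hol.zero_of_notMem (g : Hol W) {z : Fin m → ℂ} (hz : z ∉ W) : g.val z = 0 :=
  (Subtype.property (p := fun g => g ∈ holSubmodule W) g).2 z hz

theorem Hol.contDiffAt (g : Hol W) {z : Fin m → ℂ} (hz : z ∈ W) : ContDiffAt ℂ ∞ g.val z :=
  g.contDiffOn.contDiffAt (W.isOpen.mem_nhds hz)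

theorem Hol.differentiableAt (g : Hol W) {z : Fin m → ℂ} (hz : z ∈ W) :
    DifferentiableAt ℂ g.val z := (g.contDiffAt hz).differentiableAt (by simp)

theorem Hol.ext {g h : Hol W} (H : ∀ z ∈ W, g.val z = h.val z) : g = h := by
  refine Subtype.ext (funext fun z => ?_)
  by_cases hz : z ∈ W
  · exact H z hz
  · exact (g.zero_of_notMem hz).trans (h.zero_of_notMem hz).symm

/-- Construct a holomorphic function on `W` from its values on `W`. -/
def Hol.mk (g : (Fin m → ℂ) → ℂ) (hg : ContDiffOn ℂ ∞ g W) : Hol W :=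
  ⟨(W : Set (Fin m → ℂ)).indicator g,
    hg.congr fun _ hz => Set.indicator_of_mem hz g, fun _ hz => Set.indicator_of_notMem hz g⟩

theorem Hol.mk_val {g : (Fin m → ℂ) → ℂ} (hg : ContDiffOn ℂ ∞ g W) {z : Fin m → ℂ} (hz : z ∈ W) :
    (Hol.mk g hg).val z = g z := Set.indicator_of_mem (s := (W : Set (Fin m → ℂ))) hz g

theorem Hol.mk_val_eventuallyEq {g : (Fin m → ℂ) → ℂ} (hg : ContDiffOn ℂ ∞ g W)
    {z : Fin m → ℂ} (hz : z ∈ W) : (Hol.mk g hg).val =ᶠ[nhds z] g :=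
  Filter.eventually_of_mem (W.isOpen.mem_nhds hz) fun _ h => Hol.mk_val hg h

/-- Multiplication of a holomorphic function by the coordinate `z_j`. -/
def Hol.zMul (j : Fin m) (g : Hol W) : Hol W :=
  Hol.mk (fun z => z j * g.val z) ((contDiff_apply ℂ ℂ j).contDiffOn.mul g.contDiffOn)

/-- The partial derivative of a holomorphic function with respect to `z_j`. -/
def Hol.del (j : Fin m) (g : Hol W) : Hol W :=
  Hol.mk (fun z => fderiv ℂ g.val z (Pi.single j 1))
    ((g.contDiffOn.fderiv_of_isOpen W.isOpen (by simp)).clm_apply contDiffOn_const)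

/-- Multiplication by `z_j` as a linear map. -/
def Hol.zEnd (W : TopologicalSpace.Opens (Fin m → ℂ)) (j : Fin m) : Module.End ℂ (Hol W) where
  toFun := Hol.zMul j
  map_add' g h := Hol.ext fun z hz => by
    change _ = (Hol.zMul j g).val z + (Hol.zMul j h).val z
    simp only [Hol.zMul, Hol.mk_val _ hz]
    change z j * (g.val z + h.val z) = _
    ring
  map_smul' c g := Hol.ext fun z hz => by
    change _ = c * (Hol.zMul j g).val z
    simp only [Hol.zMul, Hol.mk_val _ hz]
    change z j * (c * g.val z) = _
    ring

/-- The partial derivative `∂_j` as a linear map. -/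
def Hol.delEnd (W : TopologicalSpace.Opens (Fin m → ℂ)) (j : Fin m) : Module.End ℂ (Hol W) where
  toFun := Hol.del j
  map_add' g h := Hol.ext fun z hz => by
    change _ = (Hol.del j g).val z + (Hol.del j h).val z
    simp only [Hol.del, Hol.mk_val _ hz]
    change fderiv ℂ (g.val + h.val) z _ = _
    rw [fderiv_add (g.differentiableAt hz) (h.differentiableAt hz)]; rfl
  map_smul' c g := Hol.ext fun z hz => by
    change _ = c * (Hol.del j g).val z
    simp only [Hol.del, Hol.mk_val _ hz]
    change fderiv ℂ (c • g.val) z _ = _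
    rw [fderiv_const_smul (g.differentiableAt hz)]; rfl

theorem Hol.del_del (i j : Fin m) (g : Hol W) {z : Fin m → ℂ} (hz : z ∈ W) :
    (Hol.del i (Hol.del j g)).val z
      = fderiv ℂ (fderiv ℂ g.val) z (Pi.single i 1) (Pi.single j 1) := by
  have h1 : DifferentiableAt ℂ (fderiv ℂ g.val) z :=
    ((g.contDiffAt hz).fderiv_right (m := 1) (by norm_cast)).differentiableAt (by simp)
  rw [Hol.del, Hol.mk_val _ hz, Hol.del, (Hol.mk_val_eventuallyEq _ hz).fderiv_eq,
    fderiv_clm_apply h1 (differentiableAt_const _)]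
  simp

/-- The action of the Weyl algebra on `𝒪(W)` by differential operators. -/
def Hol.action (W : TopologicalSpace.Opens (Fin m → ℂ)) :
    Weyl (Fin m) →ₐ[ℂ] Module.End ℂ (Hol W) :=
  Weyl.lift (Hol.zEnd W) (Hol.delEnd W)
    (by
      intro i j
      refine LinearMap.ext fun g => Hol.ext fun z hz => ?_
      change (Hol.zMul i (Hol.zMul j g)).val z = (Hol.zMul j (Hol.zMul i g)).val z
      simp only [Hol.zMul, Hol.mk_val _ hz]
      ring)
    (by
      intro i j
      refine LinearMap.ext fun g => Hol.ext fun z hz => ?_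
      change (Hol.del i (Hol.del j g)).val z = (Hol.del j (Hol.del i g)).val z
      rw [Hol.del_del i j g hz, Hol.del_del j i g hz]
      exact (g.contDiffAt hz).isSymmSndFDerivAt (by
        rw [minSmoothness_of_isRCLikeNormedField]
        exact WithTop.coe_le_coe.2 (le_top : (2 : ℕ∞) ≤ ⊤)) _ _)
    (by
      intro i j
      refine LinearMap.ext fun g => Hol.ext fun z hz => ?_
      have h : ((if i = j then (1 : Module.End ℂ (Hol W)) else 0) g).val z
          = (if i = j then 1 else 0) * g.val z := by
        split_ifs
        · simp
        · rw [zero_mul]; rfl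
      change (Hol.del i (Hol.zMul j g)).val z = (Hol.zMul j (Hol.del i g)).val z
        + ((if i = j then (1 : Module.End ℂ (Hol W)) else 0) g).val z
      rw [h, Hol.del, Hol.mk_val _ hz, Hol.zMul, (Hol.mk_val_eventuallyEq _ hz).fderiv_eq,
        fderiv_fun_mul (differentiableAt_apply j z) (g.differentiableAt hz), Hol.zMul,
        Hol.mk_val _ hz, Hol.del, Hol.mk_val _ hz]
      have hp : fderiv ℂ (fun z : Fin m → ℂ => z j) z = ContinuousLinearMap.proj j :=
        (ContinuousLinearMap.proj (R := ℂ) (φ := fun _ : Fin m => ℂ) j).fderiv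
      rw [hp]
      simp [Pi.single_apply, eq_comm, mul_comm])

instance : Module (Weyl (Fin m)) (Hol W) := Module.compHom (Hol W) (Hol.action W).toRingHom

theorem Hol.z_smul (j : Fin m) (g : Hol W) {z : Fin m → ℂ} (hz : z ∈ W) :
    (Weyl.z j • g).val z = z j * g.val z := by
  change (Hol.action W (Weyl.z j) g).val z = _
  rw [Hol.action, Weyl.lift_z]
  change (Hol.zMul j g).val z = _
  rw [Hol.zMul, Hol.mk_val _ hz]

theorem Hol.del_smul (j : Fin m) (g : Hol W) {z : Fin m → ℂ} (hz : z ∈ W) :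
    (Weyl.del j • g).val z = fderiv ℂ g.val z (Pi.single j 1) := by
  change (Hol.action W (Weyl.del j) g).val z = _
  rw [Hol.action, Weyl.lift_del]
  change (Hol.del j g).val z = _
  rw [Hol.del, Hol.mk_val _ hz]

end holomorphic

/-! ## Twisted cycles and Euler integrals -/

/-- The value of the linear form `ℓ_j` at a point `t ∈ ℂ^{d+1}`. -/
def ellVal (j : Fin (n + 1)) (t : Fin (d + 1) → ℂ) : ℂ := ∑ i, A i j * t i

/-- The value `f(t, z) = ∑ z_j / ℓ_j(t)`. -/
def fVal (t : Fin (d + 1) → ℂ) (z : Fin (n + 1) → ℂ) : ℂ := ∑ j, z j / ellVal A j t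

/-- A smooth singular `d`-simplex in `X_z = {t ∈ ℙ^d : ℓ_0(t) ⋯ ℓ_n(t) ≠ 0, f(t, z) ≠ 0}`, given in
homogeneous coordinates, together with a section along the simplex of the rank one local system
spanned by the branches of `φ(·, z) = f^{-s-d-1} ∏ ℓ_j^{u_j}`. Only the values on the standard
simplex matter. (A smooth map on the closed simplex extends smoothly to the ambient space.) -/
structure TwistedSimplex (z : Fin (n + 1) → ℂ) where
  /-- The simplex, in homogeneous coordinates. -/
  map : (Fin (d + 1) → ℝ) → (Fin (d + 1) → ℂ)
  smooth : ContDiff ℝ ∞ map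
  ell_ne_zero : ∀ x ∈ stdSimplex ℝ (Fin (d + 1)), ∀ j, ellVal A j (map x) ≠ 0
  f_ne_zero : ∀ x ∈ stdSimplex ℝ (Fin (d + 1)), fVal A (map x) z ≠ 0
  /-- The section `c φ` of the local system, as a function on the simplex. -/
  branch : (Fin (d + 1) → ℝ) → ℂ
  isBranch : ∃ (c : ℂ) (logEll : Fin (n + 1) → (Fin (d + 1) → ℝ) → ℂ)
      (logF : (Fin (d + 1) → ℝ) → ℂ),
    (∀ j, ContinuousOn (logEll j) (stdSimplex ℝ (Fin (d + 1)))) ∧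
    ContinuousOn logF (stdSimplex ℝ (Fin (d + 1))) ∧
    ∀ x ∈ stdSimplex ℝ (Fin (d + 1)),
      (∀ j, Complex.exp (logEll j x) = ellVal A j (map x)) ∧
      Complex.exp (logF x) = fVal A (map x) z ∧
      branch x = c * Complex.exp (-(sParam d u + d + 1) * logF x + ∑ j, u j * logEll j x)

/-- The inclusion of the `i`-th face of the standard simplex, in barycentric coordinates. -/
def face (i : Fin (d + 1)) (y : Fin d → ℝ) : Fin (d + 1) → ℝ := i.insertNth (0 : ℝ) y

variable {A u}

/-- The `i`-th face of `σ` and the `j`-th face of `τ` are the same singular simplex in `ℙ^d`. -/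
def SameFace {z : Fin (n + 1) → ℂ} (σ τ : TwistedSimplex A u z) (i j : Fin (d + 1)) : Prop :=
  ∀ y ∈ stdSimplex ℝ (Fin d), ∃ c : ℂ, c ≠ 0 ∧ τ.map (face j y) = c • σ.map (face i y)

variable (A u)

open Classical in
/-- A twisted `d`-cycle on `X_z`: a finite chain of singular simplices with coefficients in the
local system of branches of `φ(·, z)` whose boundary vanishes, that is, for each singular
`(d-1)`-simplex the (signed) sum of the sections that the chain's faces put on it is zero.
(The function `φ` is homogeneous of degree `0` in `t`, so that sections along simplices which agree
in `ℙ^d` can be compared.) -/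
structure TwistedCycle (z : Fin (n + 1) → ℂ) where
  /-- The number of simplices. -/
  size : ℕ
  simplex : Fin size → TwistedSimplex A u z
  boundary_eq_zero : ∀ (k : Fin size) (i : Fin (d + 1)), ∀ y ∈ stdSimplex ℝ (Fin d),
    ∑ p : Fin size × Fin (d + 1),
      (if SameFace (simplex k) (simplex p.1) i p.2 then
        (-1) ^ (p.2 : ℕ) * (simplex p.1).branch (face p.2 y) else 0) = 0

/-- The solid simplex `{x ∈ ℝ^d : x_i ≥ 0, ∑ x_i ≤ 1}`. -/
def solidSimplex (d : ℕ) : Set (Fin d → ℝ) := {x | (∀ i, 0 ≤ x i) ∧ ∑ i, x i ≤ 1}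

/-- The parametrization of the standard simplex by the solid simplex. -/
def chart (x : Fin d → ℝ) : Fin (d + 1) → ℝ := Fin.cons (1 - ∑ i, x i) x

/-- The coefficient of `dx_1 ∧ ⋯ ∧ dx_d` in the pull-back of `Ω(t)` along
`x ↦ σ(chart x)`: one has `Ω(t)(v_1, …, v_d) = det(t, v_1, …, v_d)`. -/
def pullbackOmega (σ : (Fin (d + 1) → ℝ) → (Fin (d + 1) → ℂ)) (x : Fin d → ℝ) : ℂ :=
  Matrix.det (Matrix.of fun r c : Fin (d + 1) =>
    (Fin.cons (σ (chart x)) (fun i : Fin d =>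
      fderiv ℝ (fun y => σ (chart y)) x (Pi.single i 1)) : Fin (d + 1) → Fin (d + 1) → ℂ) c r)

variable {A u}

/-- The Euler integral `g_Γ(z) = ∫_Γ φ(t, z) f(t, z)^{d+1} Ω(t)` of a twisted cycle `Γ` on
`X_{z₀}`, for `z` near `z₀`: along each simplex the given branch of `φ(·, z₀)` is continued to the
branch `φ(t, z) = φ(t, z₀) (f(t, z) / f(t, z₀))^{-s-d-1}` of `φ(·, z)`, where the power is the
principal one (its base is close to `1`). -/
def eulerIntegral {z₀ : Fin (n + 1) → ℂ} (Γ : TwistedCycle A u z₀) (z : Fin (n + 1) → ℂ) : ℂ :=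
  ∑ k, ∫ x in solidSimplex d,
    (Γ.simplex k).branch (chart x)
      * (fVal A ((Γ.simplex k).map (chart x)) z / fVal A ((Γ.simplex k).map (chart x)) z₀)
          ^ (-(sParam d u + d + 1))
      * fVal A ((Γ.simplex k).map (chart x)) z ^ (d + 1)
      * pullbackOmega (Γ.simplex k).map x

end MatroidHG

end

open MatroidHG

open scoped ContDiff

noncomputable section

namespace MatroidHG


/-! ## Constant coefficient operators on families of powers -/

/-! Put κ = -(s+d+1), the exponent of f in φ. Twisted forms and Euler integrals are treated by one
formal calculation. Let V(m, p) be the form f^m p(1/ℓ) Ω, or the integral of φ f^m p(1/ℓ) Ω. Since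
∂f/∂z_j = 1/ℓ_j, the operator ∂_j sends V(m, p) to (κ+m) V(m-1, x_j p). Since f = ∑ z_j/ℓ_j, one has
∑ z_j V(m-1, x_j p) = V(m, p). Since (1/ℓ_j(t))_j is a reciprocal point, V(m, p) = 0 for p in
I(L⁻¹). These rules make up `PowerFamily`.

The generator is V(d+1, 1), and κ+d+1 = -s. The rules alone imply that H kills it. They also imply
that h(∂) kills it: a monomial of degree k contributes a falling factorial depending only on k, and
the homogeneous components of h lie in I(L⁻¹) again. For P_i they give a multiple of the
t_i-derivative of φ f^d, times Ω: P_i V(d+1, 1) corresponds to s ∂_i(φ f^d) Ω. What remains is that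
this is exact.

For forms, the primitive is f^d ι_i Ω, with ι_i the contraction with ∂/∂t_i. By Cartan's formula its
twisted differential is the Lie derivative of f^d Ω minus ι_i ∇(f^d Ω). Euler's relation gives ∇(f^d
Ω) = f^d dt_0 ∧ … ∧ dt_d, and ι_i of this volume form cancels the part of the Lie derivative in
which Ω is differentiated (`nabla_primitive`, `opP_smul_eulerForm`). Since D is generated by 1,
existence and uniqueness of ψ follow.

For integrals, exactness becomes Stokes' theorem. On one simplex, `stokes_form` combines integration
by parts in each coordinate, the exterior derivative of t ↦ det(e, t, …), and a linear dependence
among d+2 vectors in ℂ^(d+1). The boundary terms cancel over a twisted cycle: the primitive on a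
face is the branch times a factor depending only on the face as a simplex in ℙ^d
(`facePart_eq_of_sameFace`), and the cycle condition kills the signed sum of branches
(`sum_face_eq_zero`). Differentiation under the integral makes the integrals holomorphic and gives
the `PowerFamily` rules. -/

theorem eval_smul_homogeneousComponent {m : ℕ} (h : MvPolynomial (Fin m) ℂ) (k : ℕ) (c : ℂ)
    (y : Fin m → ℂ) : MvPolynomial.eval (c • y) (MvPolynomial.homogeneousComponent k h)
      = c ^ k * MvPolynomial.eval y (MvPolynomial.homogeneousComponent k h) := by
  rw [MvPolynomial.homogeneousComponent_apply, map_sum, map_sum, Finset.mul_sum]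
  refine Finset.sum_congr rfl fun e he => ?_
  rw [MvPolynomial.eval_monomial, MvPolynomial.eval_monomial, ← (Finset.mem_filter.1 he).2]
  simp only [Finsupp.prod, Pi.smul_apply, smul_eq_mul, mul_pow, Finset.prod_mul_distrib,
    Finset.prod_pow_eq_pow_sum, ← Finsupp.degree_apply]
  ring

/-- The set of reciprocal points is stable under nonzero scalars. For a fixed point y, the
polynomial c ↦ h(c y) = ∑ c^k h_k(y) therefore has infinitely many zeros, so every coefficient
h_k(y) vanishes. -/
theorem homogeneousComponent_mem_reciprocalIdeal {d n : ℕ}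
    {A : Matrix (Fin (d + 1)) (Fin (n + 1)) ℂ} {h : MvPolynomial (Fin (n + 1)) ℂ}
    (hh : h ∈ reciprocalIdeal A) (k : ℕ) :
    MvPolynomial.homogeneousComponent k h ∈ reciprocalIdeal A := by
  rw [reciprocalIdeal, MvPolynomial.mem_vanishingIdeal_iff] at hh ⊢
  rintro y ⟨x, hx, hx0, rfl⟩
  set y : Fin (n + 1) → ℂ := fun j => (x j)⁻¹
  let q : Polynomial ℂ := ∑ i ∈ Finset.range (h.totalDegree + 1),
    Polynomial.C (MvPolynomial.eval y (MvPolynomial.homogeneousComponent i h)) * Polynomial.X ^ i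
  have hq : ∀ c : ℂ, c ≠ 0 → q.eval c = 0 := by
    intro c hc
    -- Scaling the reciprocals by c amounts to scaling the point of the row span by c⁻¹.
    have h1 := hh (c • y) ⟨c⁻¹ • x, Submodule.smul_mem _ _ hx,
      fun j => mul_ne_zero (inv_ne_zero hc) (hx0 j), by
        funext j
        simp [y, mul_comm]⟩
    rw [← MvPolynomial.sum_homogeneousComponent h, map_sum] at h1
    rw [← h1, Polynomial.eval_finsetSum]
    refine Finset.sum_congr rfl fun i _ => ?_
    rw [MvPolynomial.aeval_eq_eval]
    rw [eval_smul_homogeneousComponent, Polynomial.eval_mul, Polynomial.eval_C, Polynomial.eval_pow,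
      Polynomial.eval_X, mul_comm]
  have hq0 : q = 0 := by
    refine Polynomial.eq_zero_of_infinite_isRoot q (Set.Infinite.mono (s := {0}ᶜ) ?_ ?_)
    · intro c hc
      exact hq c hc
    · exact (Set.finite_singleton _).infinite_compl
  have hk := congrArg (Polynomial.coeff · k) hq0
  simp only [q, Polynomial.finsetSum_coeff, Polynomial.coeff_C_mul, Polynomial.coeff_X_pow,
    Polynomial.coeff_zero, mul_ite, mul_one, mul_zero, Finset.sum_ite_eq, Finset.mem_range] at hk
  rw [MvPolynomial.aeval_eq_eval]
  split_ifs at hk with hlt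
  · exact hk
  · rw [MvPolynomial.homogeneousComponent_eq_zero _ _ (by omega), map_zero]

theorem Weyl.smul_algebraMap_smul {ι : Type} [DecidableEq ι] {M : Type*} [AddCommGroup M]
    [Module (Weyl ι) M] (P : Weyl ι) (c : ℂ) (v : M) :
    P • algebraMap ℂ (Weyl ι) c • v = algebraMap ℂ (Weyl ι) c • P • v := by
  rw [← mul_smul, ← mul_smul, Algebra.commutes]

/-- A family `V m p` in a module over the Weyl algebra that behaves like the functions
`f ^ (κ + m) p(1/ℓ)` with `f = ∑ z_j / ℓ_j`, where `p` is a polynomial vanishing on the reciprocal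
linear space only if `V m p = 0`. -/
structure PowerFamily {d n : ℕ} (A : Matrix (Fin (d + 1)) (Fin (n + 1)) ℂ) (κ : ℂ)
    {M : Type*} [AddCommGroup M] [Module (Weyl (Fin (n + 1))) M]
    (V : ℤ → MvPolynomial (Fin (n + 1)) ℂ → M) : Prop where
  add : ∀ m p q, V m (p + q) = V m p + V m q
  smul : ∀ m (c : ℂ) p, V m (c • p) = algebraMap ℂ (Weyl (Fin (n + 1))) c • V m p
  del : ∀ m j p, Weyl.del j • V m p =
    algebraMap ℂ (Weyl (Fin (n + 1))) (κ + m) • V (m - 1) (MvPolynomial.X j * p)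
  euler : ∀ m p, ∑ j, Weyl.z j • V (m - 1) (MvPolynomial.X j * p) = V m p
  vanish : ∀ m, ∀ p ∈ reciprocalIdeal A, V m p = 0

/-! ### The generators of the hypergeometric ideal acting on a power family -/

namespace PowerFamily

variable {d n : ℕ} {A : Matrix (Fin (d + 1)) (Fin (n + 1)) ℂ} {κ : ℂ}
  {M : Type*} [AddCommGroup M] [Module (Weyl (Fin (n + 1))) M]
  {V : ℤ → MvPolynomial (Fin (n + 1)) ℂ → M}

theorem map_sum (hV : PowerFamily A κ V) {α : Type*} (m : ℤ) (s : Finset α) (p : α → MvPolynomial (Fin (n + 1)) ℂ) :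
    V m (∑ a ∈ s, p a) = ∑ a ∈ s, V m (p a) :=
  _root_.map_sum (AddMonoidHom.mk' (V m) (hV.add m)) p s

theorem del_pow (hV : PowerFamily A κ V) (j : Fin (n + 1)) (k : ℕ) : ∀ m p, Weyl.del j ^ k • V m p =
    algebraMap ℂ (Weyl (Fin (n + 1))) (∏ i ∈ Finset.range k, (κ + m - i)) •
      V (m - k) (MvPolynomial.X j ^ k * p) := by
  induction k with
  | zero => intro m p; simp
  | succ k ih =>
    intro m p
    rw [pow_succ', mul_smul, ih, Weyl.smul_algebraMap_smul, hV.del, Finset.prod_range_succ, map_mul, mul_smul,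
      ← mul_assoc, ← pow_succ']
    push_cast
    rw [← add_sub_assoc, ← sub_sub]

/-- Falling factorials compose: after a derivatives the exponent κ+m has dropped by a, and the next
b factors start there. Hence the scalar produced by a monomial depends only on its total degree. -/
theorem prod_range_add_sub (κ : ℂ) (m : ℤ) (a b : ℕ) :
    (∏ i ∈ Finset.range (a + b), (κ + m - i)) = (∏ i ∈ Finset.range a, (κ + m - i)) *
      ∏ i ∈ Finset.range b, (κ + ((m - a : ℤ) : ℂ) - i) := by
  rw [Finset.prod_range_add]
  congr 1
  refine Finset.prod_congr rfl fun i _ => ?_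
  push_cast
  ring

theorem list_prod_smul (hV : PowerFamily A κ V) (e : Fin (n + 1) → ℕ) (l : List (Fin (n + 1))) : ∀ m p,
    (l.map fun i => Weyl.del i ^ e i).prod • V m p =
      algebraMap ℂ (Weyl (Fin (n + 1))) (∏ i ∈ Finset.range (l.map e).sum, (κ + m - i)) •
        V (m - (l.map e).sum) ((l.map fun i => MvPolynomial.X i ^ e i).prod * p) := by
  induction l with
  | nil => intro m p; simp
  | cons a l ih =>
    intro m p
    simp only [List.map_cons, List.prod_cons, List.sum_cons]
    rw [mul_smul, ih, Weyl.smul_algebraMap_smul, hV.del_pow, add_comm (e a), prod_range_add_sub, map_mul, mul_smul,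
      ← mul_assoc, Nat.cast_add, sub_sub]

theorem monomial_smul (hV : PowerFamily A κ V) (e : Fin (n + 1) →₀ ℕ) (m : ℤ) :
    (List.ofFn fun i => Weyl.del i ^ e i).prod • V m 1 =
      algebraMap ℂ (Weyl (Fin (n + 1))) (∏ i ∈ Finset.range e.degree, (κ + m - i)) •
        V (m - e.degree) (MvPolynomial.monomial e 1) := by
  have h1 : ((List.finRange (n + 1)).map e).sum = e.degree := by
    rw [← List.ofFn_eq_map, List.sum_ofFn, Finsupp.degree_eq_sum]
  have h2 : ((List.finRange (n + 1)).map fun i => (MvPolynomial.X i ^ e i :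
      MvPolynomial (Fin (n + 1)) ℂ)).prod = MvPolynomial.monomial e 1 := by
    rw [← List.ofFn_eq_map, List.prod_ofFn, MvPolynomial.monomial_eq,
      Finsupp.prod_fintype _ _ (by simp)]
    simp
  rw [List.ofFn_eq_map, hV.list_prod_smul, h1, h2, mul_one]

/-- Terms of h of different degrees carry different falling factorials and land in different powers
of f, so h cannot be treated at once. Grouping by degree, the scalar factors out, and what is left
is V evaluated at a homogeneous component of h, which lies in the ideal again. -/
theorem ofSymbol_smul_eq_zero (hV : PowerFamily A κ V) {h : MvPolynomial (Fin (n + 1)) ℂ} (hh : h ∈ reciprocalIdeal A)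
    (m : ℤ) : Weyl.ofSymbol h • V m 1 = 0 := by
  have h1 : ∀ e ∈ h.support, (h.coeff e • (List.ofFn fun i => Weyl.del i ^ e i).prod) • V m 1 =
      algebraMap ℂ (Weyl (Fin (n + 1))) (∏ i ∈ Finset.range e.degree, (κ + m - i)) •
        V (m - e.degree) (MvPolynomial.monomial e (h.coeff e)) := by
    intro e _
    rw [Algebra.smul_def, mul_smul, hV.monomial_smul, Weyl.smul_algebraMap_smul, ← hV.smul,
      MvPolynomial.smul_monomial, smul_eq_mul, mul_one]
  rw [Weyl.ofSymbol, Finset.sum_smul, Finset.sum_congr rfl h1,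
    ← Finset.sum_fiberwise_of_maps_to (g := Finsupp.degree) (fun e he =>
      Finset.mem_image_of_mem Finsupp.degree he)]
  refine Finset.sum_eq_zero fun k _ => ?_
  have h2 : ∀ e ∈ h.support.filter (Finsupp.degree · = k),
      algebraMap ℂ (Weyl (Fin (n + 1))) (∏ i ∈ Finset.range e.degree, (κ + m - i)) •
        V (m - e.degree) (MvPolynomial.monomial e (h.coeff e)) =
      algebraMap ℂ (Weyl (Fin (n + 1))) (∏ i ∈ Finset.range k, (κ + m - i)) •
        V (m - k) (MvPolynomial.monomial e (h.coeff e)) := by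
    intro e he
    rw [(Finset.mem_filter.1 he).2]
  rw [Finset.sum_congr rfl h2, ← Finset.smul_sum, ← hV.map_sum,
    ← MvPolynomial.homogeneousComponent_apply,
    hV.vanish _ _ (homogeneousComponent_mem_reciprocalIdeal hh k), smul_zero]

/-- Euler's relation in z: by the `del` and `euler` rules ∑ z_j ∂_j acts on V m 1 as the scalar κ+m,
and s is added to it. -/
theorem opH_smul_eq_zero (hV : PowerFamily A κ V) {u : Fin (n + 1) → ℂ} (m : ℤ) (hm : κ + m = -sParam d u) :
    opH d u • V m 1 = 0 := by
  have h1 : ∀ j, (Weyl.z j * Weyl.del j) • V m 1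
      = algebraMap ℂ (Weyl (Fin (n + 1))) (κ + m) •
        Weyl.z j • V (m - 1) (MvPolynomial.X j * 1) := by
    intro j
    rw [mul_smul, hV.del, Weyl.smul_algebraMap_smul]
  rw [opH, add_smul, Finset.sum_smul]
  simp only [h1]
  rw [← Finset.smul_sum, hV.euler, ← add_smul, ← map_add, hm, neg_add_cancel, map_zero, zero_smul]

/-- Both terms share the factor κ+m. In the two models, the remaining bracket is minus the
t_i-derivative of φ f^(m-1), because ∂f/∂t_i = -∑ a_ij z_j/ℓ_j². This is the form in which exactness
is later recognised. -/
theorem opP_smul (hV : PowerFamily A κ V) (u : Fin (n + 1) → ℂ) (m : ℤ) (i : Fin (d + 1)) :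
    opP A u i • V m 1 = algebraMap ℂ (Weyl (Fin (n + 1))) (κ + m) •
      (algebraMap ℂ (Weyl (Fin (n + 1))) (κ + m - 1) • ∑ j, Weyl.z j •
          V (m - 2) (A i j • MvPolynomial.X j ^ 2)
        - V (m - 1) (∑ j, (A i j * u j) • MvPolynomial.X j)) := by
  rw [opP, sub_smul, Finset.sum_smul, Finset.sum_smul, smul_sub, hV.map_sum, Finset.smul_sum,
    Finset.smul_sum, Finset.smul_sum]
  congr 1
  · refine Finset.sum_congr rfl fun j _ => ?_
    rw [Algebra.smul_def, mul_smul, mul_smul, hV.del_pow, hV.smul, Finset.prod_range_succ,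
      Finset.prod_range_one, map_mul, mul_smul, mul_one]
    rw [Weyl.smul_algebraMap_smul (Weyl.z j), Weyl.smul_algebraMap_smul (Weyl.z j),
      Weyl.smul_algebraMap_smul (Weyl.z j), smul_smul, smul_smul, smul_smul, smul_smul,
      smul_smul, smul_smul, ← map_mul, ← map_mul, ← map_mul, ← map_mul]
    congr 3
    push_cast
    ring
  · refine Finset.sum_congr rfl fun j _ => ?_
    rw [Algebra.smul_def, mul_smul, hV.del, hV.smul, mul_one, ← mul_smul, ← mul_smul,
      Algebra.commutes]

/-- If `V m 1` is annihilated by the operators `P_i` modulo a submodule, then it is annihilated by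
the whole matroid hypergeometric ideal modulo that submodule. -/
theorem hypIdeal_smul_mem (hV : PowerFamily A κ V) {u : Fin (n + 1) → ℂ} (m : ℤ) (hm : κ + m = -sParam d u)
    (N : Submodule (Weyl (Fin (n + 1))) M) (hP : ∀ i, opP A u i • V m 1 ∈ N)
    {P : Weyl (Fin (n + 1))} (h : P ∈ hypIdeal A u) : P • V m 1 ∈ N := by
  induction h using Submodule.span_induction with
  | mem x hx =>
    rcases hx with (rfl | ⟨i, rfl⟩) | ⟨h, hh, rfl⟩
    · rw [hV.opH_smul_eq_zero m hm]; exact N.zero_mem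
    · exact hP i
    · rw [hV.ofSymbol_smul_eq_zero hh]; exact N.zero_mem
  | zero => rw [zero_smul]; exact N.zero_mem
  | add x y _ _ hx hy => rw [add_smul]; exact N.add_mem hx hy
  | smul a x _ hx => rw [smul_eq_mul, mul_smul]; exact N.smul_mem a hx

end PowerFamily


/-! ## Exterior and interior multiplication of forms -/

section interior

variable {d n : ℕ} (A : Matrix (Fin (d + 1)) (Fin (n + 1)) ℂ) (u : Fin (n + 1) → ℂ)

/-- A new index changes the position of a exactly when it is smaller than a. The case b = a leaves
the sign alone. -/
theorem wedgeSign_insert {a b : Fin (d + 1)} {I : Finset (Fin (d + 1))} (hb : b ∉ I) :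
    (wedgeSign a (insert b I) : RatTZ d n) = (if b < a then -1 else 1) * wedgeSign a I := by
  unfold wedgeSign
  rw [Finset.filter_insert]
  split_ifs
  · rw [Finset.card_insert_of_notMem (by simp [hb]), pow_succ']
  · rw [one_mul]

theorem wedgeSign_erase {a b : Fin (d + 1)} {I : Finset (Fin (d + 1))} (hb : b ∈ I) :
    (wedgeSign a (I.erase b) : RatTZ d n) = (if b < a then -1 else 1) * wedgeSign a I := by
  have h := wedgeSign_insert (n := n) (a := a) (Finset.notMem_erase b I)
  rw [Finset.insert_erase hb] at h
  rw [h]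
  split_ifs <;> ring

theorem wedgeSign_mul_self (a : Fin (d + 1)) (I : Finset (Fin (d + 1))) :
    (wedgeSign a I : RatTZ d n) * wedgeSign a I = 1 := by
  unfold wedgeSign
  rw [← mul_pow]
  simp

theorem wedgeSign_mem (a : Fin (d + 1)) (I : Finset (Fin (d + 1))) :
    wedgeSign a I ∈ regRing A := pow_mem (neg_mem (one_mem _)) _

theorem scale_wedgeSign (l : ℂˣ) (a : Fin (d + 1)) (I : Finset (Fin (d + 1))) :
    scale l (wedgeSign a I : RatTZ d n) = wedgeSign a I := by
  simp [wedgeSign]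

variable {A u}

/-- Contraction of a form with the vector field `∂/∂t_b`. -/
def formInterior (b : Fin (d + 1)) (η : Forms A u) : Forms A u := fun I =>
  if b ∈ I then 0 else wedgeSign b I * η (insert b I)

/-- Multiplication of a form by a rational function. -/
def mulForm (g : RatTZ d n) (η : Forms A u) : Forms A u := fun I => g * η I

/-- The twisted derivative of the coefficients of a form with respect to `t_a`. -/
def twistedPd (a : Fin (d + 1)) (η : Forms A u) : Forms A u := fun I =>
  pd (Sum.inl a) (η I) + omega A u a * η I

/-- Contractions with two vector fields anticommute; here one of them is the Euler field. It makes
the primitive of a form on projective space horizontal again. -/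
theorem contract_formInterior (b : Fin (d + 1)) (η : Forms A u) (I : Finset (Fin (d + 1))) :
    contract A u (formInterior b η) I = -formInterior b (contract A u η) I := by
  unfold contract formInterior
  by_cases hb : b ∈ I
  · simp [hb]
  · rw [if_neg hb, ← Finset.sum_erase_add _ _ (Finset.mem_compl.2 hb), if_pos (by simp),
      mul_zero, mul_zero, add_zero, Finset.mul_sum, ← Finset.sum_neg_distrib]
    have hI : Iᶜ.erase b = (insert b I)ᶜ := by
      ext x
      simp
    rw [hI]
    refine Finset.sum_congr rfl fun a ha => ?_
    have hab : a ≠ b ∧ a ∉ I := by simpa using ha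
    rw [if_neg (by simp [hb, hab.1.symm]), wedgeSign_insert hab.2, wedgeSign_insert hb,
      Finset.insert_comm]
    rcases lt_or_gt_of_ne hab.1 with h | h
    · rw [if_pos h, if_neg h.not_gt]; ring
    · rw [if_pos h, if_neg h.not_gt]; ring

theorem contract_mulForm (g : RatTZ d n) (η : Forms A u) :
    contract A u (mulForm g η) = mulForm g (contract A u η) := by
  funext I
  unfold contract mulForm
  rw [Finset.mul_sum]
  refine Finset.sum_congr rfl fun a _ => ?_
  ring

/-- Cartan's formula for the contraction with `∂/∂t_b`. -/
theorem nabla_formInterior (b : Fin (d + 1)) (η : Forms A u) (I : Finset (Fin (d + 1))) :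
    nabla A u (formInterior b η) I = twistedPd b η I - formInterior b (nabla A u η) I := by
  change nablaFun A u (formInterior b η) I = twistedPd b η I - formInterior b (nablaFun A u η) I
  have hpd : ∀ a (J : Finset (Fin (d + 1))), b ∉ J →
      pd (Sum.inl a) (formInterior b η J) + omega A u a * formInterior b η J
        = wedgeSign b J * twistedPd a η (insert b J) := by
    intro a J hJ
    unfold formInterior twistedPd
    rw [if_neg hJ, Derivation.leibniz, pd_wedgeSign]
    simp only [smul_eq_mul]
    ring
  have hpd0 : ∀ a (J : Finset (Fin (d + 1))), b ∈ J →
      pd (Sum.inl a) (formInterior b η J) + omega A u a * formInterior b η J = 0 := by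
    intro a J hJ
    unfold formInterior
    rw [if_pos hJ]
    simp
  unfold nablaFun
  -- If b ∈ I, only a = b survives in ∇ ι_b η, since ι_b η vanishes on sets containing b, and ι_b ∇η
  -- vanishes at I. If b ∉ I, the summand a = b of ι_b ∇η supplies the twisted derivative and the
  -- other summands cancel in pairs by sign.
  by_cases hb : b ∈ I
  · rw [Finset.sum_eq_single b]
    · rw [hpd _ _ (Finset.notMem_erase b I), wedgeSign_erase hb, if_neg (lt_irrefl b), one_mul,
        Finset.insert_erase hb, ← mul_assoc, wedgeSign_mul_self, one_mul]
      simp [formInterior, hb]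
    · intro a _ hab
      rw [hpd0 _ _ (Finset.mem_erase.2 ⟨hab.symm, hb⟩), mul_zero]
    · exact fun h => absurd hb h
  · unfold formInterior
    rw [if_neg hb]
    change _ = _ - wedgeSign b I * ∑ a ∈ insert b I, wedgeSign a (insert b I) *
      twistedPd a η ((insert b I).erase a)
    rw [Finset.sum_insert hb, wedgeSign_insert hb, if_neg (lt_irrefl b),
      Finset.erase_insert hb]
    rw [mul_add, one_mul, ← mul_assoc, wedgeSign_mul_self, one_mul, sub_add_cancel_left,
      Finset.mul_sum, ← Finset.sum_neg_distrib]
    refine Finset.sum_congr rfl fun a ha => ?_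
    have hab : a ≠ b := fun h => hb (h ▸ ha)
    have := hpd a (I.erase a) (by simp [hb])
    unfold formInterior at this
    rw [this, wedgeSign_insert hb, wedgeSign_erase ha, Finset.erase_insert_of_ne hab.symm]
    rcases lt_or_gt_of_ne hab with h | h
    · rw [if_pos h, if_neg h.not_gt]; ring
    · rw [if_pos h, if_neg h.not_gt]; ring

theorem nabla_mulForm (g : RatTZ d n) (η : Forms A u) (I : Finset (Fin (d + 1))) :
    nabla A u (mulForm g η) I =
      (∑ a ∈ I, wedgeSign a I * (pd (Sum.inl a) g * η (I.erase a))) + g * nabla A u η I := by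
  change nablaFun A u (mulForm g η) I = _ + g * nablaFun A u η I
  unfold nablaFun mulForm
  rw [Finset.mul_sum, ← Finset.sum_add_distrib]
  refine Finset.sum_congr rfl fun a _ => ?_
  rw [Derivation.leibniz]
  simp only [smul_eq_mul]
  ring

end interior

/-! ## The twisted forms `f ^ m p(1/ℓ) Ω` -/

section powers

variable {d n : ℕ} (A : Matrix (Fin (d + 1)) (Fin (n + 1)) ℂ) (u : Fin (n + 1) → ℂ)

/-- The z_0-derivative of f is 1/ℓ_0, which is nonzero. -/
theorem fRat_ne_zero (hA : ∀ j, ∃ i, A i j ≠ 0) : fRat A ≠ 0 := by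
  intro h
  have := pd_z_fRat A 0
  rw [h, map_zero] at this
  exact inv_ne_zero (ell_ne_zero A (hA 0)) this.symm

/-- The coefficients of the form `Ω(t)`. -/
def omegaCoeff (I : Finset (Fin (d + 1))) : RatTZ d n :=
  ∑ i : Fin (d + 1), if I = Finset.univ.erase i then (-1) ^ (i : ℕ) * tv i else 0

theorem eulerForm_eq (I : Finset (Fin (d + 1))) :
    eulerForm A u I = fRat A ^ (d + 1) * omegaCoeff I := by
  unfold eulerForm omegaCoeff
  rw [Finset.mul_sum]
  refine Finset.sum_congr rfl fun i _ => ?_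
  rw [mul_ite, mul_zero]

theorem pd_neg_one_pow (v : Fin (d + 1) ⊕ Fin (n + 1)) (k : ℕ) :
    pd v ((-1 : RatTZ d n) ^ k) = 0 := by
  rcases neg_one_pow_eq_or (RatTZ d n) k with h | h <;> rw [h] <;> simp

theorem pd_z_omegaCoeff (j : Fin (n + 1)) (I : Finset (Fin (d + 1))) :
    pd (Sum.inr j) (omegaCoeff I : RatTZ d n) = 0 := by
  unfold omegaCoeff
  rw [map_sum]
  refine Finset.sum_eq_zero fun i _ => ?_
  split_ifs
  · rw [Derivation.leibniz, pd_neg_one_pow, pd_tv]; simp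
  · simp

theorem pd_t_omegaCoeff (i : Fin (d + 1)) (I : Finset (Fin (d + 1))) :
    pd (Sum.inl i) (omegaCoeff I : RatTZ d n)
      = if I = Finset.univ.erase i then (-1) ^ (i : ℕ) else 0 := by
  unfold omegaCoeff
  rw [map_sum, Finset.sum_eq_single i]
  · split_ifs
    · rw [Derivation.leibniz, pd_neg_one_pow, pd_tv]; simp
    · simp
  · intro b _ hb
    split_ifs
    · rw [Derivation.leibniz, pd_neg_one_pow, pd_tv]; simp [hb.symm]
    · simp
  · simp

/-- The polynomial `p` evaluated at `(1/ℓ_0, …, 1/ℓ_n)`. -/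
def evalInv (p : MvPolynomial (Fin (n + 1)) ℂ) : RatTZ d n :=
  MvPolynomial.aeval (fun j => (ell A j)⁻¹) p

theorem pd_z_evalInv (j : Fin (n + 1)) (p : MvPolynomial (Fin (n + 1)) ℂ) :
    pd (Sum.inr j) (evalInv A p) = 0 := by
  unfold evalInv
  induction p using MvPolynomial.induction_on with
  | C c => simp
  | add p q hp hq => rw [map_add, map_add, hp, hq, add_zero]
  | mul_X p i hp =>
    rw [map_mul, Derivation.leibniz, hp, MvPolynomial.aeval_X, Derivation.leibniz_inv, pd_z_ell]
    simp

theorem evalInv_X_mul (j : Fin (n + 1)) (p : MvPolynomial (Fin (n + 1)) ℂ) :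
    evalInv A (MvPolynomial.X j * p) = (ell A j)⁻¹ * evalInv A p := by
  simp [evalInv]

/-- Clearing denominators in p(1/ℓ) simultaneously in the function field and at every point off the
hyperplanes. It carries the pointwise definition of the reciprocal ideal over to an identity of
rational functions. -/
theorem exists_numerator (hA : ∀ j, ∃ i, A i j ≠ 0) (p : MvPolynomial (Fin (n + 1)) ℂ) :
    ∃ (g q : Poly d n), g ≠ 0 ∧ algebraMap _ (RatTZ d n) g * evalInv A p = algebraMap _ _ q ∧
      ∀ v : Fin (d + 1) ⊕ Fin (n + 1) → ℂ, (∀ j, ∑ i, A i j * v (Sum.inl i) ≠ 0) →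
        MvPolynomial.eval v g * MvPolynomial.eval (fun j => (∑ i, A i j * v (Sum.inl i))⁻¹) p
          = MvPolynomial.eval v q := by
  have hl : ∀ j, algebraMap (Poly d n) (RatTZ d n)
      (∑ i, A i j • MvPolynomial.X (Sum.inl i)) = ell A j := by
    intro j
    simp only [map_sum, ell, Algebra.smul_def, map_mul, ← IsScalarTower.algebraMap_apply]
    rfl
  induction p using MvPolynomial.induction_on with
  | C c => exact ⟨1, MvPolynomial.C c, one_ne_zero, by
      simp [evalInv, IsScalarTower.algebraMap_apply ℂ (Poly d n) (RatTZ d n)], by simp⟩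
  | add p q hp hq =>
    obtain ⟨g, p', hg, h1, h2⟩ := hp
    obtain ⟨g', q', hg', h1', h2'⟩ := hq
    refine ⟨g * g', p' * g' + g * q', mul_ne_zero hg hg', ?_, fun v hv => ?_⟩
    · simp only [map_mul, map_add, ← h1, ← h1']
      unfold evalInv
      rw [map_add]
      ring
    · simp only [map_mul, map_add, ← h2 v hv, ← h2' v hv]
      ring
  | mul_X p j hp =>
    obtain ⟨g, p', hg, h1, h2⟩ := hp
    have h0 := ell_ne_zero A (hA j)
    refine ⟨g * ∑ i, A i j • MvPolynomial.X (Sum.inl i), p', mul_ne_zero hg ?_, ?_, fun v hv => ?_⟩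
    · intro h
      rw [← hl, h, map_zero] at h0
      exact h0 rfl
    · rw [← h1, map_mul, hl]
      unfold evalInv
      rw [map_mul, MvPolynomial.aeval_X]
      field_simp
    · rw [← h2 v hv]
      have := hv j
      simp only [map_mul, map_sum, MvPolynomial.eval_X, MvPolynomial.smul_eval]
      field_simp

theorem column_mem_span (v : Fin (d + 1) → ℂ) :
    (fun j => ∑ i, A i j * v i) ∈ Submodule.span ℂ (Set.range A) := by
  have : (fun j => ∑ i, A i j * v i) = ∑ i, v i • A i := by
    funext j
    simp [mul_comm]
  rw [this]
  exact sum_mem fun i _ => Submodule.smul_mem _ _ (Submodule.subset_span ⟨i, rfl⟩)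

/-- The numerator q of p(1/ℓ) vanishes wherever no ℓ_j does, so q ∏ ℓ_j vanishes at every point and
is the zero polynomial over the infinite field ℂ. As each ℓ_j is nonzero, q = 0. -/
theorem evalInv_eq_zero (hA : ∀ j, ∃ i, A i j ≠ 0) {p : MvPolynomial (Fin (n + 1)) ℂ}
    (hp : p ∈ reciprocalIdeal A) : evalInv A p = 0 := by
  obtain ⟨g, q, hg, h1, h2⟩ := exists_numerator A hA p
  have hl : ∀ j, (∑ i, A i j • MvPolynomial.X (Sum.inl i) : Poly d n) ≠ 0 := by
    intro j h
    obtain ⟨i, hi⟩ := hA j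
    have := congrArg (MvPolynomial.eval (Sum.elim (Pi.single i 1) 0)) h
    simp [Pi.single_apply] at this
    exact hi this
  have hq : q * ∏ j, (∑ i, A i j • MvPolynomial.X (Sum.inl i) : Poly d n) = 0 := by
    refine MvPolynomial.funext fun v => ?_
    rw [map_mul, map_zero, map_prod]
    by_cases hv : ∀ j, ∑ i, A i j * v (Sum.inl i) ≠ 0
    · rw [← h2 v hv, ← MvPolynomial.aeval_eq_eval (fun j => (∑ i, A i j * v (Sum.inl i))⁻¹),
        MvPolynomial.mem_vanishingIdeal_iff.1 hp,
        mul_zero, zero_mul]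
      exact ⟨_, column_mem_span A _, hv, rfl⟩
    · push Not at hv
      obtain ⟨j, hj⟩ := hv
      rw [Finset.prod_eq_zero (Finset.mem_univ j), mul_zero]
      simpa using hj
  rw [(mul_eq_zero.1 hq).resolve_right (Finset.prod_ne_zero_iff.2 fun j _ => hl j), map_zero] at h1
  refine (mul_eq_zero.1 h1).resolve_left fun h => hg ?_
  exact (map_eq_zero_iff _ (IsFractionRing.injective (Poly d n) (RatTZ d n))).1 h

/-- The form `f ^ m p(1/ℓ) Ω`. -/
def powerForm (m : ℤ) (p : MvPolynomial (Fin (n + 1)) ℂ) : Forms A u := fun I =>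
  fRat A ^ m * evalInv A p * omegaCoeff I

theorem pd_zpow (v : Fin (d + 1) ⊕ Fin (n + 1)) (g : RatTZ d n) (m : ℤ) :
    pd v (g ^ m) = m * g ^ (m - 1) * pd v g := by
  rw [Derivation.leibniz_zpow]
  simp only [zsmul_eq_mul, smul_eq_mul, mul_assoc]

theorem Forms.sum_apply {α : Type*} (s : Finset α) (η : α → Forms A u)
    (I : Finset (Fin (d + 1))) : (∑ a ∈ s, η a) I = ∑ a ∈ s, η a I :=
  Finset.sum_apply I s η

/-- In the `del` rule the coefficient κ+m has two sources: differentiating f^m gives m, and the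
twist `kappa` gives κ = -(s+d+1). -/
theorem powerForm_powerFamily (hA : ∀ j, ∃ i, A i j ≠ 0) :
    PowerFamily A (-(sParam d u + d + 1)) (powerForm A u) where
  add m p q := by
    funext I
    change _ = powerForm A u m p I + powerForm A u m q I
    simp only [powerForm, evalInv, map_add]
    ring
  smul m c p := by
    rw [Forms.algebraMap_smul]
    funext I
    change _ = c • powerForm A u m p I
    simp only [powerForm, evalInv, map_smul, mul_smul_comm, smul_mul_assoc]
  del m j p := by
    rw [Forms.algebraMap_smul]
    funext I
    change _ = (-(sParam d u + d + 1) + (m : ℂ)) • powerForm A u (m - 1) (MvPolynomial.X j * p) I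
    rw [Forms.del_smul]
    have hf := fRat_ne_zero A hA
    simp only [powerForm, kappa, Derivation.leibniz, pd_zpow, pd_z_omegaCoeff, pd_z_evalInv,
      pd_z_fRat, smul_eq_mul, Algebra.smul_def, map_add, map_neg, zpow_sub_one₀ hf,
      evalInv_X_mul, map_intCast, map_natCast, map_one]
    ring
  euler m p := by
    funext I
    have hf := fRat_ne_zero A hA
    rw [Forms.sum_apply]
    simp only [Forms.z_smul, powerForm, evalInv_X_mul]
    have h1 : ∀ j, zv j * (fRat A ^ (m - 1) * ((ell A j)⁻¹ * evalInv A p) * omegaCoeff I)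
        = (zv j / ell A j) * (fRat A ^ (m - 1) * evalInv A p * omegaCoeff I) := by
      intro j
      ring
    simp only [h1]
    rw [← Finset.sum_mul, ← fRat, zpow_sub_one₀ hf]
    field_simp
  vanish m p hp := by
    funext I
    change fRat A ^ m * evalInv A p * omegaCoeff I = 0
    rw [evalInv_eq_zero A hA hp, mul_zero, zero_mul]

theorem powerForm_one : powerForm A u ((d + 1 : ℕ) : ℤ) 1 = eulerForm A u := by
  funext I
  rw [eulerForm_eq, powerForm, zpow_natCast, evalInv, map_one, mul_one]

theorem mulForm_inv_eulerForm (hA : ∀ j, ∃ i, A i j ≠ 0) (I : Finset (Fin (d + 1))) :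
    mulForm (fRat A)⁻¹ (eulerForm A u) I = fRat A ^ d * omegaCoeff I := by
  have hf := fRat_ne_zero A hA
  rw [mulForm, eulerForm_eq, pow_succ]
  field_simp

/-- As f^(d+1) Ω is closed, Leibniz leaves only d_t(1/f) ∧ f^(d+1) Ω. Wedging with Ω evaluates the
Euler field, and 1/f has degree 1 in t, so the result is f^d dt_0 ∧ … ∧ dt_d. -/
theorem nabla_mulForm_inv_eulerForm (hA : ∀ j, ∃ i, A i j ≠ 0) (I : Finset (Fin (d + 1))) :
    nabla A u (mulForm (fRat A)⁻¹ (eulerForm A u)) I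
      = if I = Finset.univ then fRat A ^ d else 0 := by
  have hf := fRat_ne_zero A hA
  rw [nabla_mulForm, nabla_eulerForm A u hA]
  change _ + (fRat A)⁻¹ * (0 : RatTZ d n) = _
  rw [mul_zero, add_zero]
  split_ifs with hI
  · subst hI
    have h1 : ∀ a : Fin (d + 1), wedgeSign a Finset.univ * (pd (Sum.inl a) (fRat A)⁻¹ *
        eulerForm A u (Finset.univ.erase a))
        = -(fRat A ^ (d + 1) * (fRat A)⁻¹ ^ 2) * (tv a * pd (Sum.inl a) (fRat A)) := by
      intro a
      rw [eulerForm_erase, Derivation.leibniz_inv, wedgeSign, card_filter_lt]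
      have h2 : ((-1 : RatTZ d n) ^ (a : ℕ)) * (-1) ^ (a : ℕ) = 1 := by
        rw [← mul_pow]; simp
      rw [smul_eq_mul]
      linear_combination (-(fRat A ^ (d + 1) * (fRat A)⁻¹ ^ 2)
        * (tv a * pd (Sum.inl a) (fRat A))) * h2
    simp only [h1]
    rw [← Finset.mul_sum, euler_fRat, pow_succ]
    field_simp
  · refine Finset.sum_eq_zero fun a ha => ?_
    rw [eulerForm_of_card_ne, mul_zero, mul_zero]
    intro h
    have h1 := Finset.card_erase_add_one ha
    exact hI (Finset.eq_univ_of_card _ (by rw [Fintype.card_fin]; omega))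

/-- The primitive `f ^ d ι_i Ω` of the form that `P_i` makes of `f ^ (d + 1) Ω`. -/
def primitive (i : Fin (d + 1)) : Forms A u :=
  formInterior i (mulForm (fRat A)⁻¹ (eulerForm A u))

theorem isRelForm_primitive (hA : ∀ j, ∃ i, A i j ≠ 0) (i : Fin (d + 1)) :
    IsRelForm A u ((d : ℤ) - 1) (primitive A u i) := by
  obtain ⟨h1, h2, h3, h4⟩ := (eulerForm_mem A u hA).1
  refine ⟨fun I hI => ?_, fun I => ?_, fun l I => ?_, ?_⟩
  · unfold primitive formInterior mulForm
    split_ifs with hi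
    · rfl
    · rw [h1, mul_zero, mul_zero]
      rw [Finset.card_insert_of_notMem hi]
      push_cast
      omega
  · unfold primitive formInterior mulForm
    split_ifs with hi
    · exact zero_mem _
    · exact mul_mem (wedgeSign_mem A _ _) (mul_mem (fRat_inv_mem A) (h2 _))
  · unfold primitive formInterior mulForm
    split_ifs with hi
    · simp
    · rw [map_mul, map_mul, scale_wedgeSign, map_inv₀, scale_fRat, h3]
      simp only [Algebra.smul_def, mul_inv, ← map_inv₀]
      -- Weights: the coefficients of f^(d+1) Ω have degree -d and 1/f has degree 1, which adds up
      -- to -(d-1), as required of a (d-1)-form.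
      have : (((l ^ (-((d : ℤ) - 1)) : ℂˣ)) : ℂ) = (((l⁻¹ : ℂˣ) : ℂ))⁻¹ * ((l ^ (-(d : ℤ)) : ℂˣ) : ℂ) := by
        rw [← Units.val_inv_eq_inv_val, ← Units.val_mul, inv_inv, neg_sub, sub_eq_add_neg, zpow_add,
          zpow_one]
      rw [this, map_mul]
      ring
  · funext I
    rw [primitive, contract_formInterior, contract_mulForm, h4]
    change -(if i ∈ I then (0 : RatTZ d n) else wedgeSign i I * ((fRat A)⁻¹ * 0)) = 0
    simp

/-- Ω is the contraction of the volume form with the Euler field, whose t_i-derivative is the field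
∂/∂t_i. Hence contracting the volume form with ∂/∂t_i is the same as differentiating the
coefficients of Ω by t_i. -/
theorem formInterior_volume (i : Fin (d + 1)) (g : RatTZ d n) (η : Forms A u)
    (hη : ∀ I, η I = if I = Finset.univ then g else 0) (I : Finset (Fin (d + 1))) :
    formInterior i η I = g * pd (Sum.inl i) (omegaCoeff I) := by
  rw [pd_t_omegaCoeff]
  unfold formInterior
  by_cases hI : I = Finset.univ.erase i
  · subst hI
    rw [if_neg (by simp), if_pos rfl, hη, if_pos (by simp), wedgeSign_erase (Finset.mem_univ _),
      if_neg (lt_irrefl _), wedgeSign, card_filter_lt]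
    ring
  · rw [if_neg hI, mul_zero]
    split_ifs with hi
    · rfl
    · rw [hη, if_neg, mul_zero]
      intro h
      apply hI
      rw [← h, Finset.erase_insert hi]

/-- In Cartan's formula the twisted derivative of f^d Ω contains f^d ∂Ω/∂t_i, and ι_i ∇(f^d Ω) is
the same form. After cancellation only the derivative of the factor φ f^d is left. -/
theorem nabla_primitive (hA : ∀ j, ∃ i, A i j ≠ 0) (i : Fin (d + 1))
    (I : Finset (Fin (d + 1))) : nabla A u (primitive A u i) I =
      (pd (Sum.inl i) (fRat A ^ d) + omega A u i * fRat A ^ d) * omegaCoeff I := by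
  rw [primitive, nabla_formInterior, formInterior_volume A u i _ _ (nabla_mulForm_inv_eulerForm A u hA),
    twistedPd, mulForm_inv_eulerForm A u hA, Derivation.leibniz]
  simp only [smul_eq_mul]
  ring

theorem pd_t_fRat (i : Fin (d + 1)) :
    pd (Sum.inl i) (fRat A) = -∑ j, zv j * (algebraMap ℂ _ (A i j) * (ell A j)⁻¹ ^ 2) := by
  simp only [fRat, map_sum, ← Finset.sum_neg_distrib]
  refine Finset.sum_congr rfl fun j _ => ?_
  rw [Derivation.leibniz_div, pd_t_ell, pd_zv]
  simp only [reduceCtorEq, if_false, smul_eq_mul]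
  ring

/-- The operator `P_i` maps `f ^ (d + 1) Ω` to an exact form. -/
theorem opP_smul_eulerForm (hA : ∀ j, ∃ i, A i j ≠ 0) (i : Fin (d + 1)) :
    opP A u i • eulerForm A u
      = algebraMap ℂ (Weyl (Fin (n + 1))) (sParam d u) • nabla A u (primitive A u i) := by
  have hf := fRat_ne_zero A hA
  rw [← powerForm_one, (powerForm_powerFamily A u hA).opP_smul, Forms.algebraMap_smul,
    Forms.algebraMap_smul, Forms.algebraMap_smul]
  funext I
  have e1 : ∀ j, (Weyl.z j • powerForm A u (((d + 1 : ℕ) : ℤ) - 2)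
      (A i j • MvPolynomial.X j ^ 2)) I
      = (zv j * (algebraMap ℂ _ (A i j) * (ell A j)⁻¹ ^ 2)) *
        (fRat A ^ (d : ℤ) * (fRat A)⁻¹ * omegaCoeff I) := by
    intro j
    rw [Forms.z_smul, powerForm, evalInv, map_smul, map_pow, MvPolynomial.aeval_X,
      Algebra.smul_def, show ((d + 1 : ℕ) : ℤ) - 2 = (d : ℤ) - 1 by push_cast; ring,
      zpow_sub_one₀ hf]
    ring
  have e2 : powerForm A u (((d + 1 : ℕ) : ℤ) - 1)
      (∑ j, (A i j * u j) • MvPolynomial.X j) I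
      = (∑ j, u j • (pd (Sum.inl i) (ell A j) / ell A j)) *
        (fRat A ^ (d : ℤ) * omegaCoeff I) := by
    rw [powerForm, evalInv, map_sum, show ((d + 1 : ℕ) : ℤ) - 1 = (d : ℤ) by push_cast; ring,
      Finset.mul_sum, Finset.sum_mul, Finset.sum_mul]
    refine Finset.sum_congr rfl fun j _ => ?_
    rw [map_smul, MvPolynomial.aeval_X, pd_t_ell, Algebra.smul_def, Algebra.smul_def, map_mul]
    ring
  change (_ : ℂ) • ((_ : ℂ) • (∑ j, Weyl.z j • powerForm A u (((d + 1 : ℕ) : ℤ) - 2)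
      (A i j • MvPolynomial.X j ^ 2)) I - powerForm A u (((d + 1 : ℕ) : ℤ) - 1)
      (∑ j, (A i j * u j) • MvPolynomial.X j) I) = sParam d u • nabla A u (primitive A u i) I
  rw [Forms.sum_apply, Finset.sum_congr rfl fun j _ => e1 j, e2, ← Finset.sum_mul,
    nabla_primitive A u hA, omega, ← zpow_natCast, pd_zpow, zpow_sub_one₀ hf, pd_t_fRat]
  simp only [Algebra.smul_def, map_add, map_neg, map_sub, map_one, map_natCast,
    Int.cast_natCast, Nat.cast_add, Nat.cast_one, Int.cast_add, Int.cast_one]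
  ring

theorem opP_smul_eulerForm_mem (hA : ∀ j, ∃ i, A i j ≠ 0) (i : Fin (d + 1)) :
    opP A u i • eulerForm A u ∈ coboundaries A u d := by
  rw [opP_smul_eulerForm A u hA]
  exact Submodule.smul_mem _ _ ⟨_, isRelForm_primitive A u hA i, rfl⟩

theorem hypIdeal_smul_eulerClass (hA : ∀ j, ∃ i, A i j ≠ 0) {P : Weyl (Fin (n + 1))}
    (hP : P ∈ hypIdeal A u) : P • eulerClass A u hA = 0 := by
  have h := (powerForm_powerFamily A u hA).hypIdeal_smul_mem ((d + 1 : ℕ) : ℤ)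
    (u := u) (by push_cast; ring) (coboundaries A u d)
    (fun i => by rw [powerForm_one]; exact opP_smul_eulerForm_mem A u hA i) hP
  rw [powerForm_one] at h
  rw [eulerClass, ← Submodule.Quotient.mk_smul, Submodule.Quotient.mk_eq_zero]
  exact h

/-- The module D / H_L(u) is cyclic: a homomorphism is determined by the image of the class of 1,
and any element annihilated by H_L(u) may be that image. -/
theorem existsUnique_hom (hA : ∀ j, ∃ i, A i j ≠ 0) :
    ∃! ψ : HypSystem A u →ₗ[Weyl (Fin (n + 1))] HypCohomology A u,
      ψ (Submodule.Quotient.mk 1) = eulerClass A u hA := by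
  refine ⟨(hypIdeal A u).liftQ (LinearMap.toSpanSingleton _ _ (eulerClass A u hA)) ?_, ?_, ?_⟩
  · intro P hP
    exact hypIdeal_smul_eulerClass A u hA hP
  · change (1 : Weyl (Fin (n + 1))) • eulerClass A u hA = _
    rw [one_smul]
  · intro ψ hψ
    refine Submodule.linearMap_qext _ (LinearMap.ext_ring ?_)
    change ψ (Submodule.Quotient.mk 1) = (1 : Weyl (Fin (n + 1))) • eulerClass A u hA
    rw [hψ, one_smul]

end powers


/-! ## Stokes' theorem on the solid simplex -/

section stokes

open MeasureTheory Topology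

theorem isClosed_solidSimplex (m : ℕ) : IsClosed (solidSimplex m) := by
  have h : solidSimplex m = (⋂ i, {x | 0 ≤ x i}) ∩ {x | ∑ i, x i ≤ 1} := by
    ext x; simp [solidSimplex]
  rw [h]
  exact (isClosed_iInter fun i => isClosed_le continuous_const (continuous_apply i)).inter
    (isClosed_le (by fun_prop) continuous_const)

theorem isCompact_solidSimplex (m : ℕ) : IsCompact (solidSimplex m) := by
  refine (isCompact_univ_pi fun _ : Fin m => isCompact_Icc (a := (0 : ℝ)) (b := 1)).of_isClosed_subset
    (isClosed_solidSimplex m) fun x hx i _ => ⟨hx.1 i, ?_⟩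
  exact (Finset.single_le_sum (fun j _ => hx.1 j) (Finset.mem_univ i)).trans hx.2

theorem measurableSet_solidSimplex (m : ℕ) : MeasurableSet (solidSimplex m) :=
  (isClosed_solidSimplex m).measurableSet

theorem convex_solidSimplex (m : ℕ) : Convex ℝ (solidSimplex m) := by
  intro x hx y hy a b ha hb hab
  refine ⟨fun i => add_nonneg (mul_nonneg ha (hx.1 i)) (mul_nonneg hb (hy.1 i)), ?_⟩
  simp only [Pi.add_apply, Pi.smul_apply, smul_eq_mul, Finset.sum_add_distrib, ← Finset.mul_sum]
  nlinarith [hx.2, hy.2]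

theorem integrableOn_solidSimplex {m : ℕ} {g : (Fin m → ℝ) → ℂ}
    (hg : ContinuousOn g (solidSimplex m)) : IntegrableOn g (solidSimplex m) :=
  hg.integrableOn_compact (isCompact_solidSimplex m)

/-- The interior of the solid simplex. -/
def openSimplex (m : ℕ) : Set (Fin m → ℝ) := {x | (∀ i, 0 < x i) ∧ ∑ i, x i < 1}

theorem isOpen_openSimplex (m : ℕ) : IsOpen (openSimplex m) := by
  have h : openSimplex m = (⋂ i, {x | 0 < x i}) ∩ {x | ∑ i, x i < 1} := by
    ext x; simp [openSimplex]
  rw [h]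
  exact (isOpen_iInter_of_finite fun i => isOpen_lt continuous_const (continuous_apply i)).inter
    (isOpen_lt (by fun_prop) continuous_const)

theorem openSimplex_subset (m : ℕ) : openSimplex m ⊆ solidSimplex m :=
  fun _ hx => ⟨fun i => (hx.1 i).le, hx.2.le⟩

theorem interior_solidSimplex_subset (m : ℕ) : interior (solidSimplex m) ⊆ openSimplex m := by
  intro x hx
  have hnear : ∀ i : Fin m, ∀ᶠ t : ℝ in 𝓝 0, x + t • Pi.single i 1 ∈ solidSimplex m := by
    intro i
    have hc : ContinuousAt (fun t : ℝ => x + t • (Pi.single i 1 : Fin m → ℝ)) 0 := by fun_prop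
    refine hc.eventually_mem ?_
    simpa using mem_interior_iff_mem_nhds.1 hx
  refine ⟨fun i => ?_, ?_⟩
  · obtain ⟨t, h1, h2⟩ := (((hnear i).filter_mono nhdsWithin_le_nhds).and
      (self_mem_nhdsWithin (s := Set.Iio (0 : ℝ)))).exists
    have := h1.1 i
    simp at this h2
    linarith
  -- In dimension 0 there is no direction to move in, but the sum is empty and 0 < 1.
  · rcases isEmpty_or_nonempty (Fin m) with h | ⟨⟨i⟩⟩
    · simp
    · obtain ⟨t, h1, h2⟩ := (((hnear i).filter_mono nhdsWithin_le_nhds).and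
        (self_mem_nhdsWithin (s := Set.Ioi (0 : ℝ)))).exists
      have := h1.2
      simp [Finset.sum_add_distrib, ← Finset.mul_sum] at this h2
      linarith

/-- The frontier of a convex set is null. Branches are only known to be continuous up to the
boundary, so derivatives are used only at interior points. -/
theorem ae_mem_openSimplex (m : ℕ) :
    ∀ᵐ x ∂(volume : Measure (Fin m → ℝ)), x ∈ solidSimplex m → x ∈ openSimplex m := by
  have h := (convex_solidSimplex m).addHaar_frontier volume
  rw [measure_eq_zero_iff_ae_notMem] at h
  filter_upwards [h] with x hx hxS
  refine interior_solidSimplex_subset m ?_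
  by_contra hi
  exact hx ⟨subset_closure hxS, hi⟩

theorem insertNth_mem_solidSimplex {m : ℕ} (j : Fin (m + 1)) (t : ℝ) (w : Fin m → ℝ) :
    (j.insertNth t w : Fin (m + 1) → ℝ) ∈ solidSimplex (m + 1) ↔
      w ∈ solidSimplex m ∧ t ∈ Set.Icc 0 (1 - ∑ i, w i) := by
  simp only [solidSimplex, Set.mem_ofPred_eq, Fin.forall_iff_succAbove j, Fin.insertNth_apply_same,
    Fin.insertNth_apply_succAbove, Fin.sum_univ_succAbove _ j, Set.mem_Icc]
  constructor
  · rintro ⟨⟨h1, h2⟩, h3⟩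
    exact ⟨⟨h2, by linarith⟩, h1, by linarith⟩
  · rintro ⟨⟨h1, h2⟩, h3, h4⟩
    exact ⟨⟨h3, h1⟩, by linarith⟩

theorem insertNth_mem_openSimplex {m : ℕ} (j : Fin (m + 1)) (t : ℝ) {w : Fin m → ℝ}
    (hw : w ∈ openSimplex m) (ht : t ∈ Set.Ioo 0 (1 - ∑ i, w i)) :
    (j.insertNth t w : Fin (m + 1) → ℝ) ∈ openSimplex (m + 1) := by
  simp only [openSimplex, Set.mem_ofPred_eq, Fin.forall_iff_succAbove j, Fin.insertNth_apply_same,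
    Fin.insertNth_apply_succAbove, Fin.sum_univ_succAbove _ j]
  exact ⟨⟨ht.1, hw.1⟩, by linarith [ht.2]⟩

/-- Fubini with coordinate j innermost: the slice over w is the interval from the flat face t = 0 to
the slanted face t = 1 - ∑ w_i. -/
theorem integral_solidSimplex_succ {m : ℕ} (j : Fin (m + 1)) {g : (Fin (m + 1) → ℝ) → ℂ}
    (hg : ContinuousOn g (solidSimplex (m + 1))) :
    ∫ x in solidSimplex (m + 1), g x
      = ∫ w in solidSimplex m, ∫ t in (0)..(1 - ∑ i, w i), g (j.insertNth t w) := by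
  have hmp := (volume_preserving_piFinSuccAbove (fun _ : Fin (m + 1) => ℝ) j).symm
  rw [← integral_indicator (measurableSet_solidSimplex _), ← hmp.integral_comp']
  have hint : Integrable ((solidSimplex (m + 1)).indicator g) :=
    (integrable_indicator_iff (measurableSet_solidSimplex _)).2 (integrableOn_solidSimplex hg)
  have hint' := (hmp.integrable_comp_emb (MeasurableEquiv.measurableEmbedding _)).2 hint
  rw [Measure.volume_eq_prod, integral_prod_symm (fun x => (solidSimplex (m + 1)).indicator g
      ((MeasurableEquiv.piFinSuccAbove (fun _ : Fin (m + 1) => ℝ) j).symm x)) hint', ← integral_indicator (measurableSet_solidSimplex _)]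
  refine integral_congr_ae (Filter.Eventually.of_forall fun w => ?_)
  have hcoe : ∀ t : ℝ, (MeasurableEquiv.piFinSuccAbove (fun _ : Fin (m + 1) => ℝ) j).symm (t, w)
      = j.insertNth t w := fun t => rfl
  simp only [hcoe]
  by_cases hw : w ∈ solidSimplex m
  · rw [Set.indicator_of_mem hw, intervalIntegral.integral_of_le (by linarith [hw.2]),
      ← integral_Icc_eq_integral_Ioc, ← integral_indicator measurableSet_Icc]
    refine integral_congr_ae (Filter.Eventually.of_forall fun t => ?_)
    by_cases ht : t ∈ Set.Icc 0 (1 - ∑ i, w i)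
    · simp only [Set.indicator_of_mem ht]
      rw [Set.indicator_of_mem ((insertNth_mem_solidSimplex j t w).2 ⟨hw, ht⟩)]
    · simp only [Set.indicator_of_notMem ht]
      rw [Set.indicator_of_notMem fun h => ht ((insertNth_mem_solidSimplex j t w).1 h).2]
  · rw [Set.indicator_of_notMem hw]
    have : ∀ t : ℝ, (solidSimplex (m + 1)).indicator g (j.insertNth t w) = 0 := fun t =>
      Set.indicator_of_notMem (fun h => hw ((insertNth_mem_solidSimplex j t w).1 h).1) _
    simp [this]

/-! ### Reflections of the simplex and the slanted face -/

theorem continuous_insertNth {m : ℕ} (j : Fin (m + 1)) :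
    Continuous fun p : ℝ × (Fin m → ℝ) => (j.insertNth p.1 p.2 : Fin (m + 1) → ℝ) :=
  Continuous.finInsertNth (A := fun _ => ℝ) j continuous_fst continuous_snd

/-- The reflection of the solid simplex that exchanges the barycentric coordinates `0` and
`k + 1`. -/
def reflect {m : ℕ} (k : Fin m) (w : Fin m → ℝ) : Fin m → ℝ :=
  Function.update w k (1 - ∑ i, w i)

theorem continuous_reflect {m : ℕ} (k : Fin m) : Continuous (reflect k) := by
  unfold reflect
  exact continuous_id.update k (by fun_prop)

theorem sum_reflect {m : ℕ} (k : Fin m) (w : Fin m → ℝ) : 1 - ∑ i, reflect k w i = w k := by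
  unfold reflect
  rw [Finset.sum_update_of_mem (Finset.mem_univ k), ← Finset.add_sum_erase _ _ (Finset.mem_univ k),
    Finset.sdiff_singleton_eq_erase]
  ring

theorem reflect_mem {m : ℕ} (k : Fin m) {w : Fin m → ℝ} (hw : w ∈ solidSimplex m) :
    reflect k w ∈ solidSimplex m := by
  refine ⟨fun i => ?_, by linarith [sum_reflect k w, hw.1 k]⟩
  unfold reflect
  by_cases h : i = k
  · subst h
    simpa using hw.2
  · rw [Function.update_of_ne h]
    exact hw.1 i

/-- On each slice in direction k the reflection is t ↦ (1 - ∑ w_i) - t, which reverses the interval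
and preserves the integral. -/
theorem integral_comp_reflect {m : ℕ} (k : Fin m) {g : (Fin m → ℝ) → ℂ}
    (hg : ContinuousOn g (solidSimplex m)) :
    ∫ w in solidSimplex m, g (reflect k w) = ∫ w in solidSimplex m, g w := by
  obtain ⟨m, rfl⟩ : ∃ m', m = m' + 1 := ⟨m - 1, by have := k.2; omega⟩
  rw [integral_solidSimplex_succ k hg, integral_solidSimplex_succ k
    (g := fun w => g (reflect k w))
    (hg.comp (continuous_reflect k).continuousOn fun w hw => reflect_mem k hw)]
  congr 1
  funext w
  have h1 : ∀ t, reflect k (k.insertNth t w) = k.insertNth ((1 - ∑ i, w i) - t) w := by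
    intro t
    unfold reflect
    rw [Fin.update_insertNth, Fin.sum_univ_succAbove _ k]
    simp only [Fin.insertNth_apply_same, Fin.insertNth_apply_succAbove]
    congr 1
    ring
  simp only [h1]
  rw [intervalIntegral.integral_comp_sub_left (fun t => g (k.insertNth t w))]
  simp

theorem insertNth_succ_eq {m : ℕ} (k : Fin m) (a : ℝ) (w : Fin m → ℝ) :
    (k.succ.insertNth a w : Fin (m + 1) → ℝ)
      = k.castSucc.insertNth (w k) (Function.update w k a) := by
  funext x
  rcases Fin.eq_self_or_eq_succAbove k.castSucc x with rfl | ⟨i, rfl⟩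
  · rw [Fin.insertNth_apply_same, ← Fin.succAbove_succ_self, Fin.insertNth_apply_succAbove]
  · rw [Fin.insertNth_apply_succAbove]
    by_cases h : i = k
    · subst h
      rw [Fin.succAbove_castSucc_self, Fin.insertNth_apply_same, Function.update_self]
    · rw [Function.update_of_ne h]
      have : k.castSucc.succAbove i = k.succ.succAbove i := by
        rcases lt_or_gt_of_ne h with h | h
        · rw [Fin.succAbove_castSucc_of_lt _ _ h, Fin.succAbove_succ_of_le _ _ h.le]
        · rw [Fin.succAbove_castSucc_of_le _ _ h.le, Fin.succAbove_succ_of_lt _ _ h]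
      rw [this, Fin.insertNth_apply_succAbove]

/-- Solving ∑ x_i = 1 for different coordinates gives different parametrizations of the slanted
face. Those for consecutive coordinates differ by a reflection (`insertNth_succ_eq`), so induction
on j reduces to j = 0, which is `chart`. -/
theorem integral_slanted_face {m : ℕ} {g : (Fin (m + 1) → ℝ) → ℂ}
    (hg : ContinuousOn g (solidSimplex (m + 1))) (j : Fin (m + 1)) :
    ∫ w in solidSimplex m, g (j.insertNth (1 - ∑ i, w i) w)
      = ∫ w in solidSimplex m, g (chart w) := by
  induction j using Fin.induction with
  | zero =>
    congr 1
    funext w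
    rw [Fin.insertNth_zero']
    rfl
  | succ k ih =>
    rw [← ih]
    have hc : ContinuousOn (fun w : Fin m → ℝ => g (k.castSucc.insertNth (1 - ∑ i, w i) w))
        (solidSimplex m) := by
      refine hg.comp ((continuous_insertNth _).comp
        (by fun_prop : Continuous fun w : Fin m → ℝ => (1 - ∑ i, w i, w))).continuousOn ?_
      intro w hw
      exact (insertNth_mem_solidSimplex _ _ _).2 ⟨hw, by linarith [hw.2], le_rfl⟩
    rw [← integral_comp_reflect k hc]
    congr 1
    funext w
    simp only [sum_reflect]
    rw [insertNth_succ_eq]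
    rfl

/-- The fundamental theorem of calculus on almost every slice in direction j: the upper endpoints
fill the slanted face, the lower ones the face x_j = 0. Continuity on the closed simplex and a
derivative in the interior suffice. -/
theorem integral_partial {m : ℕ} (j : Fin (m + 1)) {V V' : (Fin (m + 1) → ℝ) → ℂ}
    (hV : ContinuousOn V (solidSimplex (m + 1))) (hV' : ContinuousOn V' (solidSimplex (m + 1)))
    (hd : ∀ x ∈ openSimplex (m + 1),
      HasDerivAt (fun t => V (Function.update x j t)) (V' x) (x j)) :
    ∫ x in solidSimplex (m + 1), V' x = (∫ w in solidSimplex m, V (chart w))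
      - ∫ w in solidSimplex m, V (j.insertNth (0 : ℝ) w) := by
  rw [← integral_slanted_face hV j, integral_solidSimplex_succ j hV', ← integral_sub]
  · refine setIntegral_congr_ae (measurableSet_solidSimplex _) ?_
    filter_upwards [ae_mem_openSimplex m] with w hw hwS
    have hmaps : Set.MapsTo (fun t : ℝ => (j.insertNth t w : Fin (m + 1) → ℝ))
        (Set.Icc 0 (1 - ∑ i, w i)) (solidSimplex (m + 1)) := fun t ht =>
      (insertNth_mem_solidSimplex _ _ _).2 ⟨hwS, ht⟩
    have hcont : Continuous fun t : ℝ => (j.insertNth t w : Fin (m + 1) → ℝ) :=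
      (continuous_insertNth j).comp (by fun_prop : Continuous fun t : ℝ => (t, w))
    have hle : 0 ≤ 1 - ∑ i, w i := by linarith [hwS.2]
    refine intervalIntegral.integral_eq_sub_of_hasDerivAt_of_le hle
      (hV.comp hcont.continuousOn hmaps) (fun t ht => ?_) ?_
    · have := hd _ (insertNth_mem_openSimplex j t (hw hwS) ht)
      simp only [Fin.update_insertNth, Fin.insertNth_apply_same] at this
      exact this
    · refine ContinuousOn.intervalIntegrable ?_
      rw [Set.uIcc_of_le hle]
      exact hV'.comp hcont.continuousOn hmaps
  · refine integrableOn_solidSimplex (hV.comp ((continuous_insertNth _).comp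
      (by fun_prop : Continuous fun w : Fin m → ℝ => (1 - ∑ i, w i, w))).continuousOn ?_)
    intro w hw
    exact (insertNth_mem_solidSimplex _ _ _).2 ⟨hw, by linarith [hw.2], le_rfl⟩
  · refine integrableOn_solidSimplex (hV.comp ((continuous_insertNth _).comp
      (by fun_prop : Continuous fun w : Fin m → ℝ => ((0 : ℝ), w))).continuousOn ?_)
    intro w hw
    exact (insertNth_mem_solidSimplex _ _ _).2 ⟨hw, le_rfl, by linarith [hw.2]⟩

end stokes


/-! ## Alternating forms -/

section alternating

variable {R M N : Type*} [CommRing R] [AddCommGroup M] [Module R M] [AddCommGroup N] [Module R N]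

/-- Expanding multilinearly, each term other than the original one has a multiple of a in a later
slot, and a already stands in slot 0. -/
theorem alternating_cons_add_smul {m : ℕ} (f : M [⋀^Fin (m + 1)]→ₗ[R] N) (a : M) (w : Fin m → M)
    (c : Fin m → R) : f (Fin.cons a fun k => w k + c k • a) = f (Fin.cons a w) := by
  have h := (f.curryLeft a).map_add_univ w fun k => c k • a
  change f.curryLeft a (w + fun k => c k • a) = f.curryLeft a w
  rw [h, Finset.sum_eq_single Finset.univ]
  · simp
  · intro s _ hs
    obtain ⟨k, hk⟩ : ∃ k, k ∉ s := by
      by_contra hcon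
      push Not at hcon
      exact hs (Finset.eq_univ_iff_forall.2 hcon)
    set v := s.piecewise w fun k => c k • a
    have h0 : f.curryLeft a (Function.update v k a) = 0 :=
      f.map_eq_zero_of_eq (Matrix.vecCons a (Function.update v k a))
        (i := 0) (j := k.succ) (by simp) (Fin.succ_ne_zero k).symm
    have h1 : v = Function.update v k (c k • a) :=
      (Function.update_eq_self_iff.2 (Finset.piecewise_eq_of_notMem _ _ _ hk).symm).symm
    rw [h1, AlternatingMap.map_update_smul, h0, smul_zero]
  · simp

theorem alternating_cons_sub {m : ℕ} (f : M [⋀^Fin (m + 1)]→ₗ[R] N) (a : M) (w : Fin m → M) :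
    f (Fin.cons a fun k => w k - a) = f (Fin.cons a w) := by
  rw [← alternating_cons_add_smul f a w fun _ => -1]
  simp [sub_eq_add_neg]

/-- The left side is the (m+1)-form fst ∧ f on R × M at the vectors (1, v_j). Subtracting the zeroth
vector from the others kills their first components, and only one term of the wedge expansion
remains. Geometrically it combines the contributions of all coordinates on the slanted face. -/
theorem sum_removeNth_eq {m : ℕ} (f : M [⋀^Fin m]→ₗ[R] N) (v : Fin (m + 1) → M) :
    ∑ j : Fin (m + 1), (-1 : ℤ) ^ (j : ℕ) • f (j.removeNth v) = f fun k => v k.succ - v 0 := by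
  let L : (R × M) →ₗ[R] (R × M) [⋀^Fin m]→ₗ[R] N :=
    (LinearMap.fst R R M).smulRight (f.compLinearMap (LinearMap.snd R R M))
  let F := AlternatingMap.alternatizeUncurryFin L
  have h := alternating_cons_sub F (1, v 0) fun k => (1, v k.succ)
  rw [AlternatingMap.alternatizeUncurryFin_apply, AlternatingMap.alternatizeUncurryFin_apply] at h
  have h1 : (Fin.cons ((1 : R), v 0) fun k => (1, v k.succ) : Fin (m + 1) → R × M)
      = fun j => (1, v j) := by
    funext j
    refine Fin.cases ?_ (fun k => ?_) j <;> rfl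
  rw [h1] at h
  have h2 : ∀ j : Fin (m + 1), L (1, v j) (j.removeNth fun j => (1, v j)) = f (j.removeNth v) := by
    intro j
    simp only [L, LinearMap.smulRight_apply, LinearMap.fst_apply, one_smul]
    rfl
  rw [Fin.sum_univ_succ] at h
  simp only [Fin.cons_zero, Fin.cons_succ] at h
  have h3 : ∀ k : Fin m, ∀ w, L ((1, v k.succ) - (1, v 0)) w = 0 := by
    intro k w
    simp [L]
  have h4 : ∀ w : Fin m → R × M, L (1, v 0) w = f fun k => (w k).2 := by
    intro w
    simp only [L, LinearMap.smulRight_apply, LinearMap.fst_apply, one_smul]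
    rfl
  simp only [h3, smul_zero, Finset.sum_const_zero, add_zero, h4, Fin.val_zero, pow_zero,
    one_smul] at h
  have h5 : ∀ j : Fin (m + 1), f (fun k => ((j.removeNth fun j => ((1 : R), v j)) k).2)
    = f (j.removeNth v) := fun j => rfl
  simp only [h2] at h
  rw [← h]
  congr 1

/-- The sum is the (m+1)-form lam ∧ D, which vanishes because m+1 vectors in an m-dimensional space
are dependent. -/
theorem cramer_identity {m : ℕ} {K : Type*} [Field K] (D : (Fin m → K) [⋀^Fin m]→ₗ[K] K)
    (lam : (Fin m → K) →ₗ[K] K) (v : Fin (m + 1) → Fin m → K) :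
    ∑ j : Fin (m + 1), (-1 : ℤ) ^ (j : ℕ) • (lam (v j) * D (j.removeNth v)) = 0 := by
  have h := (AlternatingMap.alternatizeUncurryFin (lam.smulRight D)).map_linearDependent v (by
    intro hv
    have := hv.fintype_card_le_finrank
    simp at this)
  rw [AlternatingMap.alternatizeUncurryFin_apply] at h
  simpa [zsmul_eq_mul] using h

theorem cramer_identity_cons_cons {m : ℕ} {K : Type*} [Field K]
    (D : (Fin (m + 2) → K) [⋀^Fin (m + 2)]→ₗ[K] K) (lam : (Fin (m + 2) → K) →ₗ[K] K)
    (a b : Fin (m + 2) → K) (v : Fin (m + 1) → Fin (m + 2) → K) :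
    lam a * D (Fin.cons b v) - lam b * D (Fin.cons a v) + ∑ j : Fin (m + 1),
      (-1) ^ (j : ℕ) * (lam (v j) * D (Fin.cons a (Fin.cons b (j.removeNth v)))) = 0 := by
  let w : Fin (m + 3) → Fin (m + 2) → K := Fin.cons a (Fin.cons b v)
  have h := cramer_identity D lam w
  have e0 : (0 : Fin (m + 3)).removeNth w = Fin.cons b v := rfl
  have e1 : (Fin.succ 0 : Fin (m + 3)).removeNth w = Fin.cons a v := by
    funext k
    refine Fin.cases rfl (fun k => ?_) k
    simp [Fin.removeNth, w]
  have e2 : ∀ j : Fin (m + 1), (j.succ.succ : Fin (m + 3)).removeNth w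
      = Fin.cons a (Fin.cons b (j.removeNth v)) := by
    intro j
    funext k
    refine Fin.cases rfl (fun k => ?_) k
    refine Fin.cases rfl (fun k => ?_) k
    simp [Fin.removeNth, w]
  rw [Fin.sum_univ_succ, Fin.sum_univ_succ] at h
  simp only [e0, e1, e2] at h
  simp only [w, Fin.cons_zero, Fin.cons_succ, zsmul_eq_mul, Fin.val_zero, pow_zero, Fin.val_succ,
    zero_add, pow_succ] at h
  push_cast at h
  rw [← h, ← add_assoc]
  congr 1
  · ring
  · refine Finset.sum_congr rfl fun j _ => ?_
    ring

/-- The determinant of the matrix with the given rows, as a continuous alternating map. -/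
def detForm (m : ℕ) : (Fin m → ℂ) [⋀^Fin m]→L[ℂ] ℂ :=
  { (Matrix.detRowAlternating : (Fin m → ℂ) [⋀^Fin m]→ₗ[ℂ] ℂ) with
    cont := by
      change Continuous fun v : Fin m → Fin m → ℂ => Matrix.det (Matrix.of v)
      exact Continuous.matrix_det (by fun_prop) }

theorem detForm_apply {m : ℕ} (v : Fin m → Fin m → ℂ) :
    detForm m v = Matrix.det (Matrix.of v) := rfl

end alternating

/-! ## Stokes' theorem for multiples of pulled back forms -/

section pullback

open MeasureTheory

variable {m : ℕ} {E : Type*} [NormedAddCommGroup E] [NormedSpace ℝ E]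

/-- The vectors `∂τ/∂x_k`. -/
def partials (τ : (Fin m → ℝ) → E) (x : Fin m → ℝ) (k : Fin m) : E :=
  fderiv ℝ τ x (Pi.single k 1)

theorem contDiff_partials {τ : (Fin m → ℝ) → E} (hτ : ContDiff ℝ ∞ τ) (k : Fin m) :
    ContDiff ℝ ∞ fun x => partials τ x k :=
  (hτ.fderiv_right (m := ∞) (by simp)).clm_apply contDiff_const

theorem contDiff_form {D : E [⋀^Fin (m + 2)]→L[ℝ] ℂ} {τ : (Fin (m + 1) → ℝ) → E}
    (hτ : ContDiff ℝ ∞ τ) (e : E) (j : Fin (m + 1)) :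
    ContDiff ℝ ∞ fun x => D (Fin.cons e (Fin.cons (τ x) (j.removeNth (partials τ x)))) := by
  refine D.toContinuousMultilinearMap.contDiff.comp (contDiff_pi.2 fun k => ?_)
  refine Fin.cases contDiff_const (fun k => ?_) k
  simp only [Fin.cons_succ]
  refine Fin.cases ?_ (fun k => ?_) k
  · simpa using hτ
  · exact contDiff_partials hτ _

/-- The exterior derivative of the pull-back along `τ` of the form `t ↦ D(e, t, …)`. -/
theorem sum_fderiv_form (D : E [⋀^Fin (m + 2)]→L[ℝ] ℂ) {τ : (Fin (m + 1) → ℝ) → E}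
    (hτ : ContDiff ℝ ∞ τ) (e : E) (x : Fin (m + 1) → ℝ) :
    ∑ j : Fin (m + 1), (-1 : ℤ) ^ (j : ℕ) • fderiv ℝ
        (fun x => D (Fin.cons e (Fin.cons (τ x) (j.removeNth (partials τ x))))) x (Pi.single j 1)
      = (m + 1) * D (Fin.cons e (partials τ x)) := by
  let L : E →L[ℝ] E [⋀^Fin m]→L[ℝ] ℂ := (D.curryLeft e).curryLeft
  have hd : DifferentiableAt ℝ (fun x => (L (τ x)).compContinuousLinearMap (fderiv ℝ τ x)) x := by
    have h1 : DifferentiableAt ℝ (fun x => L (τ x)) x :=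
      L.differentiableAt.comp x (hτ.differentiable (by simp) x)
    have h2 : DifferentiableAt ℝ (fderiv ℝ τ) x :=
      (hτ.fderiv_right (m := ∞) (by simp)).differentiable (by simp) x
    exact (h1.hasFDerivAt.continuousAlternatingMapCompContinuousLinearMap
      h2.hasFDerivAt).differentiableAt
  have h := extDeriv_pullback (f := τ) (x := x) (r := ∞) (𝕜 := ℝ)
    (L.differentiableAt : DifferentiableAt ℝ (fun t => L t) (τ x)) hτ.contDiffAt (by
      rw [minSmoothness_of_isRCLikeNormedField]
      exact WithTop.coe_le_coe.2 (le_top : (2 : ℕ∞) ≤ ⊤))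
  have h' := congrArg (fun F => F fun k => Pi.single k (1 : ℝ)) h
  rw [extDeriv_apply hd] at h'
  -- L is linear in t, so its derivative is L itself. This is already alternating in all m+1
  -- arguments, and antisymmetrizing it counts it m+1 times.
  have h3 : extDeriv (fun t => L t) (τ x) = (m + 1) • D.curryLeft e := by
    rw [extDeriv]
    have : fderiv ℝ (fun t => L t) (τ x) = L := L.fderiv
    rw [this, ContinuousAlternatingMap.alternatizeUncurryFin_curryLeft]
  rw [h3] at h'
  refine Eq.trans ?_ (h'.trans ?_)
  · rfl
  · simp only [ContinuousAlternatingMap.compContinuousLinearMap_apply,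
      ContinuousAlternatingMap.smul_apply, nsmul_eq_mul]
    push_cast
    rfl

/-- The `i`-th face of the solid simplex, parametrized by the solid simplex. -/
def faceMap (i : Fin (m + 2)) (w : Fin m → ℝ) : Fin (m + 1) → ℝ := Fin.tail (face i (chart w))

theorem faceMap_zero (w : Fin m → ℝ) : faceMap 0 w = chart w := by
  unfold faceMap face
  rw [Fin.insertNth_zero']
  rfl

theorem faceMap_succ (j : Fin (m + 1)) (w : Fin m → ℝ) :
    faceMap j.succ w = j.insertNth (0 : ℝ) w := by
  unfold faceMap face chart
  funext k
  change (j.succ.insertNth (0 : ℝ) (Fin.cons (1 - ∑ i, w i) w) : Fin (m + 2) → ℝ) k.succ = _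
  rcases Fin.eq_self_or_eq_succAbove j k with rfl | ⟨i, rfl⟩
  · rw [Fin.insertNth_apply_same, Fin.insertNth_apply_same]
  · rw [← Fin.succ_succAbove_succ, Fin.insertNth_apply_succAbove, Fin.insertNth_apply_succAbove]
    rfl

theorem hasFDerivAt_chart (w : Fin m → ℝ) : ∃ C : (Fin m → ℝ) →L[ℝ] Fin (m + 1) → ℝ,
    HasFDerivAt chart C w ∧ ∀ k, C (Pi.single k 1) = Pi.single k.succ 1 - Pi.single 0 1 := by
  refine ⟨ContinuousLinearMap.pi (Fin.cons (-∑ i, ContinuousLinearMap.proj i)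
    fun i => ContinuousLinearMap.proj i), ?_, fun k => ?_⟩
  · rw [hasFDerivAt_pi]
    intro i
    refine Fin.cases ?_ (fun i => ?_) i
    · simp only [chart, Fin.cons_zero]
      have h : HasFDerivAt (fun w : Fin m → ℝ => ∑ i, w i)
          (∑ i, ContinuousLinearMap.proj (R := ℝ) (φ := fun _ : Fin m => ℝ) i) w :=
        HasFDerivAt.fun_sum fun i _ => hasFDerivAt_apply i w
      exact h.const_sub 1
    · simp only [chart, Fin.cons_succ]
      exact hasFDerivAt_apply i w
  · funext i
    refine Fin.cases ?_ (fun i => ?_) i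
    · simp [Pi.single_apply, Fin.succ_ne_zero]
    · simp [Pi.single_apply, Fin.succ_ne_zero]

theorem hasFDerivAt_insertNth_zero (j : Fin (m + 1)) (w : Fin m → ℝ) :
    ∃ C : (Fin m → ℝ) →L[ℝ] Fin (m + 1) → ℝ,
      HasFDerivAt (fun w => (j.insertNth (0 : ℝ) w : Fin (m + 1) → ℝ)) C w ∧
        ∀ k, C (Pi.single k 1) = Pi.single (j.succAbove k) 1 := by
  let C : (Fin m → ℝ) →L[ℝ] Fin (m + 1) → ℝ := ContinuousLinearMap.pi
    (j.insertNth (α := fun _ => (Fin m → ℝ) →L[ℝ] ℝ) 0 fun i => ContinuousLinearMap.proj i)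
  have hC : (fun w => (j.insertNth (0 : ℝ) w : Fin (m + 1) → ℝ)) = C := by
    funext w i
    rcases Fin.eq_self_or_eq_succAbove j i with rfl | ⟨i, rfl⟩
    · simp [C]
    · simp [C]
  refine ⟨C, hC ▸ C.hasFDerivAt, fun k => ?_⟩
  rw [← hC]
  funext i
  rcases Fin.eq_self_or_eq_succAbove j i with rfl | ⟨i, rfl⟩
  · simp only []
    rw [Fin.insertNth_apply_same, Pi.single_eq_of_ne (Fin.succAbove_ne _ _).symm]
  · simp [Pi.single_apply]

theorem partials_comp_chart {τ : (Fin (m + 1) → ℝ) → E} (hτ : ContDiff ℝ ∞ τ) (w : Fin m → ℝ)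
    (k : Fin m) : partials (fun w => τ (chart w)) w k
      = partials τ (chart w) k.succ - partials τ (chart w) 0 := by
  obtain ⟨C, hC, hk⟩ := hasFDerivAt_chart w
  have h := ((hτ.differentiable (by simp) (chart w)).hasFDerivAt.comp w hC).fderiv
  unfold partials
  change fderiv ℝ (τ ∘ chart) w _ = _
  rw [h, ContinuousLinearMap.comp_apply, hk, map_sub]

theorem partials_comp_insertNth {τ : (Fin (m + 1) → ℝ) → E} (hτ : ContDiff ℝ ∞ τ)
    (j : Fin (m + 1)) (w : Fin m → ℝ) : partials (fun w => τ (j.insertNth (0 : ℝ) w)) w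
      = j.removeNth (partials τ (j.insertNth (0 : ℝ) w)) := by
  obtain ⟨C, hC, hk⟩ := hasFDerivAt_insertNth_zero j w
  have h := ((hτ.differentiable (by simp) (j.insertNth (0 : ℝ) w)).hasFDerivAt.comp w hC).fderiv
  funext k
  unfold partials
  change fderiv ℝ (τ ∘ fun w => (j.insertNth (0 : ℝ) w : Fin (m + 1) → ℝ)) w _ = _
  rw [h, ContinuousLinearMap.comp_apply, hk]
  rfl

theorem continuous_chart : Continuous (chart : (Fin m → ℝ) → Fin (m + 1) → ℝ) := by
  refine continuous_pi fun i => ?_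
  refine Fin.cases ?_ (fun i => ?_) i
  · simp only [chart, Fin.cons_zero]; fun_prop
  · simp only [chart, Fin.cons_succ]; fun_prop

theorem chart_mem {w : Fin m → ℝ} (hw : w ∈ solidSimplex m) :
    chart w ∈ solidSimplex (m + 1) := by
  have := (insertNth_mem_solidSimplex 0 (1 - ∑ i, w i) w).2 ⟨hw, by linarith [hw.2], le_rfl⟩
  rwa [Fin.insertNth_zero'] at this

/-- Stokes' theorem: if `dG = ∑ c_a dτ_a` and `∑ c_a τ_a = -(m + 1) G`, then the pull-back along `τ`
of the form `c(e) D(t, …)` is, up to the sign, the exterior derivative of `G D(e, t, …)`. -/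
theorem stokes_form {τ : (Fin (m + 1) → ℝ) → Fin (m + 2) → ℂ} (hτ : ContDiff ℝ ∞ τ)
    (e : Fin (m + 2) → ℂ) {G : (Fin (m + 1) → ℝ) → ℂ} {c : Fin (m + 2) → (Fin (m + 1) → ℝ) → ℂ}
    (hG : ContinuousOn G (solidSimplex (m + 1)))
    (hc : ∀ a, ContinuousOn (c a) (solidSimplex (m + 1)))
    (hd : ∀ x ∈ openSimplex (m + 1), ∀ j,
      HasDerivAt (fun t => G (Function.update x j t)) (∑ a, c a x * partials τ x j a) (x j))
    (hE : ∀ x ∈ solidSimplex (m + 1), ∑ a, c a x * τ x a = -((m + 1) * G x)) :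
    ∫ x in solidSimplex (m + 1),
        (∑ a, c a x * e a) * detForm (m + 2) (Fin.cons (τ x) (partials τ x))
      = -∑ i : Fin (m + 2), (-1) ^ (i : ℕ) * ∫ w in solidSimplex m, G (faceMap i w) *
          detForm (m + 2) (Fin.cons e (Fin.cons (τ (faceMap i w))
            (partials (fun w => τ (faceMap i w)) w))) := by
  -- P j is the coefficient of the pulled back form D(e, t, …) with dx_j omitted. The proof
  -- integrates the divergence of the functions (-1)^j G P_j.
  set P : Fin (m + 1) → (Fin (m + 1) → ℝ) → ℂ := fun j x =>
    detForm (m + 2) (Fin.cons e (Fin.cons (τ x) (j.removeNth (partials τ x)))) with hPdef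
  have hP : ∀ j, ContDiff ℝ ∞ (P j) := fun j =>
    contDiff_form (D := (detForm (m + 2)).restrictScalars ℝ) hτ e j
  set P' : Fin (m + 1) → (Fin (m + 1) → ℝ) → ℂ := fun j x =>
    fderiv ℝ (P j) x (Pi.single j 1) with hP'def
  have hP' : ∀ j, Continuous (P' j) := fun j =>
    (((hP j).fderiv_right (m := ∞) (by simp)).clm_apply contDiff_const).continuous
  set lam : (Fin (m + 1) → ℝ) → (Fin (m + 2) → ℂ) →ₗ[ℂ] ℂ := fun x =>
    ∑ a, c a x • LinearMap.proj a with hlam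
  have hlam_apply : ∀ x v, lam x v = ∑ a, c a x * v a := fun x v => by simp [hlam]
  have hsum : ∀ x, ∑ j : Fin (m + 1), (-1 : ℤ) ^ (j : ℕ) • P' j x
      = (m + 1) * detForm (m + 2) (Fin.cons e (partials τ x)) := fun x =>
    sum_fderiv_form ((detForm (m + 2)).restrictScalars ℝ) hτ e x
  have hparts : ∀ j : Fin (m + 1), ∫ x in solidSimplex (m + 1),
      ((∑ a, c a x * partials τ x j a) * P j x + G x * P' j x)
      = (∫ w in solidSimplex m, G (chart w) * P j (chart w))
        - ∫ w in solidSimplex m, G (j.insertNth (0 : ℝ) w) * P j (j.insertNth (0 : ℝ) w) := by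
    intro j
    refine integral_partial j (V := fun x => G x * P j x) (hG.mul (hP j).continuous.continuousOn)
      (((continuousOn_finsetSum _ fun a _ => (hc a).mul ?_).mul
        (hP j).continuous.continuousOn).add (hG.mul (hP' j).continuousOn)) fun x hx => ?_
    · exact ((continuous_apply a).comp (contDiff_partials hτ j).continuous).continuousOn
    · have h1 : HasDerivAt (fun t => P j (Function.update x j t)) (P' j x) (x j) := by
        have h2 := ((hP j).differentiable (by simp) x).hasFDerivAt
        have h3 : HasDerivAt (fun t => Function.update x j t) (Pi.single j (1 : ℝ)) (x j) :=
          hasDerivAt_update x j (x j)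
        rw [← Function.update_eq_self j x] at h2
        have h4 := h2.comp_hasDerivAt (x j) h3
        rw [Function.update_eq_self] at h4
        exact h4
      have := (hd x hx j).mul h1
      simp only [Function.update_eq_self] at this
      exact this
  have hint : ∀ j : Fin (m + 1), IntegrableOn (fun x => (-1 : ℂ) ^ (j : ℕ) *
      ((∑ a, c a x * partials τ x j a) * P j x + G x * P' j x)) (solidSimplex (m + 1)) := by
    intro j
    refine integrableOn_solidSimplex (continuousOn_const.mul
      (((continuousOn_finsetSum _ fun a _ => (hc a).mul ?_).mul
        (hP j).continuous.continuousOn).add (hG.mul (hP' j).continuousOn)))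
    exact ((continuous_apply a).comp (contDiff_partials hτ j).continuous).continuousOn
  -- In the Cramer identity for e, τ and the partials of τ, the term with lam(τ) = -(m+1) G is
  -- exactly what the derivatives of the P_j contribute, so the integrand is minus the divergence.
  have hdiv : ∀ x ∈ solidSimplex (m + 1),
      (∑ a, c a x * e a) * detForm (m + 2) (Fin.cons (τ x) (partials τ x))
      = -∑ j : Fin (m + 1), (-1 : ℂ) ^ (j : ℕ) *
        ((∑ a, c a x * partials τ x j a) * P j x + G x * P' j x) := by
    intro x hx
    have h1 := cramer_identity_cons_cons (detForm (m + 2)).toAlternatingMap (lam x) e (τ x)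
      (partials τ x)
    have h2 := hsum x
    simp only [hlam_apply, hE x hx] at h1
    simp only [mul_add, Finset.sum_add_distrib]
    have h3 : ∑ j : Fin (m + 1), (-1 : ℂ) ^ (j : ℕ) * (G x * P' j x)
        = G x * ((m + 1) * detForm (m + 2) (Fin.cons e (partials τ x))) := by
      rw [← h2, Finset.mul_sum]
      refine Finset.sum_congr rfl fun j _ => ?_
      rw [zsmul_eq_mul]
      push_cast
      ring
    rw [h3]
    change _ * detForm (m + 2) _ - _ * detForm (m + 2) _ + ∑ j : Fin (m + 1), _ * (_ * P j x) = 0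
      at h1
    linear_combination h1
  rw [setIntegral_congr_fun (measurableSet_solidSimplex _) hdiv, integral_neg,
    integral_finsetSum _ fun j _ => hint j]
  simp only [integral_const_mul, hparts]
  congr 1
  -- All coordinate directions contribute to the slanted face. Along `chart` the partials are the
  -- differences of those of τ with index k+1 and 0, so `sum_removeNth_eq` assembles the
  -- contributions into one pulled back form.
  have hslant : ∫ w in solidSimplex m, G (faceMap 0 w) * detForm (m + 2)
      (Fin.cons e (Fin.cons (τ (faceMap 0 w)) (partials (fun w => τ (faceMap 0 w)) w)))
      = ∑ j : Fin (m + 1), (-1) ^ (j : ℕ) *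
        ∫ w in solidSimplex m, G (chart w) * P j (chart w) := by
    have hI : ∀ j : Fin (m + 1), IntegrableOn
        (fun w => (-1 : ℂ) ^ (j : ℕ) * (G (chart w) * P j (chart w))) (solidSimplex m) := fun j =>
      integrableOn_solidSimplex (continuousOn_const.mul
        ((hG.mul (hP j).continuous.continuousOn).comp continuous_chart.continuousOn
          fun w hw => chart_mem hw))
    simp only [← integral_const_mul]
    rw [← integral_finsetSum _ fun j _ => hI j]
    refine integral_congr_ae (Filter.Eventually.of_forall fun w => ?_)
    have h1 := sum_removeNth_eq (((detForm (m + 2)).toAlternatingMap.curryLeft e).curryLeft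
      (τ (chart w))) (partials τ (chart w))
    simp only [faceMap_zero]
    rw [show partials (fun w => τ (chart w)) w = fun k => partials τ (chart w) k.succ -
      partials τ (chart w) 0 from funext fun k => partials_comp_chart hτ w k]
    change ∑ j : Fin (m + 1), _ • P j (chart w) = detForm (m + 2) (Fin.cons e (Fin.cons
      (τ (chart w)) _)) at h1
    rw [← h1, Finset.mul_sum]
    refine Finset.sum_congr rfl fun j _ => ?_
    rw [zsmul_eq_mul]
    push_cast
    ring
  have hflat : ∀ j : Fin (m + 1), ∫ w in solidSimplex m, G (faceMap j.succ w) * detForm (m + 2)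
      (Fin.cons e (Fin.cons (τ (faceMap j.succ w)) (partials (fun w => τ (faceMap j.succ w)) w)))
      = ∫ w in solidSimplex m, G (j.insertNth (0 : ℝ) w) * P j (j.insertNth (0 : ℝ) w) := by
    intro j
    simp only [faceMap_succ, partials_comp_insertNth hτ, hPdef]
  refine Eq.trans ?_ (Fin.sum_univ_succ _).symm
  rw [hslant]
  simp only [hflat, Fin.val_zero, pow_zero, one_mul, Fin.val_succ]
  rw [← Finset.sum_add_distrib]
  refine Finset.sum_congr rfl fun j _ => ?_
  ring

end pullback


/-! ## Integrals depending holomorphically on parameters -/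

section parametric

open MeasureTheory Topology

variable {k N : ℕ}

/-- The continuous linear form with coefficients `a`. -/
def linForm (a : Fin N → ℂ) : (Fin N → ℂ) →L[ℂ] ℂ := ∑ j, a j • ContinuousLinearMap.proj j

theorem linForm_single (a : Fin N → ℂ) (j : Fin N) : linForm a (Pi.single j 1) = a j := by
  simp [linForm, Pi.single_apply]

/-- Dominated differentiation: on K times a small closed ball the derivative is continuous on a
compact set, so a constant dominates it, and K has finite measure. -/
theorem hasFDerivAt_integral_of_continuousOn {K : Set (Fin k → ℝ)} (hK : IsCompact K)
    {W : Set (Fin N → ℂ)} (hW : IsOpen W) {F : (Fin k → ℝ) → (Fin N → ℂ) → ℂ}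
    {F' : Fin N → (Fin k → ℝ) → (Fin N → ℂ) → ℂ}
    (hF : ContinuousOn (fun q : (Fin k → ℝ) × (Fin N → ℂ) => F q.1 q.2) (K ×ˢ W))
    (hF' : ∀ j, ContinuousOn (fun q : (Fin k → ℝ) × (Fin N → ℂ) => F' j q.1 q.2) (K ×ˢ W))
    (hd : ∀ x ∈ K, ∀ z ∈ W, HasFDerivAt (F x) (linForm fun j => F' j x z) z)
    {z : Fin N → ℂ} (hz : z ∈ W) :
    HasFDerivAt (fun z => ∫ x in K, F x z) (linForm fun j => ∫ x in K, F' j x z) z := by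
  obtain ⟨r, hr, hrW⟩ := Metric.nhds_basis_closedBall.mem_iff.1 (hW.mem_nhds hz)
  have hslice : ∀ {G : (Fin k → ℝ) → (Fin N → ℂ) → ℂ},
      ContinuousOn (fun q : (Fin k → ℝ) × (Fin N → ℂ) => G q.1 q.2) (K ×ˢ W) → ∀ y ∈ W,
      ContinuousOn (fun x => G x y) K := by
    intro G hG y hy
    exact hG.comp (by fun_prop : Continuous fun x : Fin k → ℝ => (x, y)).continuousOn
      fun x hx => ⟨hx, hy⟩
  have hL : Continuous (linForm : (Fin N → ℂ) → _) := by
    unfold linForm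
    fun_prop
  have hlin : ContinuousOn (fun q : (Fin k → ℝ) × (Fin N → ℂ) =>
      linForm fun j => F' j q.1 q.2) (K ×ˢ W) :=
    hL.comp_continuousOn (continuousOn_pi.2 hF')
  obtain ⟨C, hC⟩ := (hK.prod (isCompact_closedBall z r)).exists_bound_of_continuousOn
    (hlin.mono (Set.prod_mono_right hrW))
  have hlin' : ContinuousOn (fun x => linForm fun j => F' j x z) K :=
    hL.comp_continuousOn (continuousOn_pi.2 fun j => hslice (hF' j) z hz)
  have hfin : volume K < ⊤ := hK.measure_lt_top
  have key := hasFDerivAt_integral_of_dominated_of_fderiv_le (μ := volume.restrict K) (𝕜 := ℂ)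
    (F := fun z x => F x z) (F' := fun z x => linForm fun j => F' j x z) (x₀ := z)
    (bound := fun _ => C) (s := Metric.closedBall z r) (Metric.closedBall_mem_nhds z hr)
    (Filter.eventually_of_mem (Metric.closedBall_mem_nhds z hr) fun y hy =>
      (hslice hF y (hrW hy)).aestronglyMeasurable hK.measurableSet)
    ((hslice hF z hz).integrableOn_compact hK)
    (hlin'.aestronglyMeasurable hK.measurableSet)
    ((ae_restrict_iff' hK.measurableSet).2 (Filter.Eventually.of_forall fun x hx y hy =>
      hC (x, y) ⟨hx, hy⟩))
    (by
      have : IsFiniteMeasure (volume.restrict K) := ⟨by simpa using hfin⟩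
      exact integrable_const C)
    ((ae_restrict_iff' hK.measurableSet).2 (Filter.Eventually.of_forall fun x hx y hy =>
      hd x hx y (hrW hy)))
  have heq : ∫ x in K, linForm (fun j => F' j x z) = linForm fun j => ∫ x in K, F' j x z := by
    unfold linForm
    rw [integral_finsetSum]
    · refine Finset.sum_congr rfl fun j _ => ?_
      rw [integral_smul_const]
    · intro j _
      exact ((hslice (hF' j) z hz).integrableOn_compact hK).smul_const _
  rw [heq] at key
  exact key

/-- A family of functions that is stable under partial derivatives consists of smooth functions. -/
theorem contDiffOn_of_family {W : Set (Fin N → ℂ)} (hW : IsOpen W) (S : Set ((Fin N → ℂ) → ℂ))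
    (hS : ∀ g ∈ S, ∃ g' : Fin N → (Fin N → ℂ) → ℂ, (∀ j, g' j ∈ S) ∧
      ∀ z ∈ W, HasFDerivAt g (linForm fun j => g' j z) z)
    {g : (Fin N → ℂ) → ℂ} (hg : g ∈ S) : ContDiffOn ℂ ∞ g W := by
  rw [contDiffOn_infty]
  intro r
  induction r generalizing g with
  | zero =>
    obtain ⟨g', _, hd⟩ := hS g hg
    exact contDiffOn_zero.2 fun z hz => (hd z hz).continuousAt.continuousWithinAt
  | succ r ih =>
    obtain ⟨g', hg', hd⟩ := hS g hg
    push_cast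
    rw [contDiffOn_succ_iff_fderiv_of_isOpen hW]
    refine ⟨fun z hz => (hd z hz).differentiableAt.differentiableWithinAt, by simp, ?_⟩
    have h1 : ContDiffOn ℂ r (fun z => linForm fun j => g' j z) W := by
      unfold linForm
      exact ContDiffOn.sum fun j _ => (ih (hg' j)).smul contDiffOn_const
    exact h1.congr fun z hz => (hd z hz).fderiv

end parametric

/-! ## The integrals `∫ φ f ^ m p(1/ℓ) Ω` over a twisted simplex -/

section simplex

open MeasureTheory

variable {d n : ℕ} {A : Matrix (Fin (d + 1)) (Fin (n + 1)) ℂ} {u : Fin (n + 1) → ℂ}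
  {z₀ : Fin (n + 1) → ℂ}

theorem chart_mem_stdSimplex {m : ℕ} {x : Fin m → ℝ} (hx : x ∈ solidSimplex m) :
    chart x ∈ stdSimplex ℝ (Fin (m + 1)) := by
  refine ⟨fun i => ?_, ?_⟩
  · refine Fin.cases ?_ (fun i => ?_) i
    · simpa [chart] using hx.2
    · simpa [chart] using hx.1 i
  · simp [chart, Fin.sum_univ_succ]

theorem continuous_ellVal (j : Fin (n + 1)) : Continuous (ellVal A j) := by
  unfold ellVal
  fun_prop

namespace TwistedSimplex

variable (T : TwistedSimplex A u z₀)

/-- The simplex, parametrized by the solid simplex. -/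
def param (x : Fin d → ℝ) : Fin (d + 1) → ℂ := T.map (chart x)

theorem contDiff_param : ContDiff ℝ ∞ T.param := by
  refine T.smooth.comp (contDiff_pi.2 fun i => ?_)
  refine Fin.cases ?_ (fun i => ?_) i
  · simp only [chart, Fin.cons_zero]
    fun_prop
  · simp only [chart, Fin.cons_succ]
    fun_prop

theorem ell_param_ne_zero {x : Fin d → ℝ} (hx : x ∈ solidSimplex d) (j : Fin (n + 1)) :
    ellVal A j (T.param x) ≠ 0 := T.ell_ne_zero _ (chart_mem_stdSimplex hx) j

theorem f_param_ne_zero {x : Fin d → ℝ} (hx : x ∈ solidSimplex d) :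
    fVal A (T.param x) z₀ ≠ 0 := T.f_ne_zero _ (chart_mem_stdSimplex hx)

/-- The parameters `z` for which the branch can be continued from `z₀` to `z` by the principal
power. -/
def domain : Set (Fin (n + 1) → ℂ) :=
  {z | ∀ x ∈ solidSimplex d, fVal A (T.param x) z / fVal A (T.param x) z₀ ∈ Complex.slitPlane}

theorem f_ne_zero_of_mem_domain {z : Fin (n + 1) → ℂ} (hz : z ∈ T.domain) {x : Fin d → ℝ}
    (hx : x ∈ solidSimplex d) : fVal A (T.param x) z ≠ 0 := by
  intro h
  have := hz x hx
  rw [h, zero_div] at this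
  exact Complex.zero_notMem_slitPlane this

theorem continuousOn_ell_inv (j : Fin (n + 1)) :
    ContinuousOn (fun x => (ellVal A j (T.param x))⁻¹) (solidSimplex d) :=
  ((continuous_ellVal j).comp T.contDiff_param.continuous).continuousOn.inv₀
    fun _ hx => T.ell_param_ne_zero hx j

theorem continuousOn_f (s : Set (Fin (n + 1) → ℂ)) :
    ContinuousOn (fun q : (Fin d → ℝ) × (Fin (n + 1) → ℂ) => fVal A (T.param q.1) q.2)
      (solidSimplex d ×ˢ s) := by
  unfold fVal
  refine continuousOn_finsetSum _ fun j _ => ?_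
  simp only [div_eq_mul_inv]
  refine ContinuousOn.mul (by fun_prop) ?_
  exact (T.continuousOn_ell_inv j).comp continuous_fst.continuousOn fun q hq => hq.1

theorem continuousOn_f_right (z : Fin (n + 1) → ℂ) :
    ContinuousOn (fun x => fVal A (T.param x) z) (solidSimplex d) :=
  (T.continuousOn_f Set.univ).comp (f := fun x => (x, z)) (by fun_prop) fun _ hx => ⟨hx, trivial⟩

/-- The quotient f(t, z)/f(t, z₀) is 1 plus a linear form in z - z₀ whose coefficients are bounded
on the compact simplex. Near z₀ it stays in the unit disc about 1, inside the slit plane, uniformly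
along the simplex. -/
theorem exists_open_subset_domain :
    ∃ W : Set (Fin (n + 1) → ℂ), IsOpen W ∧ z₀ ∈ W ∧ W ⊆ T.domain := by
  have hc : ∀ j, ContinuousOn
      (fun x => (ellVal A j (T.param x))⁻¹ / fVal A (T.param x) z₀) (solidSimplex d) := fun j =>
    (T.continuousOn_ell_inv j).div (T.continuousOn_f_right z₀) fun _ hx => T.f_param_ne_zero hx
  obtain ⟨C, hC⟩ := (isCompact_solidSimplex d).exists_bound_of_continuousOn
    (continuousOn_finsetSum Finset.univ fun j _ => (hc j).norm)
  refine ⟨Metric.ball z₀ (|C| + 1)⁻¹, Metric.isOpen_ball, Metric.mem_ball_self (by positivity),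
    fun z hz x hx => ?_⟩
  have h1 : fVal A (T.param x) z / fVal A (T.param x) z₀
      = 1 + ∑ j, (z j - z₀ j) * ((ellVal A j (T.param x))⁻¹ / fVal A (T.param x) z₀) := by
    have h2 := T.f_param_ne_zero hx
    have h3 : fVal A (T.param x) z = fVal A (T.param x) z₀
        + ∑ j, (z j - z₀ j) * (ellVal A j (T.param x))⁻¹ := by
      unfold fVal
      rw [← Finset.sum_add_distrib]
      refine Finset.sum_congr rfl fun j _ => ?_
      ring
    rw [h3, add_div, div_self h2, Finset.sum_div]
    simp only [mul_div_assoc]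
  rw [h1]
  refine Complex.mem_slitPlane_of_norm_lt_one ?_
  have hz' : ‖z - z₀‖ < (|C| + 1)⁻¹ := by rwa [← dist_eq_norm]
  have hsum := hC x hx
  rw [Real.norm_of_nonneg (Finset.sum_nonneg fun j _ => norm_nonneg _)] at hsum
  calc ‖∑ j, (z j - z₀ j) * ((ellVal A j (T.param x))⁻¹ / fVal A (T.param x) z₀)‖
      ≤ ∑ j, ‖z - z₀‖ * ‖(ellVal A j (T.param x))⁻¹ / fVal A (T.param x) z₀‖ := by
        refine norm_sum_le_of_le _ fun j _ => ?_
        rw [norm_mul]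
        exact mul_le_mul_of_nonneg_right (norm_le_pi_norm (z - z₀) j) (norm_nonneg _)
    _ = ‖z - z₀‖ * ∑ j, ‖(ellVal A j (T.param x))⁻¹ / fVal A (T.param x) z₀‖ := by
        rw [Finset.mul_sum]
    _ ≤ ‖z - z₀‖ * (|C| + 1) := by
        gcongr
        linarith [le_abs_self C]
    _ < 1 := by
        rwa [← lt_div_iff₀ (by positivity), one_div]

/-- The branch of `φ(·, z)` along the simplex. -/
def phi (x : Fin d → ℝ) (z : Fin (n + 1) → ℂ) : ℂ :=
  T.branch (chart x)
    * (fVal A (T.param x) z / fVal A (T.param x) z₀) ^ (-(sParam d u + d + 1))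

/-- The coefficient of the pull-back of the form `φ f ^ m p(1/ℓ) Ω`. -/
def integrand (m : ℤ) (p : MvPolynomial (Fin (n + 1)) ℂ) (x : Fin d → ℝ)
    (z : Fin (n + 1) → ℂ) : ℂ :=
  T.phi x z * fVal A (T.param x) z ^ m
    * MvPolynomial.eval (fun j => (ellVal A j (T.param x))⁻¹) p * pullbackOmega T.map x

theorem pullbackOmega_eq (x : Fin d → ℝ) : pullbackOmega T.map x
    = detForm (d + 1) (Fin.cons (T.param x) (partials T.param x)) := by
  rw [detForm_apply, ← Matrix.det_transpose]
  rfl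

theorem continuous_pullbackOmega : Continuous (pullbackOmega T.map) := by
  rw [show pullbackOmega T.map = _ from funext T.pullbackOmega_eq]
  refine (detForm (d + 1)).cont.comp (continuous_pi fun k => ?_)
  refine Fin.cases ?_ (fun k => ?_) k
  · exact T.contDiff_param.continuous
  · exact (contDiff_partials T.contDiff_param k).continuous

theorem continuousOn_branch : ContinuousOn (fun x => T.branch (chart x)) (solidSimplex d) := by
  obtain ⟨c, lE, lF, hE, hF, h⟩ := T.isBranch
  have : ContinuousOn (fun x => c * Complex.exp (-(sParam d u + d + 1) * lF (chart x)
      + ∑ j, u j * lE j (chart x))) (solidSimplex d) := by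
    have hch : Set.MapsTo chart (solidSimplex d) (stdSimplex ℝ (Fin (d + 1))) :=
      fun _ hx => chart_mem_stdSimplex hx
    have h1 := hF.comp continuous_chart.continuousOn hch
    have h2 := fun j => (hE j).comp continuous_chart.continuousOn hch
    refine continuousOn_const.mul (ContinuousOn.cexp ((continuousOn_const.mul h1).add
      (continuousOn_finsetSum _ fun j _ => continuousOn_const.mul (h2 j))))
  exact this.congr fun x hx => (h _ (chart_mem_stdSimplex hx)).2.2

theorem continuousOn_phi : ContinuousOn
    (fun q : (Fin d → ℝ) × (Fin (n + 1) → ℂ) => T.phi q.1 q.2) (solidSimplex d ×ˢ T.domain) := by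
  unfold phi
  refine ContinuousOn.mul (T.continuousOn_branch.comp continuous_fst.continuousOn
    fun q hq => hq.1) (ContinuousOn.cpow ?_ continuousOn_const fun q hq => hq.2 _ hq.1)
  exact (T.continuousOn_f _).div ((T.continuousOn_f_right z₀).comp continuous_fst.continuousOn
    fun q hq => hq.1) fun q hq => T.f_param_ne_zero hq.1

theorem continuousOn_evalInv (p : MvPolynomial (Fin (n + 1)) ℂ) : ContinuousOn
    (fun x => MvPolynomial.eval (fun j => (ellVal A j (T.param x))⁻¹) p) (solidSimplex d) :=
  (MvPolynomial.continuous_eval p).comp_continuousOn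
    (continuousOn_pi.2 fun j => T.continuousOn_ell_inv j)

theorem continuousOn_integrand (m : ℤ) (p : MvPolynomial (Fin (n + 1)) ℂ) : ContinuousOn
    (fun q : (Fin d → ℝ) × (Fin (n + 1) → ℂ) => T.integrand m p q.1 q.2)
      (solidSimplex d ×ˢ T.domain) := by
  have h1 : Set.MapsTo Prod.fst (solidSimplex d ×ˢ T.domain) (solidSimplex d) := fun q hq => hq.1
  refine ((T.continuousOn_phi.mul ((T.continuousOn_f _).zpow₀ m fun q hq => Or.inl ?_)).mul
    ((T.continuousOn_evalInv p).comp continuous_fst.continuousOn h1)).mul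
    (T.continuous_pullbackOmega.comp continuous_fst).continuousOn
  exact T.f_ne_zero_of_mem_domain hq.2 hq.1

theorem hasFDerivAt_fVal (t : Fin (d + 1) → ℂ) (z : Fin (n + 1) → ℂ) :
    HasFDerivAt (fVal A t) (linForm fun j => (ellVal A j t)⁻¹) z := by
  have : fVal A t = linForm fun j => (ellVal A j t)⁻¹ := by
    funext z
    simp [fVal, linForm, div_eq_mul_inv, mul_comm]
  rw [this]
  exact (linForm fun j => (ellVal A j t)⁻¹).hasFDerivAt

theorem hasFDerivAt_integrand (m : ℤ) (p : MvPolynomial (Fin (n + 1)) ℂ) {x : Fin d → ℝ}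
    (hx : x ∈ solidSimplex d) {z : Fin (n + 1) → ℂ} (hz : z ∈ T.domain) :
    HasFDerivAt (T.integrand m p x) (linForm fun j => (-(sParam d u + d + 1) + m) *
      T.integrand (m - 1) (MvPolynomial.X j * p) x z) z := by
  -- The integrand depends on z only through y = f(t, z), as (y/f₀)^κ y^m. The chain rule then
  -- brings in ∂f/∂z_j = 1/ℓ_j.
  set κ := -(sParam d u + d + 1)
  set t := T.param x
  set f₀ := fVal A t z₀
  have hf₀ : f₀ ≠ 0 := T.f_param_ne_zero hx
  have hf : fVal A t z ≠ 0 := T.f_ne_zero_of_mem_domain hz hx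
  have h1 : HasDerivAt (fun y : ℂ => (y / f₀) ^ κ * y ^ m)
      ((κ + m) * ((fVal A t z / f₀) ^ κ * fVal A t z ^ (m - 1))) (fVal A t z) := by
    have h2 : HasDerivAt (fun y : ℂ => (y / f₀) ^ κ)
        (κ * (fVal A t z / f₀) ^ (κ - 1) * (1 / f₀)) (fVal A t z) :=
      ((hasDerivAt_id _).div_const f₀).cpow_const (hz x hx)
    have h3 := h2.mul (hasDerivAt_zpow m (fVal A t z) (Or.inl hf))
    refine h3.congr_deriv ?_
    rw [Complex.cpow_sub _ _ (div_ne_zero hf hf₀), Complex.cpow_one, zpow_sub_one₀ hf]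
    field_simp
  have h4 := (h1.comp_hasFDerivAt z (hasFDerivAt_fVal t z)).const_mul (T.branch (chart x) *
    (MvPolynomial.eval (fun j => (ellVal A j t)⁻¹) p * pullbackOmega T.map x))
  refine (h4.congr_of_eventuallyEq (Filter.Eventually.of_forall fun y => ?_)).congr_fderiv ?_
  · simp only [integrand, phi, Function.comp]
    ring
  · ext v
    simp only [linForm, integrand, phi, smul_apply,
      sum_apply, ContinuousLinearMap.proj_apply, smul_eq_mul, Finset.mul_sum,
      map_mul, MvPolynomial.eval_X]
    refine Finset.sum_congr rfl fun j _ => ?_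
    ring

end TwistedSimplex
end simplex


/-! ## The exact form on a twisted simplex -/

section exactness

open MeasureTheory Topology

/-- A continuous logarithm of a differentiable function is differentiable: by continuity |Im(L t - L
t₀)| < 1 < π near t₀, so L agrees there with L t₀ plus the principal logarithm of g t / g t₀.
Branches are given by logarithms that are only continuous. -/
theorem hasDerivAt_of_exp_eventuallyEq {L g : ℝ → ℂ} {g' : ℂ} {t₀ : ℝ} (hL : ContinuousAt L t₀)
    (hg : HasDerivAt g g' t₀) (h : ∀ᶠ t in 𝓝 t₀, Complex.exp (L t) = g t) :
    HasDerivAt L (g' / g t₀) t₀ := by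
  have h0 : Complex.exp (L t₀) = g t₀ := h.self_of_nhds
  have hne : g t₀ ≠ 0 := h0 ▸ Complex.exp_ne_zero _
  have h1 : HasDerivAt (fun t => L t₀ + Complex.log (g t / g t₀)) (g' / g t₀) t₀ := by
    have h2 : HasDerivAt (fun t => g t / g t₀) (g' / g t₀) t₀ := hg.div_const _
    have h3 := (h2.clog_real (by simp [div_self hne])).const_add (L t₀)
    simpa [div_self hne] using h3
  refine h1.congr_of_eventuallyEq ?_
  have hnear : ∀ᶠ t in 𝓝 t₀, ‖L t - L t₀‖ < 1 := by
    have := hL.eventually (Metric.ball_mem_nhds (L t₀) one_pos)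
    simpa [dist_eq_norm] using this
  filter_upwards [h, hnear] with t ht ht'
  rw [← ht, ← h0, ← Complex.exp_sub]
  have him : |(L t - L t₀).im| < 1 := (Complex.abs_im_le_norm _).trans_lt ht'
  rw [abs_lt] at him
  rw [Complex.log_exp (by linarith [Real.pi_gt_three]) (by linarith [Real.pi_gt_three])]
  ring

variable {d n : ℕ} {A : Matrix (Fin (d + 1)) (Fin (n + 1)) ℂ} {u : Fin (n + 1) → ℂ}
  {z₀ : Fin (n + 1) → ℂ}

namespace TwistedSimplex

variable (T : TwistedSimplex A u z₀)

/-- The coefficients of the differential of the branch of `φ f ^ d`. -/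
def gradient (z : Fin (n + 1) → ℂ) (a : Fin (d + 1)) (x : Fin d → ℝ) : ℂ :=
  T.phi x z * fVal A (T.param x) z ^ (d : ℤ) *
    ((∑ j, A a j * (u j * (ellVal A j (T.param x))⁻¹))
      - (-(sParam d u + d + 1) + d) * (fVal A (T.param x) z)⁻¹ *
        ∑ j, A a j * (z j * (ellVal A j (T.param x))⁻¹ ^ 2))

theorem sum_gradient_mul (z : Fin (n + 1) → ℂ) (x : Fin d → ℝ) (v : Fin (d + 1) → ℂ) :
    ∑ a, T.gradient z a x * v a = T.phi x z * fVal A (T.param x) z ^ (d : ℤ) *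
    ((∑ j, u j * (ellVal A j (T.param x))⁻¹ * ellVal A j v)
      - (-(sParam d u + d + 1) + d) * (fVal A (T.param x) z)⁻¹ *
        ∑ j, z j * (ellVal A j (T.param x))⁻¹ ^ 2 * ellVal A j v) := by
  have key : ∀ b : Fin (n + 1) → ℂ, ∑ a, (∑ j, A a j * b j) * v a
      = ∑ j, b j * ellVal A j v := by
    intro b
    simp only [Finset.sum_mul, ellVal, Finset.mul_sum]
    rw [Finset.sum_comm]
    refine Finset.sum_congr rfl fun j _ => Finset.sum_congr rfl fun a _ => ?_
    ring
  rw [← key, ← key]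
  rw [Finset.mul_sum, ← Finset.sum_sub_distrib, Finset.mul_sum]
  refine Finset.sum_congr rfl fun a _ => ?_
  unfold gradient
  ring

/-- Euler's relation for φ f^d, which has degree ∑ u_j - (κ+d) = ∑ u_j + s + 1 = -d in t. This is
the hypothesis `hE` of `stokes_form` when d = m+1. -/
theorem sum_gradient_mul_param {z : Fin (n + 1) → ℂ} (hz : z ∈ T.domain) {x : Fin d → ℝ}
    (hx : x ∈ solidSimplex d) : ∑ a, T.gradient z a x * T.param x a
      = -(d * (T.phi x z * fVal A (T.param x) z ^ (d : ℤ))) := by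
  have hf := T.f_ne_zero_of_mem_domain hz hx
  have h1 : ∑ j, u j * (ellVal A j (T.param x))⁻¹ * ellVal A j (T.param x) = ∑ j, u j := by
    refine Finset.sum_congr rfl fun j _ => ?_
    rw [mul_assoc, inv_mul_cancel₀ (T.ell_param_ne_zero hx j), mul_one]
  have h2 : ∑ j, z j * (ellVal A j (T.param x))⁻¹ ^ 2 * ellVal A j (T.param x)
      = fVal A (T.param x) z := by
    unfold fVal
    refine Finset.sum_congr rfl fun j _ => ?_
    have := T.ell_param_ne_zero hx j
    field_simp
  rw [T.sum_gradient_mul, h1, h2, mul_assoc _ (fVal A (T.param x) z)⁻¹, inv_mul_cancel₀ hf, sParam]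
  ring

theorem continuousOn_phi_right {z : Fin (n + 1) → ℂ} (hz : z ∈ T.domain) :
    ContinuousOn (fun x => T.phi x z) (solidSimplex d) :=
  T.continuousOn_phi.comp (f := fun x => (x, z)) (by fun_prop) fun _ hx => ⟨hx, hz⟩

theorem continuousOn_primitive {z : Fin (n + 1) → ℂ} (hz : z ∈ T.domain) :
    ContinuousOn (fun x => T.phi x z * fVal A (T.param x) z ^ (d : ℤ)) (solidSimplex d) :=
  (T.continuousOn_phi_right hz).mul ((T.continuousOn_f_right z).zpow₀ _ fun _ hx =>
    Or.inl (T.f_ne_zero_of_mem_domain hz hx))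

theorem continuousOn_gradient {z : Fin (n + 1) → ℂ} (hz : z ∈ T.domain) (a : Fin (d + 1)) :
    ContinuousOn (T.gradient z a) (solidSimplex d) := by
  refine (T.continuousOn_primitive hz).mul (ContinuousOn.sub ?_ (ContinuousOn.mul
    (continuousOn_const.mul ((T.continuousOn_f_right z).inv₀ fun _ hx =>
      T.f_ne_zero_of_mem_domain hz hx)) ?_))
  · exact continuousOn_finsetSum _ fun j _ => continuousOn_const.mul
      (continuousOn_const.mul (T.continuousOn_ell_inv j))
  · exact continuousOn_finsetSum _ fun j _ => continuousOn_const.mul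
      (continuousOn_const.mul ((T.continuousOn_ell_inv j).pow 2))

/-- The branch at z₀ has logarithmic derivative κ df(z₀)/f(z₀) + ∑ u_i dℓ_i/ℓ_i. The continuation
factor (f(z)/f(z₀))^κ replaces the first summand by κ df(z)/f(z), so z₀ disappears from the
logarithmic derivative. -/
theorem hasDerivAt_primitive {z : Fin (n + 1) → ℂ} (hz : z ∈ T.domain) {x : Fin d → ℝ}
    (hx : x ∈ openSimplex d) (j : Fin d) :
    HasDerivAt (fun t => T.phi (Function.update x j t) z *
        fVal A (T.param (Function.update x j t)) z ^ (d : ℤ))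
      (∑ a, T.gradient z a x * partials T.param x j a) (x j) := by
  have hxS := openSimplex_subset d hx
  set κ := -(sParam d u + d + 1) with hκ
  set v := partials T.param x j
  have hup : Function.update x j (x j) = x := Function.update_eq_self j x
  have hpath : HasDerivAt (fun t => Function.update x j t) (Pi.single j (1 : ℝ)) (x j) :=
    hasDerivAt_update x j (x j)
  have hy : HasDerivAt (fun t => T.param (Function.update x j t)) v (x j) := by
    have h1 := (T.contDiff_param.differentiable (by simp) x).hasFDerivAt
    rw [← hup] at h1
    have h2 := h1.comp_hasDerivAt (x j) hpath
    rw [hup] at h2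
    exact h2
  have hell : ∀ i, HasDerivAt (fun t => ellVal A i (T.param (Function.update x j t)))
      (ellVal A i v) (x j) := by
    intro i
    unfold ellVal
    exact HasDerivAt.fun_sum fun a _ => ((hasDerivAt_pi.1 hy) a).const_mul _
  have hl0 : ∀ i, ellVal A i (T.param x) ≠ 0 := T.ell_param_ne_zero hxS
  have hf : ∀ y : Fin (n + 1) → ℂ, HasDerivAt
      (fun t => fVal A (T.param (Function.update x j t)) y)
      (-∑ i, y i * (ellVal A i (T.param x))⁻¹ ^ 2 * ellVal A i v) (x j) := by
    intro y
    unfold fVal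
    rw [← Finset.sum_neg_distrib]
    refine HasDerivAt.fun_sum fun i _ => ?_
    have h1 := ((hell i).fun_inv (by rw [hup]; exact hl0 i)).const_mul (y i)
    simp only [div_eq_mul_inv]
    refine h1.congr_deriv ?_
    rw [hup]
    field_simp
  have hnear : ∀ᶠ t in 𝓝 (x j), Function.update x j t ∈ solidSimplex d := by
    have h1 : ContinuousAt (fun t => Function.update x j t) (x j) := hpath.continuousAt
    refine h1.eventually_mem ?_
    rw [hup]
    exact Filter.mem_of_superset ((isOpen_openSimplex d).mem_nhds hx) (openSimplex_subset d)
  obtain ⟨c, lE, lF, hlE, hlF, hb⟩ := T.isBranch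
  have hcont : ∀ {L : (Fin (d + 1) → ℝ) → ℂ}, ContinuousOn L (stdSimplex ℝ (Fin (d + 1))) →
      ContinuousAt (fun t => L (chart (Function.update x j t))) (x j) := by
    intro L hL
    have h1 : ContinuousOn (fun x => L (chart x)) (solidSimplex d) :=
      hL.comp continuous_chart.continuousOn fun _ hx => chart_mem_stdSimplex hx
    have h2 : ContinuousAt (fun x => L (chart x)) x := h1.continuousAt
      (Filter.mem_of_superset ((isOpen_openSimplex d).mem_nhds hx) (openSimplex_subset d))
    rw [← hup] at h2
    exact h2.comp (f := fun t => Function.update x j t) hpath.continuousAt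
  have dE : ∀ i, HasDerivAt (fun t => lE i (chart (Function.update x j t)))
      (ellVal A i v / ellVal A i (T.param x)) (x j) := by
    intro i
    have := hasDerivAt_of_exp_eventuallyEq (hcont (hlE i)) (hell i)
      (hnear.mono fun t ht => (hb _ (chart_mem_stdSimplex ht)).1 i)
    rwa [hup] at this
  have dF : HasDerivAt (fun t => lF (chart (Function.update x j t)))
      ((-∑ i, z₀ i * (ellVal A i (T.param x))⁻¹ ^ 2 * ellVal A i v) / fVal A (T.param x) z₀)
      (x j) := by
    have := hasDerivAt_of_exp_eventuallyEq (hcont hlF) (hf z₀)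
      (hnear.mono fun t ht => (hb _ (chart_mem_stdSimplex ht)).2.1)
    rwa [hup] at this
  have dB : HasDerivAt (fun t => T.branch (chart (Function.update x j t)))
      (T.branch (chart x) * (κ * ((-∑ i, z₀ i * (ellVal A i (T.param x))⁻¹ ^ 2 * ellVal A i v)
        / fVal A (T.param x) z₀) + ∑ i, u i * (ellVal A i v / ellVal A i (T.param x)))) (x j) := by
    have h1 := (((dF.const_mul κ).add (HasDerivAt.fun_sum fun i (_ : i ∈ Finset.univ) =>
      (dE i).const_mul (u i))).cexp).const_mul c
    refine (h1.congr_of_eventuallyEq (hnear.mono fun t ht =>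
      (hb _ (chart_mem_stdSimplex ht)).2.2)).congr_deriv ?_
    rw [(hb _ (chart_mem_stdSimplex hxS)).2.2]
    simp only [Pi.add_apply, hup]
    ring
  have hf0 := T.f_param_ne_zero hxS
  have hfz := T.f_ne_zero_of_mem_domain hz hxS
  have dR : HasDerivAt (fun t => (fVal A (T.param (Function.update x j t)) z /
      fVal A (T.param (Function.update x j t)) z₀) ^ κ)
      ((fVal A (T.param x) z / fVal A (T.param x) z₀) ^ κ * κ *
        ((-∑ i, z i * (ellVal A i (T.param x))⁻¹ ^ 2 * ellVal A i v) / fVal A (T.param x) z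
        - (-∑ i, z₀ i * (ellVal A i (T.param x))⁻¹ ^ 2 * ellVal A i v)
          / fVal A (T.param x) z₀)) (x j) := by
    have h1 := (hf z).fun_div (hf z₀) (by rw [hup]; exact hf0)
    have h2 : HasDerivAt (fun y : ℂ => y ^ κ) (κ * (fVal A (T.param x) z /
        fVal A (T.param x) z₀) ^ (κ - 1)) (fVal A (T.param (Function.update x j (x j))) z /
        fVal A (T.param (Function.update x j (x j))) z₀) := by
      rw [hup]
      have := (hasDerivAt_id (fVal A (T.param x) z / fVal A (T.param x) z₀)).cpow_const
        (c := κ) (hz x hxS)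
      simpa using this
    refine (h2.comp (x j) h1).congr_deriv ?_
    rw [hup, Complex.cpow_sub _ _ (div_ne_zero hfz hf0), Complex.cpow_one]
    field_simp
  have dP : HasDerivAt (fun t => fVal A (T.param (Function.update x j t)) z ^ (d : ℤ))
      (d * fVal A (T.param x) z ^ ((d : ℤ) - 1) *
        (-∑ i, z i * (ellVal A i (T.param x))⁻¹ ^ 2 * ellVal A i v)) (x j) := by
    have h2 : HasDerivAt (fun y : ℂ => y ^ (d : ℤ)) (d * fVal A (T.param x) z ^ ((d : ℤ) - 1))
        (fVal A (T.param (Function.update x j (x j))) z) := by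
      rw [hup]
      simpa using hasDerivAt_zpow (d : ℤ) (fVal A (T.param x) z) (Or.inl hfz)
    exact h2.comp (x j) (hf z)
  have h := (dB.mul dR).mul dP
  refine h.congr_deriv ?_
  simp only [Pi.mul_apply, hup]
  rw [T.sum_gradient_mul, zpow_sub_one₀ hfz, phi, ← hκ]
  have hu : ∑ i, u i * (ellVal A i v / ellVal A i (T.param x))
      = ∑ i, u i * (ellVal A i (T.param x))⁻¹ * ellVal A i v :=
    Finset.sum_congr rfl fun i _ => by ring
  rw [hu]
  ring

end TwistedSimplex
end exactness


/-! ## Faces of twisted simplices -/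

section faces

open MeasureTheory Topology

/-- `faceMap` drops the zeroth barycentric coordinate, and `chart` restores it because the
coordinates on a face add up to 1. -/
theorem chart_faceMap {m : ℕ} (i : Fin (m + 2)) (w : Fin m → ℝ) :
    chart (faceMap i w) = face i (chart w) := by
  have h : ∑ k, face i (chart w) k = 1 := by
    rw [Fin.sum_univ_succAbove _ i]
    simp [face, chart, Fin.sum_univ_succ]
  rw [Fin.sum_univ_succ] at h
  funext k
  refine Fin.cases ?_ (fun k => ?_) k
  · simp only [chart, Fin.cons_zero, faceMap, Fin.tail]
    change 1 - ∑ k : Fin (m + 1), face i (chart w) k.succ = face i (chart w) 0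
    linarith
  · rfl

theorem faceMap_mem {m : ℕ} (i : Fin (m + 2)) {w : Fin m → ℝ} (hw : w ∈ solidSimplex m) :
    faceMap i w ∈ solidSimplex (m + 1) := by
  have hnn : ∀ k, 0 ≤ face i (chart w) k := by
    intro k
    rcases Fin.eq_self_or_eq_succAbove i k with rfl | ⟨k, rfl⟩
    · simp [face]
    · simpa [face] using (chart_mem_stdSimplex hw).1 k
  rw [← chart_faceMap] at hnn
  refine ⟨fun k => by simpa [chart] using hnn k.succ, by simpa [chart] using hnn 0⟩

theorem contDiff_chart {m : ℕ} : ContDiff ℝ ∞ (chart : (Fin m → ℝ) → Fin (m + 1) → ℝ) := by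
  refine contDiff_pi.2 fun i => ?_
  refine Fin.cases ?_ (fun i => ?_) i
  · simp only [chart, Fin.cons_zero]; fun_prop
  · simp only [chart, Fin.cons_succ]; fun_prop

theorem contDiff_face {m : ℕ} (i : Fin (m + 1)) :
    ContDiff ℝ ∞ (face i : (Fin m → ℝ) → Fin (m + 1) → ℝ) := by
  refine contDiff_pi.2 fun k => ?_
  rcases Fin.eq_self_or_eq_succAbove i k with rfl | ⟨k, rfl⟩
  · simp only [face, Fin.insertNth_apply_same]; fun_prop
  · simp only [face, Fin.insertNth_apply_succAbove]; fun_prop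

/-! ### Dependence on the choice of homogeneous coordinates -/

section scaling

variable {d n : ℕ} {A : Matrix (Fin (d + 1)) (Fin (n + 1)) ℂ}

theorem ellVal_smul (j : Fin (n + 1)) (c : ℂ) (t : Fin (d + 1) → ℂ) :
    ellVal A j (c • t) = c * ellVal A j t := by
  simp only [ellVal, Pi.smul_apply, smul_eq_mul, Finset.mul_sum]
  exact Finset.sum_congr rfl fun a _ => by ring

theorem fVal_smul (c : ℂ) (t : Fin (d + 1) → ℂ) (z : Fin (n + 1) → ℂ) :
    fVal A (c • t) z = c⁻¹ * fVal A t z := by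
  simp only [fVal, ellVal_smul, Finset.mul_sum]
  exact Finset.sum_congr rfl fun a _ => by rw [div_eq_mul_inv, mul_inv, div_eq_mul_inv]; ring

end scaling

/-- Changing the lift from t to c t turns the tangent vectors dt into c dt + (dc) t. The multiples
of t drop out and one factor c is left in each of the m+1 slots. -/
theorem alternating_cons_smul_add {m : ℕ} {M : Type*} [AddCommGroup M] [Module ℂ M]
    (f : M [⋀^Fin (m + 1)]→ₗ[ℂ] ℂ) (a : M) (w : Fin m → M) {c : ℂ} (hc : c ≠ 0)
    (b : Fin m → ℂ) :
    f (Fin.cons (c • a) fun k => c • w k + b k • a) = c ^ (m + 1) * f (Fin.cons a w) := by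
  have h1 : (fun k => c • w k + b k • a) = fun k => c • w k + (b k / c) • (c • a) := by
    funext k
    rw [smul_smul, div_mul_cancel₀ _ hc]
  have h2 : (Fin.cons (c • a) fun k => c • w k : Fin (m + 1) → M)
      = fun k => (fun _ => c) k • (Fin.cons a w : Fin (m + 1) → M) k := by
    funext k
    refine Fin.cases rfl (fun k => rfl) k
  rw [h1, alternating_cons_add_smul, h2, f.map_smul_univ]
  simp

variable {m n : ℕ} {A : Matrix (Fin (m + 1 + 1)) (Fin (n + 1)) ℂ} {u : Fin (n + 1) → ℂ}
  {z₀ : Fin (n + 1) → ℂ}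

namespace TwistedSimplex

variable (T : TwistedSimplex A u z₀)

/-- A face of a twisted simplex, parametrized by the solid simplex. -/
def facePoint (i : Fin (m + 2)) (w : Fin m → ℝ) : Fin (m + 2) → ℂ := T.map (face i (chart w))

theorem param_faceMap (i : Fin (m + 2)) (w : Fin m → ℝ) :
    T.param (faceMap i w) = T.facePoint i w := by
  rw [param, chart_faceMap, facePoint]

theorem contDiff_facePoint (i : Fin (m + 2)) : ContDiff ℝ ∞ (T.facePoint i) :=
  T.smooth.comp ((contDiff_face i).comp contDiff_chart)

/-- The pull-back to a face of the contraction of `f ^ d Ω` with a constant vector field, times the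
factor by which the branch changes between `z₀` and `z`. -/
def facePart (z : Fin (n + 1) → ℂ) (e : Fin (m + 2) → ℂ) (i : Fin (m + 2)) (w : Fin m → ℝ) : ℂ :=
  (fVal A (T.facePoint i w) z / fVal A (T.facePoint i w) z₀)
      ^ (-(sParam (m + 1) u + (m + 1 : ℕ) + 1))
    * fVal A (T.facePoint i w) z ^ ((m + 1 : ℕ) : ℤ)
    * detForm (m + 2) (Fin.cons e (Fin.cons (T.facePoint i w) (partials (T.facePoint i) w)))

/-- If two lifts of a face differ by a scalar function c, the determinant gains c^(m+1), the power
f^(m+1) gains c^(-(m+1)), and f(z)/f(z₀) does not change. So the product depends only on the face in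
ℙ^d. -/
theorem facePart_eq_of_sameFace {σ τ : TwistedSimplex A u z₀} {i j : Fin (m + 2)}
    (h : SameFace σ τ i j) (z : Fin (n + 1) → ℂ) (e : Fin (m + 2) → ℂ) {w : Fin m → ℝ}
    (hw : w ∈ openSimplex m) : τ.facePart z e j w = σ.facePart z e i w := by
  set ρ := σ.facePoint i
  set ρ' := τ.facePoint j
  have hρ0 : ∀ w ∈ solidSimplex m, ellVal A 0 (ρ w) ≠ 0 := fun w hw => by
    have := σ.ell_param_ne_zero (faceMap_mem i hw) 0
    rwa [param_faceMap] at this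
  -- `SameFace` gives scalars only pointwise. Writing them as quotients of values of ℓ_0 shows that
  -- they depend differentiably on w.
  set c : (Fin m → ℝ) → ℂ := fun w => ellVal A 0 (ρ' w) / ellVal A 0 (ρ w) with hcdef
  have hc : ∀ w ∈ solidSimplex m, c w ≠ 0 ∧ ρ' w = c w • ρ w := by
    intro w hw
    obtain ⟨b, hb0, hb⟩ := h (chart w) (chart_mem_stdSimplex hw)
    change ρ' w = b • ρ w at hb
    have hcb : c w = b := by
      rw [hcdef]
      simp only [hb, ellVal_smul]
      rw [mul_div_assoc, div_self (hρ0 w hw), mul_one]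
    rw [hcb]
    exact ⟨hb0, hb⟩
  have hwS := openSimplex_subset m hw
  obtain ⟨hc0, hcw⟩ := hc w hwS
  have hdρ : DifferentiableAt ℝ ρ w := (σ.contDiff_facePoint i).differentiable (by simp) w
  have hdρ' : DifferentiableAt ℝ ρ' w := (τ.contDiff_facePoint j).differentiable (by simp) w
  have hdell : ∀ {r : (Fin m → ℝ) → Fin (m + 2) → ℂ}, DifferentiableAt ℝ r w →
      DifferentiableAt ℝ (fun w => ellVal A 0 (r w)) w := by
    intro r hr
    unfold ellVal
    exact DifferentiableAt.fun_sum fun a _ => ((differentiableAt_pi.1 hr) a).const_mul _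
  have hdc : DifferentiableAt ℝ c w := by
    simp only [hcdef, div_eq_mul_inv]
    exact (hdell hdρ').mul ((hdell hdρ).inv (hρ0 w hwS))
  have hpart : partials ρ' w = fun k => c w • partials ρ w k + partials c w k • ρ w := by
    have he : ρ' =ᶠ[𝓝 w] fun w => c w • ρ w :=
      Filter.eventually_of_mem ((isOpen_openSimplex m).mem_nhds hw)
        fun w hw => (hc w (openSimplex_subset m hw)).2
    funext k
    unfold partials
    rw [he.fderiv_eq, fderiv_fun_smul hdc hdρ]
    rfl
  have hdet : detForm (m + 2) (Fin.cons e (Fin.cons (ρ' w) (partials ρ' w)))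
      = c w ^ (m + 1) * detForm (m + 2) (Fin.cons e (Fin.cons (ρ w) (partials ρ w))) := by
    rw [hpart, hcw]
    exact alternating_cons_smul_add ((detForm (m + 2)).toAlternatingMap.curryLeft e) (ρ w)
      (partials ρ w) hc0 (partials c w)
  unfold facePart
  change (fVal A (ρ' w) z / fVal A (ρ' w) z₀) ^ _ * fVal A (ρ' w) z ^ _ * _ = _
  rw [hdet, hcw, fVal_smul, fVal_smul, mul_div_mul_left _ _ (inv_ne_zero hc0), mul_zpow,
    inv_zpow, zpow_natCast, zpow_natCast]
  change _ = (fVal A (ρ w) z / fVal A (ρ w) z₀) ^ _ * fVal A (ρ w) z ^ _ * _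
  have := pow_ne_zero (m + 1) hc0
  field_simp
  rfl

end TwistedSimplex

/-! ### Cancellation along the boundary of a cycle -/

theorem sameFace_refl (σ : TwistedSimplex A u z₀) (i : Fin (m + 1 + 1)) : SameFace σ σ i i :=
  fun _ _ => ⟨1, one_ne_zero, (one_smul _ _).symm⟩

theorem SameFace.symm {σ τ : TwistedSimplex A u z₀} {i j : Fin (m + 1 + 1)}
    (h : SameFace σ τ i j) : SameFace τ σ j i := by
  intro y hy
  obtain ⟨c, hc, h⟩ := h y hy
  exact ⟨c⁻¹, inv_ne_zero hc, by rw [h, smul_smul, inv_mul_cancel₀ hc, one_smul]⟩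

theorem SameFace.trans {σ τ υ : TwistedSimplex A u z₀} {i j k : Fin (m + 1 + 1)}
    (h : SameFace σ τ i j) (h' : SameFace τ υ j k) : SameFace σ υ i k := by
  intro y hy
  obtain ⟨c, hc, h⟩ := h y hy
  obtain ⟨c', hc', h'⟩ := h' y hy
  exact ⟨c' * c, mul_ne_zero hc' hc, by rw [h', h, smul_smul]⟩

namespace TwistedCycle

variable (Γ : TwistedCycle A u z₀)

/-- The relation of two faces of a cycle to be the same singular simplex. -/
def faceSetoid : Setoid (Fin Γ.size × Fin (m + 2)) where
  r p q := SameFace (Γ.simplex p.1) (Γ.simplex q.1) p.2 q.2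
  iseqv := ⟨fun _ => sameFace_refl _ _, SameFace.symm, SameFace.trans⟩

/-- Faces are grouped into classes of equal singular simplices. On a class `facePart` is constant
and factors out, leaving the signed sum of branches, which is zero by the cycle condition. -/
theorem sum_face_eq_zero (z : Fin (n + 1) → ℂ) (e : Fin (m + 2) → ℂ) {w : Fin m → ℝ}
    (hw : w ∈ openSimplex m) :
    ∑ p : Fin Γ.size × Fin (m + 2), (-1) ^ (p.2 : ℕ) *
      ((Γ.simplex p.1).branch (face p.2 (chart w)) * (Γ.simplex p.1).facePart z e p.2 w) = 0 := by
  classical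
  refine Finset.sum_cancels_of_partition_cancels Γ.faceSetoid fun q _ => ?_
  have h := Γ.boundary_eq_zero q.1 q.2 (chart w)
    (chart_mem_stdSimplex (openSimplex_subset m hw))
  rw [← Finset.sum_filter] at h
  rw [← mul_zero ((Γ.simplex q.1).facePart z e q.2 w), ← h, Finset.mul_sum]
  refine Finset.sum_congr ?_ fun _ hp => ?_
  · ext p
    simp only [Finset.mem_filter]
    exact and_congr_right fun _ => ⟨SameFace.symm, SameFace.symm⟩
  · rw [TwistedSimplex.facePart_eq_of_sameFace (Finset.mem_filter.1 hp).2 z e hw]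
    ring

end TwistedCycle
end faces


/-! ## Stokes' theorem for twisted cycles -/

section cycles

open MeasureTheory Topology

section

variable {m n : ℕ} {A : Matrix (Fin (m + 1 + 1)) (Fin (n + 1)) ℂ} {u : Fin (n + 1) → ℂ}
  {z₀ : Fin (n + 1) → ℂ}

theorem TwistedSimplex.branch_mul_facePart (T : TwistedSimplex A u z₀) (z : Fin (n + 1) → ℂ)
    (e : Fin (m + 2) → ℂ) (i : Fin (m + 2)) (w : Fin m → ℝ) :
    T.branch (face i (chart w)) * T.facePart z e i w
      = T.phi (faceMap i w) z * fVal A (T.param (faceMap i w)) z ^ ((m + 1 : ℕ) : ℤ) *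
        detForm (m + 2) (Fin.cons e (Fin.cons (T.param (faceMap i w))
            (partials (fun w => T.param (faceMap i w)) w))) := by
  rw [show (fun w => T.param (faceMap i w)) = T.facePoint i from funext (T.param_faceMap i),
    T.param_faceMap, phi, T.param_faceMap, chart_faceMap, facePart]
  ring

theorem continuous_faceMap (i : Fin (m + 2)) :
    Continuous (faceMap i : (Fin m → ℝ) → Fin (m + 1) → ℝ) :=
  continuous_pi fun k => (continuous_apply k.succ).comp
    ((contDiff_face i).continuous.comp continuous_chart)

theorem TwistedSimplex.continuousOn_branch_mul_facePart (T : TwistedSimplex A u z₀)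
    {z : Fin (n + 1) → ℂ} (hz : z ∈ T.domain) (e : Fin (m + 2) → ℂ) (i : Fin (m + 2)) :
    ContinuousOn (fun w => T.branch (face i (chart w)) * T.facePart z e i w)
      (solidSimplex m) := by
  simp only [T.branch_mul_facePart]
  refine ContinuousOn.mul ((T.continuousOn_primitive hz).comp
    (continuous_faceMap i).continuousOn fun w hw => faceMap_mem i hw) (Continuous.continuousOn ?_)
  rw [show (fun w => T.param (faceMap i w)) = T.facePoint i from funext (T.param_faceMap i)]
  simp only [T.param_faceMap]
  refine (detForm (m + 2)).cont.comp (continuous_pi fun k => ?_)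
  refine Fin.cases continuous_const (fun k => ?_) k
  refine Fin.cases ?_ (fun k => ?_) k
  · exact (T.contDiff_facePoint i).continuous
  · exact (contDiff_partials (T.contDiff_facePoint i) k).continuous

theorem TwistedSimplex.integral_gradient (T : TwistedSimplex A u z₀) {z : Fin (n + 1) → ℂ}
    (hz : z ∈ T.domain) (a : Fin (m + 2)) :
    ∫ x in solidSimplex (m + 1), T.gradient z a x * pullbackOmega T.map x
      = -∑ i : Fin (m + 2), (-1) ^ (i : ℕ) * ∫ w in solidSimplex m,
          T.branch (face i (chart w)) * T.facePart z (Pi.single a 1) i w := by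
  -- With e the a-th basis vector, the factor c(e) in Stokes' theorem is the a-th component of the
  -- gradient.
  have h := stokes_form T.contDiff_param (Pi.single a 1) (T.continuousOn_primitive hz)
    (T.continuousOn_gradient hz) (fun x hx j => T.hasDerivAt_primitive hz hx j)
    (fun x hx => by rw [T.sum_gradient_mul_param hz hx]; push_cast; rfl)
  simp only [branch_mul_facePart]
  refine Eq.trans (integral_congr_ae (Filter.Eventually.of_forall fun x => ?_)) h
  simp [pullbackOmega_eq, Pi.single_apply]

theorem TwistedCycle.sum_integral_gradient (Γ : TwistedCycle A u z₀) {z : Fin (n + 1) → ℂ}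
    (hz : ∀ k, z ∈ (Γ.simplex k).domain) (a : Fin (m + 2)) :
    ∑ k, ∫ x in solidSimplex (m + 1),
      (Γ.simplex k).gradient z a x * pullbackOmega (Γ.simplex k).map x = 0 := by
  rw [Finset.sum_congr rfl fun k _ => (Γ.simplex k).integral_gradient (hz k) a,
    Finset.sum_neg_distrib, neg_eq_zero, ← Fintype.sum_prod_type (f := fun p : Fin Γ.size × Fin (m + 2) =>
      (-1 : ℂ) ^ (p.2 : ℕ) * ∫ w in solidSimplex m, (Γ.simplex p.1).branch
        (face p.2 (chart w)) * (Γ.simplex p.1).facePart z (Pi.single a 1) p.2 w)]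
  simp only [← integral_const_mul]
  rw [← integral_finsetSum]
  · refine (setIntegral_congr_ae (measurableSet_solidSimplex m) ?_).trans (integral_zero _ _)
    filter_upwards [ae_mem_openSimplex m] with w hw hwS
    exact Γ.sum_face_eq_zero z (Pi.single a 1) (hw hwS)
  · intro p _
    exact (integrableOn_solidSimplex
      ((Γ.simplex p.1).continuousOn_branch_mul_facePart (hz p.1) _ p.2)).const_mul _

end

variable {d n : ℕ} {A : Matrix (Fin (d + 1)) (Fin (n + 1)) ℂ} {u : Fin (n + 1) → ℂ}
  {z₀ : Fin (n + 1) → ℂ}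

/-- The differential of `φ f ^ d` integrates to zero over a twisted cycle. -/
theorem TwistedCycle.sum_integral_gradient_eq_zero (Γ : TwistedCycle A u z₀)
    {z : Fin (n + 1) → ℂ} (hz : ∀ k, z ∈ (Γ.simplex k).domain) (a : Fin (d + 1)) :
    ∑ k, ∫ x in solidSimplex d,
      (Γ.simplex k).gradient z a x * pullbackOmega (Γ.simplex k).map x = 0 := by
  cases d with
  | succ m => exact Γ.sum_integral_gradient hz a
  -- For d = 0 there are no boundary terms: Ω is the single coordinate t_0, and Euler's relation in
  -- degree 0 makes the integrand vanish.
  | zero =>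
    refine Finset.sum_eq_zero fun k _ => ?_
    refine (setIntegral_congr_fun (measurableSet_solidSimplex 0) fun x hx => ?_).trans
      (integral_zero _ _)
    have h := (Γ.simplex k).sum_gradient_mul_param (hz k) hx
    rw [Fin.sum_univ_one, Nat.cast_zero, zero_mul, neg_zero] at h
    rw [TwistedSimplex.pullbackOmega_eq, detForm_apply, show a = 0 from Fin.fin_one_eq_zero a]
    exact (congrArg _ (Matrix.det_fin_one _)).trans h

end cycles

/-! ## Euler integrals -/

section holomorphic

variable {m : ℕ} {W : TopologicalSpace.Opens (Fin m → ℂ)}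

theorem Hol.val_add (g h : Hol W) (z : Fin m → ℂ) : (g + h).val z = g.val z + h.val z := rfl

theorem Hol.val_sub (g h : Hol W) (z : Fin m → ℂ) : (g - h).val z = g.val z - h.val z := rfl

theorem Hol.val_zero (z : Fin m → ℂ) : (0 : Hol W).val z = 0 := rfl

theorem Hol.val_sum {α : Type*} (s : Finset α) (g : α → Hol W) (z : Fin m → ℂ) :
    (∑ a ∈ s, g a).val z = ∑ a ∈ s, (g a).val z :=
  map_sum (AddMonoidHom.mk' (fun g : Hol W => g.val z) fun _ _ => rfl) g s

theorem Hol.algebraMap_smul (c : ℂ) (g : Hol W) (z : Fin m → ℂ) :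
    (algebraMap ℂ (Weyl (Fin m)) c • g).val z = c * g.val z := by
  change (Hol.action W (algebraMap ℂ _ c) g).val z = _
  rw [AlgHom.commutes]
  rfl

end holomorphic

section euler

open MeasureTheory Topology

variable {d n : ℕ} {A : Matrix (Fin (d + 1)) (Fin (n + 1)) ℂ} {u : Fin (n + 1) → ℂ}
  {z₀ : Fin (n + 1) → ℂ}

theorem eval_inv_eq_zero {p : MvPolynomial (Fin (n + 1)) ℂ} (hp : p ∈ reciprocalIdeal A)
    {t : Fin (d + 1) → ℂ} (ht : ∀ j, ellVal A j t ≠ 0) :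
    MvPolynomial.eval (fun j => (ellVal A j t)⁻¹) p = 0 := by
  rw [reciprocalIdeal, MvPolynomial.mem_vanishingIdeal_iff] at hp
  have := hp _ ⟨fun j => ellVal A j t, column_mem_span A t, ht, rfl⟩
  simpa [MvPolynomial.aeval_eq_eval] using this

namespace TwistedSimplex

variable (T : TwistedSimplex A u z₀)

theorem continuousOn_integrand_right (m : ℤ) (p : MvPolynomial (Fin (n + 1)) ℂ)
    {z : Fin (n + 1) → ℂ} (hz : z ∈ T.domain) :
    ContinuousOn (fun x => T.integrand m p x z) (solidSimplex d) :=
  (T.continuousOn_integrand m p).comp (f := fun x => (x, z)) (by fun_prop) fun _ hx => ⟨hx, hz⟩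

theorem sum_mul_integrand (m : ℤ) (p : MvPolynomial (Fin (n + 1)) ℂ) {z : Fin (n + 1) → ℂ}
    (hz : z ∈ T.domain) {x : Fin d → ℝ} (hx : x ∈ solidSimplex d) :
    ∑ j, z j * T.integrand (m - 1) (MvPolynomial.X j * p) x z = T.integrand m p x z := by
  have hf := T.f_ne_zero_of_mem_domain hz hx
  have h : T.integrand m p x z = T.phi x z * fVal A (T.param x) z ^ (m - 1) *
      (∑ j, z j / ellVal A j (T.param x))
      * MvPolynomial.eval (fun j => (ellVal A j (T.param x))⁻¹) p * pullbackOmega T.map x := by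
    rw [integrand, ← fVal, mul_assoc (T.phi x z) (_ ^ (m - 1)), ← zpow_add_one₀ hf, sub_add_cancel]
  rw [h, Finset.mul_sum, Finset.sum_mul, Finset.sum_mul]
  refine Finset.sum_congr rfl fun j _ => ?_
  rw [integrand, map_mul, MvPolynomial.eval_X]
  ring

end TwistedSimplex

/-! ### Integrals over a cycle as a power family -/

namespace TwistedCycle

variable (Γ : TwistedCycle A u z₀)

/-- The integral of the form `φ f ^ m p(1/ℓ) Ω` over a twisted cycle. -/
def integral (m : ℤ) (p : MvPolynomial (Fin (n + 1)) ℂ) (z : Fin (n + 1) → ℂ) : ℂ :=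
  ∑ k, ∫ x in solidSimplex d, (Γ.simplex k).integrand m p x z

variable {W : TopologicalSpace.Opens (Fin (n + 1) → ℂ)}

theorem exists_opens : ∃ W : TopologicalSpace.Opens (Fin (n + 1) → ℂ),
    z₀ ∈ W ∧ ∀ k, ∀ z ∈ W, z ∈ (Γ.simplex k).domain := by
  choose W hW h0 hsub using fun k => (Γ.simplex k).exists_open_subset_domain
  refine ⟨⟨⋂ k, W k, isOpen_iInter_of_finite hW⟩, Set.mem_iInter.2 h0, fun k z hz => ?_⟩
  exact hsub k (Set.mem_iInter.1 hz k)

theorem hasFDerivAt_integral (hW : ∀ k, ∀ z ∈ W, z ∈ (Γ.simplex k).domain) (m : ℤ)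
    (p : MvPolynomial (Fin (n + 1)) ℂ) {z : Fin (n + 1) → ℂ} (hz : z ∈ W) :
    HasFDerivAt (Γ.integral m p) (linForm fun j => (-(sParam d u + d + 1) + m) *
      Γ.integral (m - 1) (MvPolynomial.X j * p) z) z := by
  have h : ∀ k, HasFDerivAt (fun z => ∫ x in solidSimplex d, (Γ.simplex k).integrand m p x z)
      (linForm fun j => ∫ x in solidSimplex d, (-(sParam d u + d + 1) + m) *
        (Γ.simplex k).integrand (m - 1) (MvPolynomial.X j * p) x z) z := fun k =>
    hasFDerivAt_integral_of_continuousOn (isCompact_solidSimplex d) W.isOpen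
      (((Γ.simplex k).continuousOn_integrand m p).mono (Set.prod_mono_right (hW k)))
      (fun j => (continuousOn_const.mul ((Γ.simplex k).continuousOn_integrand (m - 1)
        (MvPolynomial.X j * p))).mono (Set.prod_mono_right (hW k)))
      (fun x hx z hz => (Γ.simplex k).hasFDerivAt_integrand m p hx (hW k z hz)) hz
  refine (HasFDerivAt.fun_sum fun k (_ : k ∈ Finset.univ) => h k).congr_fderiv ?_
  ext v
  simp only [linForm, sum_apply, smul_apply, ContinuousLinearMap.proj_apply, smul_eq_mul,
    integral, integral_const_mul, Finset.mul_sum, Finset.sum_mul]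
  exact Finset.sum_comm

theorem contDiffOn_integral (hW : ∀ k, ∀ z ∈ W, z ∈ (Γ.simplex k).domain) (m : ℤ)
    (p : MvPolynomial (Fin (n + 1)) ℂ) : ContDiffOn ℂ ∞ (Γ.integral m p) W := by
  -- Constant multiples belong to the family because each partial derivative brings out the factor
  -- κ+m.
  refine contDiffOn_of_family W.isOpen
    {g | ∃ (c : ℂ) (m : ℤ) (p : MvPolynomial (Fin (n + 1)) ℂ), g = fun z => c * Γ.integral m p z}
    ?_ ⟨1, m, p, by simp⟩
  rintro _ ⟨c, m, p, rfl⟩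
  refine ⟨fun j z => c * (-(sParam d u + d + 1) + m) *
    Γ.integral (m - 1) (MvPolynomial.X j * p) z, fun j => ⟨_, _, _, rfl⟩, fun z hz => ?_⟩
  refine ((Γ.hasFDerivAt_integral hW m p hz).const_mul c).congr_fderiv ?_
  ext v
  simp only [linForm, sum_apply, smul_apply, ContinuousLinearMap.proj_apply, smul_eq_mul,
    Finset.mul_sum, mul_assoc]

/-- The integral of the form `φ f ^ m p(1/ℓ) Ω` over a twisted cycle as a holomorphic function. -/
def holIntegral (hW : ∀ k, ∀ z ∈ W, z ∈ (Γ.simplex k).domain) (m : ℤ)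
    (p : MvPolynomial (Fin (n + 1)) ℂ) : Hol W :=
  Hol.mk (Γ.integral m p) (Γ.contDiffOn_integral hW m p)

variable (hW : ∀ k, ∀ z ∈ W, z ∈ (Γ.simplex k).domain)

theorem holIntegral_val (m : ℤ) (p : MvPolynomial (Fin (n + 1)) ℂ) {z : Fin (n + 1) → ℂ}
    (hz : z ∈ W) : (Γ.holIntegral hW m p).val z = Γ.integral m p z := Hol.mk_val _ hz

theorem integrable_integrand (k : Fin Γ.size) (m : ℤ) (p : MvPolynomial (Fin (n + 1)) ℂ)
    {z : Fin (n + 1) → ℂ} (hz : z ∈ (Γ.simplex k).domain) :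
    IntegrableOn (fun x => (Γ.simplex k).integrand m p x z) (solidSimplex d) :=
  integrableOn_solidSimplex ((Γ.simplex k).continuousOn_integrand_right m p hz)

theorem powerFamily_holIntegral :
    PowerFamily A (-(sParam d u + d + 1)) (Γ.holIntegral hW) where
  add m p q := Hol.ext fun z hz => by
    rw [Hol.val_add, holIntegral_val _ _ _ _ hz, holIntegral_val _ _ _ _ hz,
      holIntegral_val _ _ _ _ hz, integral, integral, integral, ← Finset.sum_add_distrib]
    refine Finset.sum_congr rfl fun k _ => ?_
    rw [← integral_add (Γ.integrable_integrand k m p (hW k z hz))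
      (Γ.integrable_integrand k m q (hW k z hz))]
    simp only [TwistedSimplex.integrand, map_add, mul_add, add_mul]
  smul m c p := Hol.ext fun z hz => by
    rw [Hol.algebraMap_smul, holIntegral_val _ _ _ _ hz, holIntegral_val _ _ _ _ hz, integral,
      integral, Finset.mul_sum]
    refine Finset.sum_congr rfl fun k _ => ?_
    rw [← integral_const_mul]
    refine integral_congr_ae (Filter.Eventually.of_forall fun x => ?_)
    simp only [TwistedSimplex.integrand, MvPolynomial.smul_eval]
    ring
  del m j p := Hol.ext fun z hz => by
    rw [Hol.algebraMap_smul, Hol.del_smul _ _ hz, holIntegral_val _ _ _ _ hz, holIntegral,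
      (Hol.mk_val_eventuallyEq _ hz).fderiv_eq, (Γ.hasFDerivAt_integral hW m p hz).fderiv,
      linForm_single]
  euler m p := Hol.ext fun z hz => by
    rw [Hol.val_sum, holIntegral_val _ _ _ _ hz, integral]
    simp only [Hol.z_smul _ _ hz, holIntegral_val _ _ _ _ hz, integral, Finset.mul_sum]
    rw [Finset.sum_comm]
    refine Finset.sum_congr rfl fun k _ => ?_
    simp only [← integral_const_mul]
    rw [← integral_finsetSum _ fun j _ =>
      (Γ.integrable_integrand k _ _ (hW k z hz)).const_mul _]
    exact setIntegral_congr_fun (measurableSet_solidSimplex d) fun x hx =>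
      (Γ.simplex k).sum_mul_integrand m p (hW k z hz) hx
  vanish m p hp := Hol.ext fun z hz => by
    rw [Hol.val_zero, holIntegral_val _ _ _ _ hz, integral]
    refine Finset.sum_eq_zero fun k _ => ?_
    refine (setIntegral_congr_fun (measurableSet_solidSimplex d) fun x hx => ?_).trans
      (integral_zero _ _)
    simp [TwistedSimplex.integrand,
      eval_inv_eq_zero hp ((Γ.simplex k).ell_param_ne_zero hx)]

/-- The bracket of `PowerFamily.opP_smul` for m = d+1 is minus the integral over the cycle of the
i-th gradient component times Ω, which is zero by Stokes. -/
theorem opP_smul_holIntegral (i : Fin (d + 1)) :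
    opP A u i • Γ.holIntegral hW ((d + 1 : ℕ) : ℤ) 1 = 0 := by
  rw [(Γ.powerFamily_holIntegral hW).opP_smul]
  refine (congrArg _ (Hol.ext fun z hz => ?_)).trans (smul_zero _)
  rw [Hol.val_sub, Hol.algebraMap_smul, Hol.val_sum, Hol.val_zero,
    ← neg_eq_zero, ← Γ.sum_integral_gradient_eq_zero (fun k => hW k z hz) i, neg_sub]
  simp only [Hol.z_smul _ _ hz, holIntegral_val _ _ _ _ hz, integral, Finset.mul_sum]
  rw [Finset.sum_comm, ← Finset.sum_sub_distrib]
  refine Finset.sum_congr rfl fun k _ => ?_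
  simp only [← integral_const_mul]
  have hint := fun m p => Γ.integrable_integrand k m p (hW k z hz)
  rw [← integral_finsetSum _ fun j _ => ((hint _ _).const_mul _).const_mul _,
    ← integral_sub (hint _ _)
      (integrable_finsetSum _ fun j _ => ((hint _ _).const_mul _).const_mul _)]
  refine setIntegral_congr_fun (measurableSet_solidSimplex d) fun x hx => ?_
  have hf := (Γ.simplex k).f_ne_zero_of_mem_domain (hW k z hz) hx
  have e1 : (((d + 1 : ℕ) : ℤ) - 1) = (d : ℤ) := by push_cast; ring
  have e2 : (((d + 1 : ℕ) : ℤ) - 2) = (d : ℤ) - 1 := by push_cast; ring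
  simp only [TwistedSimplex.integrand, TwistedSimplex.gradient, e1, e2, zpow_sub_one₀ hf,
    map_sum, MvPolynomial.smul_eval, map_pow, MvPolynomial.eval_X, mul_sub, sub_mul,
    Finset.mul_sum, Finset.sum_mul]
  congr 1
  · exact Finset.sum_congr rfl fun j _ => by ring
  · refine Finset.sum_congr rfl fun j _ => ?_
    push_cast
    ring

theorem eulerIntegral_eq (z : Fin (n + 1) → ℂ) :
    eulerIntegral Γ z = Γ.integral ((d + 1 : ℕ) : ℤ) 1 z := by
  simp only [eulerIntegral, integral, TwistedSimplex.integrand, TwistedSimplex.phi, map_one,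
    mul_one, zpow_natCast]
  rfl

theorem exists_holomorphic : ∃ (W : TopologicalSpace.Opens (Fin (n + 1) → ℂ)) (g : Hol W),
    z₀ ∈ W ∧ (∀ z ∈ W, g.val z = eulerIntegral Γ z) ∧ ∀ P ∈ hypIdeal A u, P • g = 0 := by
  obtain ⟨W, h0, hW⟩ := Γ.exists_opens
  refine ⟨W, Γ.holIntegral hW ((d + 1 : ℕ) : ℤ) 1, h0, fun z hz => ?_, fun P hP => ?_⟩
  · rw [Γ.holIntegral_val hW _ _ hz, eulerIntegral_eq]
  -- The submodule is ⊥ here, where for forms it was the coboundaries: integration over a cycle has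
  -- already killed exact forms.
  · have h := (Γ.powerFamily_holIntegral hW).hypIdeal_smul_mem ((d + 1 : ℕ) : ℤ)
      (by push_cast; ring) ⊥ (fun i => by
        rw [Γ.opP_smul_holIntegral hW i]; exact Submodule.zero_mem _) hP
    exact (Submodule.mem_bot _).1 h

end TwistedCycle
end euler

end MatroidHG

end

theorem mainTheorem8 {d n : ℕ} (hdn : d < n)
    (A : Matrix (Fin (d + 1)) (Fin (n + 1)) ℂ) (hrank : A.rank = d + 1)
    (hloop : ∀ j, ∃ i, A i j ≠ 0) (u : Fin (n + 1) → ℂ) :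
    (∃! ψ : HypSystem A u →ₗ[Weyl (Fin (n + 1))] HypCohomology A u,
      ψ (Submodule.Quotient.mk 1) = eulerClass A u hloop) ∧
    (∀ (z₀ : Fin (n + 1) → ℂ) (Γ : TwistedCycle A u z₀),
      ∃ (W : TopologicalSpace.Opens (Fin (n + 1) → ℂ)) (g : Hol W),
        z₀ ∈ W ∧ (∀ z ∈ W, g.val z = eulerIntegral Γ z) ∧
        ∀ P ∈ hypIdeal A u, P • g = 0) := by
  exact ⟨existsUnique_hom A u hloop, fun _ Γ => Γ.exists_holomorphic⟩
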